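/- **Setting.** Let $\mathcal M=(\mathcal S,\mathcal A,\{p_h\}_{h\in[H]},s_1,H)$ be an episodic Markov decision process with a finite set of $S$ states, a finite set of $A$ actions, horizon $H$, transition laws $p_h(\cdot\mid s,a)$ and initial state $s_1$. For a stochastic Markov policy $\pi$ let $p^\pi_h(s,a)=\mathbb P^\pi(s_h=s,a_h=a)$ and let $\Omega=\{p^\pi\}$ be the set of all these state-action distributions. Let $c:[H]\times\mathcal S\times\mathcal A\to\mathbb R$ be a target function such that $\mathcal X=\{(h,s,a):c_h(s,a)>0\}$ is non-empty, and for any such function put $$\varphi^\star(c)=\inf_{\rho\in\Omega}\ \max_{(h,s,a):\,c_h(s,a)>0}\frac{c_h(s,a)}{\rho_h(s,a)}\in(0,\infty]\qquad (x/0=\infty\text{ for }x>0).$$ Let $c_{\min}=\big(\min_{\mathcal X}c_h(s,a)\big)\vee 1$, $c_{\max}=\max_{h,s,a}c_h(s,a)$, $m=\lceil\log_2(c_{\max}/c_{\min})\rceil\vee 1$, $\mathcal X_0=\mathcal X$ and $\mathcal X_k=\{(h,s,a):c_h(s,a)>c_{\min}2^k\}$ for $k\ge1$. Let $n^t_h(s,a)$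 be the number of visits of $(s,a)$ at stage $h$ in the first $t$ episodes. **The algorithm** (CovGame with confidence $\delta\in(0,1)$). Start with $k_1=0$ and $\lambda^1$ uniform on $\mathcal X_0$. In episode $t=1,2,\dots$, UCBVI chooses a deterministic policy $\pi^t$ from the reward function $\lambda^t$ and the past episodes, and a trajectory $(s^t_h,a^t_h)_{h\in[H]}$ is generated with $\pi^t$. The algorithm stops, and $\tau=t$, if $n^t_h(s,a)\ge c_h(s,a)$ for all $(h,s,a)$. Otherwise let $k_{t+1}=\max\{j\in\mathbb N: n_h^t(s,a)\ge c_h(s,a)\ \forall (h,s,a)\in\mathcal X\setminus\mathcal X_j\}$. If $k_{t+1}\ne k_t$, the adversary is reset and $\lambda^{t+1}$ is uniform on $\mathcal X_{k_{t+1}}$; if $k_{t+1}=k_t$, the adversary is fed with the loss $\ell^t_h(s,a)=\mathbb 1(s_h^t=s,a_h^t=a)$ of each expert $(h,s,a)\in\mathcal X_{k_t}$ and returns $\lambda^{t+1}$. *Adversary (weighted majority forecaster with variance-dependent learning rate).* $\lambda^{t+1}_h(s,a)\propto\exp(-\xi L_h(s,a))$ on $\mathcal X_{k_{t+1}}$ and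 $0$ elsewhere, where $L$ is the cumulative loss since the last reset, $V$ is the sum, over the rounds since the last reset, of the variances of the loss vector under the weights played in the round, and $\xi=\min\{1,\ \kappa\sqrt{\ln|\mathcal X_{k_{t+1}}|/V}\}$ with $\kappa=\sqrt{2(\sqrt2-1)/(e-2)}$ ($\xi=1$ if $V=0$). *Learner (UCBVI with changing rewards, run with confidence $1-\delta'$, $\delta'=\delta/2$).* $\pi^t_h(s)\in\arg\max_a\overline Q^{t-1}_h(s,a;\lambda^t)$ (ties broken arbitrarily), where $\overline Q^t_H(s,a;r)=r_H(s,a)$ and, for $h<H$, with $n=n_h^t(s,a)$, $$\overline Q^t_h(s,a;r)=\Big(r_h(s,a)+\widehat P^t_{h,s,a}\overline V^t_{h+1}+\max\Big\{\sqrt{\tfrac{8\,\mathbb V(\widehat P^t_{h,s,a},\overline V^t_{h+1})\,\beta(n,\delta')}{n}},\ \tfrac{8\beta(n,\delta')}{n}\Big\}\Big)\wedge1,\qquad \overline V^t_{h+1}(s)=\max_a\overline Q^t_{h+1}(s,a;r)$$ ($\overline Q^t_h(s,a;r)=1$ if $n=0$). Here $\widehat P^t_{h,s,a}$ is the empirical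 transition law at $(h,s,a)$ after $t$ episodes, $\mathbb V(P,V)$ is the variance of $V$ under $P$, and $\beta(n,\delta')=\log(2SAH/\delta')+S\log(8e(n+1))$. **Claim.** With probability at least $1-\delta$, the stopping time of CovGame satisfies $$\tau\ \le\ 64\,m\,\varphi^\star(c)+\widetilde O\big(m\,\varphi^\star(\mathbb 1_{\mathcal X})\,SAH^2(\log(1/\delta)+S)\big),$$ where $\widetilde O$ hides poly-logarithmic factors in $S,A,H,\varphi^\star(\mathbb 1_{\mathcal X}),\log(1/\delta)$. That is, there are numerical constants $C>0$ and $d\in\mathbb N$ such that for every $\mathcal M$, $c$ and $\delta$ as above, with probability at least $1-\delta$, $$\tau\le 64\,m\,\varphi^\star(c)+C\,m\,\varphi^\star(\mathbb 1_{\mathcal X})\,SAH^2\big(\log(1/\delta)+S\big)\,\log^d\!\big(2+S+A+H+\varphi^\star(\mathbb 1_{\mathcal X})+\log(1/\delta)\big).$$ -/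

import Mathlib

open scoped ENNReal

namespace ActiveCoverage

/-- Tabular finite-horizon MDP with states `S`, actions `A`, horizon `H`. Stages are `0, …, H - 1`;
`trans h s a` is the law of the state reached at stage `h + 1` from `(s, a)` at stage `h`. -/
structure MDP (S A : Type*) (H : ℕ) where
  init : S
  trans : Fin H → S → A → PMF S

section

variable {S A : Type*} {H : ℕ}

/-- A trajectory `(s_h, a_h)_h` of one episode. -/
abbrev Traj (S A : Type*) (H : ℕ) := Fin H → S × A

/-- Stochastic Markov policies. -/
abbrev StochPolicy (S A : Type*) (H : ℕ) := Fin H → S → PMF A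

/-- Deterministic Markov policies. -/
abbrev DetPolicy (S A : Type*) (H : ℕ) := Fin H → S → A

/-- A deterministic policy as a stochastic one. -/
noncomputable def DetPolicy.toStoch (π : DetPolicy S A H) : StochPolicy S A H :=
  fun h s => PMF.pure (π h s)

open Classical in
/-- Probability that `s` is the state at stage `h` of the trajectory `x`, given the part of `x`
before stage `h`. -/
noncomputable def MDP.stateProb (M : MDP S A H) (x : Traj S A H) (h : Fin H) (s : S) : ℝ≥0∞ :=
  if h.val = 0 then (if s = M.init then 1 else 0)
  else
    let g : Fin H := ⟨h.val - 1, by omega⟩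
    M.trans g (x g).1 (x g).2 s

/-- Probability of the trajectory `x` when one episode is played with `π`. -/
noncomputable def MDP.trajProb (M : MDP S A H) (π : StochPolicy S A H) (x : Traj S A H) : ℝ≥0∞ :=
  ∏ h, M.stateProb x h (x h).1 * π h (x h).1 (x h).2

open Classical in
/-- State-action distribution `p_h^π(s,a) = ℙ^π(s_h = s, a_h = a)`. -/
noncomputable def MDP.occupancy [Fintype S] [Fintype A] (M : MDP S A H) (π : StochPolicy S A H)
    (z : Fin H × S × A) : ℝ≥0∞ :=
  ∑ x : Traj S A H, if x z.1 = z.2 then M.trajProb π x else 0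

/-- The coverage complexity
`φ*(c) = inf_{ρ ∈ Ω} max_{(h,s,a) : c_h(s,a) > 0} c_h(s,a) / ρ_h(s,a)`, in `[0, ∞]`
(a triplet with `c > 0` and `ρ = 0` contributes `∞`). -/
noncomputable def MDP.phiStar [Fintype S] [Fintype A] (M : MDP S A H)
    (c : Fin H × S × A → ℝ) : ℝ≥0∞ :=
  ⨅ π : StochPolicy S A H, ⨆ z : Fin H × S × A, ⨆ _ : 0 < c z,
    ENNReal.ofReal (c z) / M.occupancy π z

/-! ### Target functions -/

open Classical in
/-- `𝒳 = {(h,s,a) : c_h(s,a) > 0}`. -/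
noncomputable def target [Fintype S] [Fintype A] (c : Fin H × S × A → ℝ) :
    Finset (Fin H × S × A) :=
  Finset.univ.filter fun z => 0 < c z

open Classical in
/-- The indicator function `𝟙_𝒳`. -/
noncomputable def targetInd [Fintype S] [Fintype A] (c : Fin H × S × A → ℝ)
    (z : Fin H × S × A) : ℝ :=
  if z ∈ target c then 1 else 0

/-- `c_min = (min_{𝒳} c) ∨ 1`. -/
noncomputable def cmin [Fintype S] [Fintype A] (c : Fin H × S × A → ℝ) : ℝ :=
  max (⨅ z : target c, c z) 1

/-- `c_max = max_{h,s,a} c_h(s,a)`. -/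
noncomputable def cmax (c : Fin H × S × A → ℝ) : ℝ :=
  ⨆ z, c z

/-- `m = ⌈log₂(c_max / c_min)⌉ ∨ 1`. -/
noncomputable def numLevels [Fintype S] [Fintype A] (c : Fin H × S × A → ℝ) : ℕ :=
  max ⌈Real.logb 2 (cmax c / cmin c)⌉₊ 1

open Classical in
/-- `𝒳_0 = 𝒳` and `𝒳_k = {(h,s,a) : c_h(s,a) > c_min 2^k}` for `k ≥ 1`. -/
noncomputable def level [Fintype S] [Fintype A] (c : Fin H × S × A → ℝ) (k : ℕ) :
    Finset (Fin H × S × A) :=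
  if k = 0 then target c else Finset.univ.filter fun z => cmin c * 2 ^ k < c z

/-! ### Counts. In `y : ℕ → Traj S A H`, the entry `y i` is the trajectory of episode `i + 1`. -/

open Classical in
/-- `n_h^t(s,a)`: number of visits of `(h,s,a)` in the first `t` episodes. -/
noncomputable def counts (y : ℕ → Traj S A H) (t : ℕ) (z : Fin H × S × A) : ℕ :=
  ((Finset.range t).filter fun i => y i z.1 = z.2).card

open Classical in
/-- Number of the first `t` episodes in which `(s,a)` is played at stage `h` and the state
at stage `h + 1` is `s'`. -/
noncomputable def transCounts (y : ℕ → Traj S A H) (t : ℕ) (h : Fin H) (hh : h.val + 1 < H)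
    (s : S) (a : A) (s' : S) : ℕ :=
  ((Finset.range t).filter fun i => y i h = (s, a) ∧ (y i ⟨h.val + 1, hh⟩).1 = s').card

/-- All sampling requirements are met after `t` episodes. -/
def Covered (c : Fin H × S × A → ℝ) (y : ℕ → Traj S A H) (t : ℕ) : Prop :=
  ∀ z, c z ≤ (counts y t z : ℝ)

/-- The stopping time `τ` of CovGame: the first `t ≥ 1` such that all requirements are met
after episode `t` (`⊤` if there is none). -/
noncomputable def stoppingTime (c : Fin H × S × A → ℝ) (y : ℕ → Traj S A H) : ℕ∞ :=
  ⨅ t : ℕ, ⨅ _ : 1 ≤ t ∧ Covered c y t, (t : ℕ∞)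

/-! ### The adversary: weighted majority forecaster with variance-dependent learning rate -/

/-- Learning rate with `N` experts, losses of range at most `1` and past cumulative variance `V`:
`min {1, C √(ln N / V)}`, `C = √(2 (√2 - 1) / (e - 2))`, read as `1` if `V = 0`. -/
noncomputable def wmfRate (N : ℕ) (V : ℝ) : ℝ :=
  if V = 0 then 1
  else min 1 (√(2 * (√2 - 1) / (Real.exp 1 - 2)) * √(Real.log N / V))

/-- State of the forecaster: cumulative loss of each expert and cumulative variance of the losses
(under the weights that were played) since the last reset. -/
structure WMFState (ι : Type*) where
  loss : ι → ℝ
  var : ℝ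

/-- State after a reset. -/
def WMFState.reset (ι : Type*) : WMFState ι := ⟨fun _ => 0, 0⟩

open Classical in
/-- Weights of the forecaster on the set of experts `X` (uniform after a reset). -/
noncomputable def WMFState.weights {ι : Type*} (X : Finset ι) (W : WMFState ι) (z : ι) : ℝ :=
  if z ∈ X then
    Real.exp (-(wmfRate X.card W.var * W.loss z)) /
      ∑ z' ∈ X, Real.exp (-(wmfRate X.card W.var * W.loss z'))
  else 0

/-- Update of the forecaster on the experts `X` after the loss vector `l`. -/
noncomputable def WMFState.update {ι : Type*} (X : Finset ι) (W : WMFState ι) (l : ι → ℝ) :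
    WMFState ι where
  loss z := W.loss z + l z
  var := W.var + ∑ z ∈ X, W.weights X z * (l z - ∑ z' ∈ X, W.weights X z' * l z') ^ 2

/-- The level index `k` in force in episode `t + 1`. -/
noncomputable def levelIdx [Fintype S] [Fintype A] (c : Fin H × S × A → ℝ) (y : ℕ → Traj S A H) :
    ℕ → ℕ
  | 0 => 0
  | t + 1 => sSup {j : ℕ | ∀ z ∈ target c, z ∉ level c j → c z ≤ (counts y (t + 1) z : ℝ)}

open Classical in
/-- State of the forecaster at the start of episode `t + 1`: it is reset when the level index
changes, and otherwise fed with the loss `𝟙(s_h = s, a_h = a)` of the expert `(h,s,a)`. -/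
noncomputable def wmfState [Fintype S] [Fintype A] (c : Fin H × S × A → ℝ) (y : ℕ → Traj S A H) :
    ℕ → WMFState (Fin H × S × A)
  | 0 => WMFState.reset _
  | t + 1 =>
    if levelIdx c y (t + 1) ≠ levelIdx c y t then WMFState.reset _
    else (wmfState c y t).update (level c (levelIdx c y t)) fun z => if y t z.1 = z.2 then 1 else 0

/-- The reward function `λ` given to the learner in episode `t + 1`. -/
noncomputable def advReward [Fintype S] [Fintype A] (c : Fin H × S × A → ℝ) (y : ℕ → Traj S A H)
    (t : ℕ) : Fin H × S × A → ℝ :=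
  (wmfState c y t).weights (level c (levelIdx c y t))

/-! ### The learner: UCBVI with changing rewards -/

/-- `β(n, δ) = log(2SAH/δ) + S log(8e(n+1))`. -/
noncomputable def ucbBeta (S A : Type*) [Fintype S] [Fintype A] (H : ℕ) (δ : ℝ) (n : ℕ) : ℝ :=
  Real.log (2 * Fintype.card S * Fintype.card A * H / δ) +
    Fintype.card S * Real.log (8 * Real.exp 1 * (n + 1))

/-- Optimistic action values `Q̄_h^t(s,a;r)` built with confidence `1 - δ` from the first `t`
episodes. The bonus is infinite, hence the value is `1`, at an unvisited triplet before the last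
stage. -/
noncomputable def ucbQ [Fintype S] [Fintype A] (δ : ℝ) (y : ℕ → Traj S A H) (t : ℕ)
    (r : Fin H × S × A → ℝ) (h : Fin H) (s : S) (a : A) : ℝ :=
  if hh : h.val + 1 < H then
    if counts y t (h, s, a) = 0 then 1
    else
      let n : ℕ := counts y t (h, s, a)
      let V : S → ℝ := fun s' => ⨆ a' : A, ucbQ δ y t r ⟨h.val + 1, hh⟩ s' a'
      let P : S → ℝ := fun s' => (transCounts y t h hh s a s' : ℝ) / n
      let PV : ℝ := ∑ s', P s' * V s'
      let var : ℝ := ∑ s', P s' * (V s' - PV) ^ 2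
      let B : ℝ := max √(8 * var * ucbBeta S A H δ n / n) (8 * ucbBeta S A H δ n / n)
      min (r (h, s, a) + PV + B) 1
  else r (h, s, a)
termination_by H - h.val

/-- `π` is greedy for the action values `Q`. -/
def IsGreedy (Q : Fin H → S → A → ℝ) (π : DetPolicy S A H) : Prop :=
  ∀ h s a, Q h s a ≤ Q h s (π h s)

/-! ### The interaction -/

/-- `pol` and `traj` are the policies and trajectories of a run of CovGame (with the weighted
majority forecaster and UCBVI) on the MDP `M`, with target function `c` and confidence `δ`; entry
`t` belongs to episode `t + 1`. Each policy that is played before the algorithm stops is greedy for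
the optimistic values computed, with confidence `1 - δ/2`, from the past episodes and the current
reward function (ties are broken arbitrarily, possibly at random). Given the past and the current
policy, the trajectory has the law induced by this policy. What happens after the stopping time is
irrelevant: policies are arbitrary there. -/
structure IsCovGameRun [Fintype S] [Fintype A] (M : MDP S A H) (c : Fin H × S × A → ℝ) (δ : ℝ)
    {Ω : Type*} [MeasurableSpace Ω] (μ : MeasureTheory.Measure Ω)
    (pol : ℕ → Ω → DetPolicy S A H) (traj : ℕ → Ω → Traj S A H) : Prop where
  measurable_pol : ∀ t q, MeasurableSet {ω | pol t ω = q}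
  measurable_traj : ∀ t x, MeasurableSet {ω | traj t ω = x}
  greedy : ∀ (t : ℕ) ω, (t : ℕ∞) < stoppingTime c (fun i => traj i ω) →
    IsGreedy (ucbQ (δ / 2) (fun i => traj i ω) t (advReward c (fun i => traj i ω) t)) (pol t ω)
  law : ∀ (t : ℕ) (q : ℕ → DetPolicy S A H) (x : ℕ → Traj S A H),
    μ {ω | (∀ i < t, pol i ω = q i ∧ traj i ω = x i) ∧ pol t ω = q t ∧ traj t ω = x t} =
      μ {ω | (∀ i < t, pol i ω = q i ∧ traj i ω = x i) ∧ pol t ω = q t} *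
        M.trajProb (q t).toStoch (x t)

/-- The poly-logarithmic factor
`log (2 + S + A + H + φ*(𝟙_𝒳) + log(1/δ)) ^ d`. It is only used as a factor of `φ*(𝟙_𝒳)`, so
that its value when `φ*(𝟙_𝒳) = ∞` is irrelevant. -/
noncomputable def polyLog [Fintype S] [Fintype A] (M : MDP S A H) (c : Fin H × S × A → ℝ) (δ : ℝ)
    (d : ℕ) : ℝ :=
  Real.log (2 + Fintype.card S + Fintype.card A + H + (M.phiStar (targetInd c)).toReal
    + Real.log (1 / δ)) ^ d

end

end ActiveCoverage

/-! Write `φ_k` for the coverage complexity of the indicator of the level `𝒳_k`, `f = φ_0`, and let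
`k` be the level in force. CovGame is a zero-sum game in which the learner collects the weights `λ`
that the adversary puts on the triplets of `𝒳_k`. Any bound `V` on the values of all policies
satisfies `1 ≤ φ_k V` (`one_le_phiSet_mul`). The optimistic value of UCBVI is such a bound
(`sum_occupancy_mul_le_ucbV`), and it is at most twice the expected sum of rewards and confidence
widths under the policy played (`ucbV_le_two_mul_expect`). So every episode before the stopping time
accounts for at least `1` in the sum of `2 φ_k E[gain + widths]`.

A multiplicative Chernoff bound replaces expectations by realised values, at the price of a second
factor two. The gains are weighted by `φ_k / f`, so that one bound serves all levels. The realised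
widths form harmonic sums. The realised gain is the loss of the forecaster, at most `8/3` times the
loss of any expert up to a logarithm (`WMFState.Invariant.le`), and while `k` is in force some
triplet of `𝒳_k` has at most `c_min 2^(k+1)` visits. Since `φ_k c_min 2^k ≤ φ*(c) + f`
(`phiSet_level_mul_le`), the `m` levels give `T ≤ (64/3) m φ*(c)` plus lower-order terms containing
`log² T`, which `le_of_self_bounding` removes.

Both probabilistic inputs come from Ville's inequality. For the transitions, the supermartingale is
the likelihood ratio of Laplace's rule of succession to the true law. It yields `Typical`, a
statement about all test functions at once, from which the Bernstein-type bounds follow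
deterministically. -/

namespace ActiveCoverage

/-! ### Weights of paths of a finite Markov chain. -/

section Paths

variable {R B : Type*} [CommSemiring R] [Fintype B]

/-- Weight of a path of a Markov chain with initial weights `k₀` and kernels `K i`. -/
def pathWeight {n : ℕ} (k₀ : B → R) (K : Fin n → B → B → R) (x : Fin (n + 1) → B) : R :=
  k₀ (x 0) * ∏ i : Fin n, K i (x i.castSucc) (x i.succ)

theorem sum_snoc {n : ℕ} (F : (Fin (n + 1) → B) → R) :
    ∑ x, F x = ∑ y : Fin n → B, ∑ v, F (Fin.snoc (α := fun _ => B) y v) := by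
  rw [← (Fin.snocEquiv (fun _ : Fin (n + 1) => B)).sum_comp, Fintype.sum_prod_type,
    Finset.sum_comm]
  rfl

set_option linter.unusedSectionVars false in
theorem pathWeight_snoc {n : ℕ} (k₀ : B → R) (K : Fin (n + 1) → B → B → R) (y : Fin (n + 1) → B)
    (v : B) : pathWeight k₀ K (Fin.snoc (α := fun _ => B) y v) =
      pathWeight k₀ (fun i => K i.castSucc) y * K (Fin.last n) (y (Fin.last n)) v := by
  unfold pathWeight
  rw [Fin.prod_univ_castSucc, ← mul_assoc]
  congr 1
  · congr 1
    refine Finset.prod_congr rfl fun i _ => ?_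
    rw [Fin.snoc_castSucc, Fin.succ_castSucc, Fin.snoc_castSucc]
  · rw [Fin.snoc_castSucc, Fin.succ_last, Fin.snoc_last]

theorem sum_pathWeight {n : ℕ} (k₀ : B → R) (K : Fin n → B → B → R) (h₀ : ∑ v, k₀ v = 1)
    (hK : ∀ i u, ∑ v, K i u v = 1) : ∑ x, pathWeight k₀ K x = 1 := by
  induction n with
  | zero =>
    rw [← h₀, ← (Equiv.funUnique (Fin 1) B).sum_comp]
    exact Finset.sum_congr rfl fun x _ => by simp [pathWeight]
  | succ n ih =>
    rw [sum_snoc, ← ih (fun i => K i.castSucc) fun i => hK _]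
    refine Finset.sum_congr rfl fun y _ => ?_
    simp_rw [pathWeight_snoc, ← Finset.mul_sum, hK, mul_one]

/-- Markov property: the coordinates after `i.succ` are summed out from the last one down, because
every row of a kernel has sum one. -/
theorem sum_pathWeight_mul {n : ℕ} (k₀ : B → R) (K : Fin n → B → B → R)
    (hK : ∀ i u, ∑ v, K i u v = 1) (i : Fin n) (g : B → B → R) :
    ∑ x, pathWeight k₀ K x * g (x i.castSucc) (x i.succ) =
      ∑ x, pathWeight k₀ K x * ∑ v, K i (x i.castSucc) v * g (x i.castSucc) v := by
  induction n with
  | zero => exact i.elim0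
  | succ n ih =>
    rw [sum_snoc (n := n + 1), sum_snoc (n := n + 1)]
    simp_rw [pathWeight_snoc, Fin.snoc_castSucc]
    induction i using Fin.lastCases with
    | last =>
      simp_rw [Fin.succ_last, Fin.snoc_last]
      refine Finset.sum_congr rfl fun y _ => ?_
      simp_rw [← Finset.sum_mul, ← Finset.mul_sum, hK, mul_one, mul_assoc, ← Finset.mul_sum]
    | cast i =>
      simp_rw [Fin.succ_castSucc, Fin.snoc_castSucc, ← Finset.sum_mul, ← Finset.mul_sum, hK,
        mul_one]
      exact ih (fun i => K i.castSucc) (fun i => hK _) i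

end Paths

/-! ### Expectations over one episode. -/

section Expectation

variable {S A : Type*} {H : ℕ} [Fintype S] [Fintype A]

set_option linter.unusedSectionVars false in
open Classical in
theorem trajProb_eq_pathWeight {n : ℕ} (M : MDP S A (n + 1)) (π : StochPolicy S A (n + 1))
    (x : Traj S A (n + 1)) :
    M.trajProb π x = pathWeight
      (fun v : S × A => (if v.1 = M.init then 1 else 0) * π 0 v.1 v.2)
      (fun (i : Fin n) (u v : S × A) => M.trans i.castSucc u.1 u.2 v.1 * π i.succ v.1 v.2) x := by
  unfold MDP.trajProb pathWeight
  rw [Fin.prod_univ_succ]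
  congr 1

theorem PMF_sum_eq_one {B : Type*} [Fintype B] (p : PMF B) : ∑ b, p b = 1 := by
  rw [← tsum_fintype (L := .unconditional B), p.tsum_coe]

theorem sum_trajProb [Nonempty (Fin H)] (M : MDP S A H) (π : StochPolicy S A H) :
    ∑ x, M.trajProb π x = 1 := by
  classical
  obtain ⟨n, rfl⟩ : ∃ n, H = n + 1 := ⟨H - 1, by have := (Classical.arbitrary (Fin H)).2; omega⟩
  simp_rw [trajProb_eq_pathWeight]
  apply sum_pathWeight
  · rw [Fintype.sum_prod_type]
    simp [PMF_sum_eq_one]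
  · intro i u
    rw [Fintype.sum_prod_type]
    dsimp only
    simp_rw [← Finset.mul_sum, PMF_sum_eq_one, mul_one, PMF_sum_eq_one]

theorem sum_trajProb_mul (M : MDP S A H) (π : StochPolicy S A H) (h : Fin H)
    (hh : h.val + 1 < H) (g : S × A → S → ℝ≥0∞) :
    ∑ x, M.trajProb π x * g (x h) (x ⟨h.val + 1, hh⟩).1 =
      ∑ x, M.trajProb π x * ∑ s', M.trans h (x h).1 (x h).2 s' * g (x h) s' := by
  classical
  obtain ⟨n, rfl⟩ : ∃ n, H = n + 1 := ⟨H - 1, by omega⟩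
  simp_rw [trajProb_eq_pathWeight]
  have hi : h.val < n := by omega
  have := sum_pathWeight_mul
    (fun v : S × A => (if v.1 = M.init then 1 else 0) * π 0 v.1 v.2)
    (fun (i : Fin n) (u v : S × A) => M.trans i.castSucc u.1 u.2 v.1 * π i.succ v.1 v.2)
    (fun i u => by
      rw [Fintype.sum_prod_type]
      dsimp only
      simp_rw [← Finset.mul_sum, PMF_sum_eq_one, mul_one, PMF_sum_eq_one])
    ⟨h.val, hi⟩ (fun u v => g u v.1)
  refine this.trans ?_
  refine Finset.sum_congr rfl fun x _ => ?_
  congr 1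
  rw [Fintype.sum_prod_type]
  refine Finset.sum_congr rfl fun s' _ => ?_
  simp_rw [mul_right_comm _ _ (g _ _), ← Finset.mul_sum, PMF_sum_eq_one, mul_one]
  rfl

theorem trajProb_ne_top [Nonempty (Fin H)] (M : MDP S A H) (π : StochPolicy S A H)
    (x : Traj S A H) : M.trajProb π x ≠ ⊤ := by
  refine ne_top_of_le_ne_top ENNReal.one_ne_top ?_
  rw [← sum_trajProb M π]
  exact Finset.single_le_sum (f := fun x => M.trajProb π x) (fun _ _ => zero_le) (Finset.mem_univ x)

/-- Expectation of a function of the trajectory of one episode played with `π`. -/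
noncomputable def MDP.expect (M : MDP S A H) (π : StochPolicy S A H) (f : Traj S A H → ℝ) : ℝ :=
  ∑ x, (M.trajProb π x).toReal * f x

variable (M : MDP S A H) (π : StochPolicy S A H)

theorem expect_mono {f g : Traj S A H → ℝ} (h : ∀ x, M.trajProb π x ≠ 0 → f x ≤ g x) :
    M.expect π f ≤ M.expect π g := by
  refine Finset.sum_le_sum fun x _ => ?_
  by_cases hx : M.trajProb π x = 0
  · simp [hx]
  · exact mul_le_mul_of_nonneg_left (h x hx) ENNReal.toReal_nonneg

theorem expect_add (f g : Traj S A H → ℝ) :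
    M.expect π (fun x => f x + g x) = M.expect π f + M.expect π g := by
  simp [MDP.expect, mul_add, Finset.sum_add_distrib]

theorem expect_mul_left (a : ℝ) (f : Traj S A H → ℝ) :
    M.expect π (fun x => a * f x) = a * M.expect π f := by
  simp_rw [MDP.expect, Finset.mul_sum]
  exact Finset.sum_congr rfl fun x _ => by ring

theorem expect_sum {ι : Type*} (s : Finset ι) (f : ι → Traj S A H → ℝ) :
    M.expect π (fun x => ∑ i ∈ s, f i x) = ∑ i ∈ s, M.expect π (f i) := by
  simp_rw [MDP.expect, Finset.mul_sum]
  exact Finset.sum_comm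

theorem expect_const [Nonempty (Fin H)] (a : ℝ) : M.expect π (fun _ => a) = a := by
  rw [MDP.expect, ← Finset.sum_mul, ← ENNReal.toReal_sum fun x _ => trajProb_ne_top M π x,
    sum_trajProb]
  simp

theorem expect_congr {f g : Traj S A H → ℝ} (h : ∀ x, M.trajProb π x ≠ 0 → f x = g x) :
    M.expect π f = M.expect π g :=
  le_antisymm (expect_mono M π fun x hx => (h x hx).le) (expect_mono M π fun x hx => (h x hx).ge)

theorem ofReal_expect [Nonempty (Fin H)] {f : Traj S A H → ℝ} (hf : ∀ x, 0 ≤ f x) :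
    ENNReal.ofReal (M.expect π f) = ∑ x, M.trajProb π x * ENNReal.ofReal (f x) := by
  rw [MDP.expect, ENNReal.ofReal_sum_of_nonneg fun x _ => mul_nonneg ENNReal.toReal_nonneg (hf x)]
  refine Finset.sum_congr rfl fun x _ => ?_
  rw [ENNReal.ofReal_mul ENNReal.toReal_nonneg, ENNReal.ofReal_toReal (trajProb_ne_top M π x)]

/-- Expectation of `f` at the successor state of `(s, a)` at stage `h`. -/
noncomputable def MDP.next (M : MDP S A H) (h : Fin H) (s : S) (a : A) (f : S → ℝ) : ℝ :=
  ∑ s', (M.trans h s a s').toReal * f s'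

/-- The Markov property is proved in `ℝ≥0∞`; nonnegativity of `f` allows the passage to real
numbers. -/
theorem expect_next [Nonempty (Fin H)] (h : Fin H) (hh : h.val + 1 < H) {f : S → ℝ}
    (hf : ∀ s, 0 ≤ f s) :
    M.expect π (fun x => f (x ⟨h.val + 1, hh⟩).1) =
      M.expect π (fun x => M.next h (x h).1 (x h).2 f) := by
  have hn : ∀ s a, 0 ≤ M.next h s a f := fun s a =>
    Finset.sum_nonneg fun s' _ => mul_nonneg ENNReal.toReal_nonneg (hf s')
  have h1 : ∀ g : Traj S A H → ℝ, (∀ x, 0 ≤ g x) → 0 ≤ M.expect π g := fun g hg =>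
    Finset.sum_nonneg fun x _ => mul_nonneg ENNReal.toReal_nonneg (hg x)
  rw [← ENNReal.ofReal_eq_ofReal_iff (h1 _ fun x => hf _) (h1 _ fun x => hn _ _),
    ofReal_expect M π fun x => hf _, ofReal_expect M π fun x => hn _ _,
    sum_trajProb_mul M π h hh fun _ s => ENNReal.ofReal (f s)]
  refine Finset.sum_congr rfl fun x _ => ?_
  congr 1
  rw [MDP.next, ENNReal.ofReal_sum_of_nonneg fun x _ => mul_nonneg ENNReal.toReal_nonneg (hf x)]
  refine Finset.sum_congr rfl fun s' _ => ?_
  rw [ENNReal.ofReal_mul ENNReal.toReal_nonneg, ENNReal.ofReal_toReal (PMF.apply_ne_top _ _)]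

variable {M π}

set_option linter.unusedSectionVars false

theorem eq_init_of_trajProb_ne_zero {x : Traj S A H} (hx : M.trajProb π x ≠ 0) (h : Fin H)
    (h0 : h.val = 0) : (x h).1 = M.init := by
  have := Finset.prod_ne_zero_iff.1 hx h (Finset.mem_univ h)
  by_contra hne
  simp [MDP.stateProb, h0, hne] at this

theorem eq_action_of_trajProb_ne_zero {π : DetPolicy S A H} {x : Traj S A H}
    (hx : M.trajProb π.toStoch x ≠ 0) (h : Fin H) : (x h).2 = π h (x h).1 := by
  have := Finset.prod_ne_zero_iff.1 hx h (Finset.mem_univ h)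
  by_contra hne
  simp [DetPolicy.toStoch, hne] at this

open Classical in
theorem expect_sum_stages [Nonempty (Fin H)] (g : Fin H × S × A → ℝ) :
    M.expect π (fun x => ∑ h, g (h, x h)) = ∑ z, (M.occupancy π z).toReal * g z := by
  rw [expect_sum, Fintype.sum_prod_type]
  refine Finset.sum_congr rfl fun h _ => ?_
  have : ∀ v : S × A, (M.occupancy π (h, v)).toReal =
      ∑ x : Traj S A H, if x h = v then (M.trajProb π x).toReal else 0 := by
    intro v
    rw [MDP.occupancy, ENNReal.toReal_sum]
    · exact Finset.sum_congr rfl fun x _ => by split_ifs <;> simp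
    · intro x _
      split_ifs <;> simp [trajProb_ne_top]
  simp_rw [this, Finset.sum_mul]
  rw [Finset.sum_comm]
  refine Finset.sum_congr rfl fun x _ => ?_
  simp [ite_mul]

theorem occupancy_le_one [Nonempty (Fin H)] (z : Fin H × S × A) : M.occupancy π z ≤ 1 := by
  classical
  rw [← sum_trajProb M π]
  refine Finset.sum_le_sum fun x _ => ?_
  split_ifs
  · exact le_rfl
  · exact zero_le

end Expectation

/-! ### Nonnegative supermartingales along a run. -/

section Ville

set_option linter.unusedSectionVars false

variable {S A : Type*} {H : ℕ} [Fintype S] [Fintype A] {M : MDP S A H}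
  {Ω : Type*} [MeasurableSpace Ω] {μ : MeasureTheory.Measure Ω}
  {pol : ℕ → Ω → DetPolicy S A H} {traj : ℕ → Ω → Traj S A H}

theorem lintegral_comp_fintype {Γ : Type*} [Fintype Γ] (X : Ω → Γ)
    (hX : ∀ γ, MeasurableSet {ω | X ω = γ}) (F : Γ → ℝ≥0∞) :
    ∫⁻ ω, F (X ω) ∂μ = ∑ γ, F γ * μ {ω | X ω = γ} := by
  let _ : MeasurableSpace Γ := ⊤
  have hm : Measurable X := by
    apply measurable_to_countable'
    exact fun γ => hX γ
  rw [← MeasureTheory.lintegral_map (f := F) (measurable_of_finite F) hm,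
    MeasureTheory.lintegral_fintype]
  refine Finset.sum_congr rfl fun γ _ => ?_
  rw [MeasureTheory.Measure.map_apply hm (MeasurableSet.singleton γ)]
  rfl

variable (pol traj) in
/-- Policies and trajectories of the first `t` episodes. -/
def history (t : ℕ) (ω : Ω) (i : Fin t) : DetPolicy S A H × Traj S A H :=
  (pol i ω, traj i ω)

/-- A function of runs depends on the first `t` episodes only. -/
def IsPast {β : Type*} (t : ℕ) (F : (ℕ → DetPolicy S A H) → (ℕ → Traj S A H) → β) : Prop :=
  ∀ q q' x x', (∀ i < t, q i = q' i ∧ x i = x' i) → F q x = F q' x'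

variable {t : ℕ}

theorem IsPast.mono {β : Type*} {F : (ℕ → DetPolicy S A H) → (ℕ → Traj S A H) → β} {t' : ℕ}
    (hF : IsPast t F) (h : t ≤ t') : IsPast t' F :=
  fun q q' x x' hq => hF q q' x x' fun i hi => hq i (hi.trans_le h)

open Classical in
-- Histories take finitely many values, so this factorisation reduces measurability of past events
-- to that of single histories.
theorem IsPast.exists_history {β : Type*} [Nonempty β]
    {F : (ℕ → DetPolicy S A H) → (ℕ → Traj S A H) → β} (hF : IsPast t F) :
    ∃ G : (Fin t → DetPolicy S A H × Traj S A H) → β, ∀ q x,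
      F q x = G fun i => (q i, x i) := by
  refine ⟨fun g => if h : ∃ (q : ℕ → DetPolicy S A H) (x : ℕ → Traj S A H),
      g = fun i : Fin t => (q i.val, x i.val) then
    F h.choose h.choose_spec.choose else Classical.arbitrary β, fun q x => ?_⟩
  have h : ∃ (q' : ℕ → DetPolicy S A H) (x' : ℕ → Traj S A H),
      (fun i : Fin t => (q i.val, x i.val)) =
      fun i : Fin t => (q' i.val, x' i.val) := ⟨q, x, rfl⟩
  beta_reduce
  rw [dif_pos h]
  refine hF _ _ _ _ fun i hi => ?_
  have := congrFun h.choose_spec.choose_spec ⟨i, hi⟩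
  exact ⟨congrArg Prod.fst this, congrArg Prod.snd this⟩

/-- Laws of a run in which `traj t` is generated with the policy `pol t`. -/
structure IsRun (M : MDP S A H) (μ : MeasureTheory.Measure Ω) (pol : ℕ → Ω → DetPolicy S A H)
    (traj : ℕ → Ω → Traj S A H) : Prop where
  measurable_pol : ∀ t q, MeasurableSet {ω | pol t ω = q}
  measurable_traj : ∀ t x, MeasurableSet {ω | traj t ω = x}
  law : ∀ (t : ℕ) (q : ℕ → DetPolicy S A H) (x : ℕ → Traj S A H),
    μ {ω | (∀ i < t, pol i ω = q i ∧ traj i ω = x i) ∧ pol t ω = q t ∧ traj t ω = x t} =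
      μ {ω | (∀ i < t, pol i ω = q i ∧ traj i ω = x i) ∧ pol t ω = q t} *
        M.trajProb (q t).toStoch (x t)

theorem IsRun.measurableSet_history (hr : IsRun M μ pol traj) (t : ℕ)
    (g : Fin t → DetPolicy S A H × Traj S A H) : MeasurableSet {ω | history pol traj t ω = g} := by
  have : {ω | history pol traj t ω = g} =
      ⋂ i : Fin t, {ω | pol i ω = (g i).1} ∩ {ω | traj i ω = (g i).2} := by
    ext ω
    simp only [Set.mem_ofPred_eq, Set.mem_iInter, Set.mem_inter_iff, funext_iff, history,
      Prod.ext_iff]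
  rw [this]
  exact MeasurableSet.iInter fun i => (hr.measurable_pol _ _).inter (hr.measurable_traj _ _)

/-- Replacing the trajectory of episode `t + 1` by a draw from its law. -/
theorem IsRun.lintegral_le (hr : IsRun M μ pol traj)
    {F G : (ℕ → DetPolicy S A H) → (ℕ → Traj S A H) → ℝ≥0∞} (hF : IsPast (t + 1) F)
    (hG : IsPast t G)
    (hFG : ∀ q x, ∑ v, M.trajProb (q t).toStoch v * F q (Function.update x t v) ≤ G q x) :
    ∫⁻ ω, F (fun i => pol i ω) (fun i => traj i ω) ∂μ ≤
      ∫⁻ ω, G (fun i => pol i ω) (fun i => traj i ω) ∂μ := by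
  classical
  by_cases hemp : IsEmpty Ω
  · simp [MeasureTheory.Measure.eq_zero_of_isEmpty]
  obtain ⟨ω₀⟩ := not_isEmpty_iff.1 hemp
  let D := DetPolicy S A H
  let X : Ω → (Fin t → D × Traj S A H) × D := fun ω => (history pol traj t ω, pol t ω)
  -- `qx` and `tx` extend a finite history to a full run. Index `t` of `qx` holds the current
  -- policy; later values are never seen by `F` and `G`.
  let qx : (Fin t → D × Traj S A H) × D → ℕ → D := fun γ i =>
    if h : i < t then (γ.1 ⟨i, h⟩).1 else γ.2
  let tx : (Fin t → D × Traj S A H) × D → ℕ → Traj S A H := fun γ i =>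
    if h : i < t then (γ.1 ⟨i, h⟩).2 else traj 0 ω₀
  have hXm : ∀ γ, MeasurableSet {ω | X ω = γ} := by
    intro γ
    have : {ω | X ω = γ} = {ω | history pol traj t ω = γ.1} ∩ {ω | pol t ω = γ.2} := by
      ext ω; simp [X, Prod.ext_iff]
    rw [this]
    exact (hr.measurableSet_history _ _).inter (hr.measurable_pol _ _)
  have hYm : ∀ γ : ((Fin t → D × Traj S A H) × D) × Traj S A H,
      MeasurableSet {ω | (X ω, traj t ω) = γ} := by
    intro γ
    have : {ω | (X ω, traj t ω) = γ} = {ω | X ω = γ.1} ∩ {ω | traj t ω = γ.2} := by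
      ext ω; simp [Prod.ext_iff]
    rw [this]
    exact (hXm _).inter (hr.measurable_traj _ _)
  have e1 : ∀ ω, F (fun i => pol i ω) (fun i => traj i ω) =
      (fun γ : ((Fin t → D × Traj S A H) × D) × Traj S A H =>
        F (qx γ.1) (Function.update (tx γ.1) t γ.2)) (X ω, traj t ω) := by
    intro ω
    refine hF _ _ _ _ fun i hi => ?_
    rcases Nat.lt_succ_iff_lt_or_eq.1 hi with h | rfl
    · simp [qx, tx, X, h, history, Function.update_of_ne h.ne]
    · simp [qx, X]
  have e2 : ∀ ω, G (fun i => pol i ω) (fun i => traj i ω) =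
      (fun γ => G (qx γ) (tx γ)) (X ω) := by
    intro ω
    refine hG _ _ _ _ fun i hi => ?_
    simp [qx, tx, X, hi, history]
  rw [(MeasureTheory.lintegral_congr e1).trans (lintegral_comp_fintype _ hYm
      fun γ => F (qx γ.1) (Function.update (tx γ.1) t γ.2)),
    (MeasureTheory.lintegral_congr e2).trans (lintegral_comp_fintype _ hXm
      fun γ => G (qx γ) (tx γ)),
    Fintype.sum_prod_type]
  refine Finset.sum_le_sum fun γ _ => ?_
  have hlaw : ∀ v, μ {ω | (X ω, traj t ω) = (γ, v)} =
      μ {ω | X ω = γ} * M.trajProb (qx γ t).toStoch v := by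
    intro v
    have := hr.law t (qx γ) (Function.update (tx γ) t v)
    rw [Function.update_self] at this
    have hc : ∀ ω, X ω = γ ↔ (∀ i < t, pol i ω = qx γ i ∧
        traj i ω = Function.update (tx γ) t v i) ∧ pol t ω = qx γ t := by
      intro ω
      constructor
      · rintro rfl
        refine ⟨fun i hi => ?_, by simp [qx, X]⟩
        simp [qx, tx, X, hi, history, Function.update_of_ne hi.ne]
      · rintro ⟨h1, h2⟩
        refine Prod.ext (funext fun i => ?_) ?_
        · have := h1 i i.2
          rw [Function.update_of_ne i.2.ne] at this
          simp only [qx, tx, i.2, dif_pos] at this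
          exact Prod.ext this.1 this.2
        · simpa [qx] using h2
    simp only [Prod.mk.injEq, hc, and_assoc]
    exact this
  simp_rw [hlaw]
  calc ∑ v, F (qx γ) (Function.update (tx γ) t v) *
        (μ {ω | X ω = γ} * M.trajProb (qx γ t).toStoch v)
      = μ {ω | X ω = γ} * ∑ v, M.trajProb (qx γ t).toStoch v *
          F (qx γ) (Function.update (tx γ) t v) := by
        rw [Finset.mul_sum]
        exact Finset.sum_congr rfl fun v _ => by ring
    _ ≤ μ {ω | X ω = γ} * G (qx γ) (tx γ) := by gcongr; exact hFG _ _
    _ = _ := mul_comm _ _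

/-- Ville's maximal inequality for nonnegative supermartingales along a run. -/
theorem IsRun.ville [MeasureTheory.IsProbabilityMeasure μ] (hr : IsRun M μ pol traj)
    [Nonempty (Fin H)]
    {W : ℕ → (ℕ → DetPolicy S A H) → (ℕ → Traj S A H) → ℝ≥0∞} (hW : ∀ t, IsPast t (W t))
    (hW0 : ∀ q x, W 0 q x ≤ 1)
    (hstep : ∀ t q x,
      ∑ v, M.trajProb (q t).toStoch v * W (t + 1) q (Function.update x t v) ≤ W t q x)
    (K : ℝ≥0∞) :
    K * μ {ω | ∃ t, K ≤ W t (fun i => pol i ω) (fun i => traj i ω)} ≤ 1 := by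
  classical
  -- The process is frozen at the value `K` once it has reached `K`. The frozen process still has
  -- mean at most one, and Markov's inequality for it at time `t` controls all times up to `t`.
  let A' : ℕ → (ℕ → DetPolicy S A H) → (ℕ → Traj S A H) → Prop := fun t q x =>
    ∃ i ≤ t, K ≤ W i q x
  have hA' : ∀ t, IsPast t (A' t) := by
    intro t q q' x x' h
    refine propext (exists_congr fun i => and_congr_right fun hi => ?_)
    rw [(hW i).mono hi q q' x x' h]
  have key : ∀ t, ∫⁻ ω, (if A' t (fun i => pol i ω) (fun i => traj i ω) then K
      else W t (fun i => pol i ω) (fun i => traj i ω)) ∂μ ≤ 1 := by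
    intro t
    induction t with
    | zero =>
      calc _ ≤ ∫⁻ _, 1 ∂μ := MeasureTheory.lintegral_mono fun ω => by
            split_ifs with h
            · obtain ⟨i, hi, h⟩ := h
              obtain rfl := Nat.le_zero.1 hi
              exact h.trans (hW0 _ _)
            · exact hW0 _ _
        _ = 1 := by simp
    | succ t ih =>
      refine le_trans ?_ ih
      have h1 : ∀ ω, (if A' (t + 1) (fun i => pol i ω) (fun i => traj i ω) then K
          else W (t + 1) (fun i => pol i ω) (fun i => traj i ω)) ≤
          (fun q x => if A' t q x then K else W (t + 1) q x) (fun i => pol i ω)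
            (fun i => traj i ω) := by
        intro ω
        by_cases h : A' t (fun i => pol i ω) (fun i => traj i ω)
        · have h' : A' (t + 1) (fun i => pol i ω) (fun i => traj i ω) := by
            obtain ⟨i, hi, h⟩ := h
            exact ⟨i, hi.trans (Nat.le_succ t), h⟩
          simp [h, h']
        · by_cases h' : A' (t + 1) (fun i => pol i ω) (fun i => traj i ω)
          · simp only [h, h', if_true, if_false]
            obtain ⟨i, hi, h'⟩ := h'
            rcases Nat.le_succ_iff.1 hi with hi | rfl
            · exact absurd ⟨i, hi, h'⟩ h
            · exact h'
          · simp [h, h']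
      refine (MeasureTheory.lintegral_mono h1).trans ?_
      apply hr.lintegral_le (t := t) (F := fun q x => if A' t q x then K else W (t + 1) q x)
        (G := fun q x => if A' t q x then K else W t q x)
      · intro q q' x x' h
        dsimp only
        simp only [(hA' t).mono t.le_succ q q' x x' h, hW (t + 1) q q' x x' h]
      · intro q q' x x' h
        dsimp only
        simp only [hA' t q q' x x' h, hW t q q' x x' h]
      · intro q x
        have : ∀ v, A' t q (Function.update x t v) = A' t q x := fun v =>
          hA' t _ _ _ _ fun i hi => ⟨rfl, Function.update_of_ne hi.ne _ _⟩
        simp_rw [this]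
        split_ifs
        · rw [← Finset.sum_mul, sum_trajProb, one_mul]
        · exact hstep t q x
  have hmono : Monotone fun t => {ω | A' t (fun i => pol i ω) (fun i => traj i ω)} := by
    intro a b hab ω h
    obtain ⟨i, hi, h⟩ := h
    exact ⟨i, hi.trans hab, h⟩
  have hU : {ω | ∃ t, K ≤ W t (fun i => pol i ω) (fun i => traj i ω)} =
      ⋃ t, {ω | A' t (fun i => pol i ω) (fun i => traj i ω)} := by
    ext ω
    simp only [Set.mem_ofPred_eq, Set.mem_iUnion, A']
    exact ⟨fun ⟨t, h⟩ => ⟨t, t, le_rfl, h⟩, fun ⟨_, i, _, h⟩ => ⟨i, h⟩⟩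
  rw [hU, hmono.measure_iUnion, ENNReal.mul_iSup]
  refine iSup_le fun t => le_trans ?_ (key t)
  obtain ⟨G, hG⟩ := (hA' t).exists_history
  have hms : MeasurableSet {ω | A' t (fun i => pol i ω) (fun i => traj i ω)} := by
    have : {ω | A' t (fun i => pol i ω) (fun i => traj i ω)} =
        ⋃ g ∈ {g | G g}, {ω | history pol traj t ω = g} := by
      ext ω
      simp only [Set.mem_ofPred_eq, Set.mem_iUnion, exists_prop, exists_eq_right', hG]
      rfl
    rw [this]
    exact MeasurableSet.biUnion (Set.to_countable _) fun g _ => hr.measurableSet_history t g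
  rw [← MeasureTheory.setLIntegral_const, ← MeasureTheory.lintegral_indicator hms]
  refine MeasureTheory.lintegral_mono fun ω => ?_
  by_cases h : A' t (fun i => pol i ω) (fun i => traj i ω)
  · simp [Set.indicator, h]
  · simp [Set.indicator, h]

end Ville

/-! ### A multiplicative Chernoff bound. -/

section Chernoff

variable {S A : Type*} {H : ℕ} [Fintype S] [Fintype A] {M : MDP S A H}
  {Ω : Type*} [MeasurableSpace Ω] {μ : MeasureTheory.Measure Ω}
  {pol : ℕ → Ω → DetPolicy S A H} {traj : ℕ → Ω → Traj S A H}

theorem exp_neg_le_one_sub_half {g : ℝ} (h0 : 0 ≤ g) (h1 : g ≤ 1) :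
    Real.exp (-g) ≤ 1 - g / 2 := by
  rw [Real.exp_neg, inv_le_comm₀ (Real.exp_pos g) (by linarith)]
  refine le_trans ?_ (Real.add_one_le_exp g)
  rw [inv_le_iff_one_le_mul₀ (by linarith)]
  nlinarith

theorem expect_exp_neg_le [Nonempty (Fin H)] (π : StochPolicy S A H) {g : Traj S A H → ℝ}
    (h0 : ∀ v, 0 ≤ g v) (h1 : ∀ v, g v ≤ 1) :
    M.expect π (fun v => Real.exp (-g v)) ≤ Real.exp (-(M.expect π g / 2)) := by
  calc M.expect π (fun v => Real.exp (-g v)) ≤ M.expect π (fun v => 1 + (-(1 / 2)) * g v) :=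
        expect_mono M π fun v _ => by
          have := exp_neg_le_one_sub_half (h0 v) (h1 v)
          linarith
    _ = -(M.expect π g / 2) + 1 := by
        rw [expect_add, expect_const, expect_mul_left]; ring
    _ ≤ _ := Real.add_one_le_exp _

/-- Multiplicative Chernoff bound, uniform in time, for predictable functions of the trajectories. -/
theorem IsRun.chernoff [MeasureTheory.IsProbabilityMeasure μ] (hr : IsRun M μ pol traj)
    [Nonempty (Fin H)] (g : ℕ → (ℕ → Traj S A H) → Traj S A H → ℝ)
    (hg : ∀ t x x', (∀ i < t, x i = x' i) → g t x = g t x')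
    (h0 : ∀ t x v, 0 ≤ g t x v) (h1 : ∀ t x v, g t x v ≤ 1) {ε : ℝ} (hε : 0 < ε) :
    μ {ω | ∃ T, ∑ t ∈ Finset.range T, g t (fun i => traj i ω) (traj t ω) + Real.log (1 / ε) ≤
      (∑ t ∈ Finset.range T, M.expect (pol t ω).toStoch (g t (fun i => traj i ω))) / 2} ≤
      ENNReal.ofReal ε := by
  -- `exp Y` is a supermartingale because `exp (-g) ≤ 1 - g / 2` on `[0, 1]`. Giving up a factor two
  -- leaves only the additive deviation `log (1 / ε)`.
  let Y : ℕ → (ℕ → DetPolicy S A H) → (ℕ → Traj S A H) → ℝ := fun t q x =>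
    ∑ i ∈ Finset.range t, (M.expect (q i).toStoch (g i x) / 2 - g i x (x i))
  have hY : ∀ t, IsPast t (Y t) := by
    intro t q q' x x' h
    refine Finset.sum_congr rfl fun i hi => ?_
    have hi' := Finset.mem_range.1 hi
    rw [(h i hi').1, (h i hi').2, hg i x x' fun j hj => (h j (hj.trans hi')).2]
  have key := hr.ville (W := fun t q x => ENNReal.ofReal (Real.exp (Y t q x)))
    (fun t q q' x x' h => by simp only [hY t q q' x x' h]) (fun q x => by simp [Y])
    (fun t q x => by
      have e : ∀ v, Real.exp (Y (t + 1) q (Function.update x t v)) =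
          Real.exp (Y t q x + M.expect (q t).toStoch (g t x) / 2) * Real.exp (-g t x v) := by
        intro v
        have e1 : Y t q (Function.update x t v) = Y t q x :=
          hY t _ _ _ _ fun i hi => ⟨rfl, Function.update_of_ne hi.ne _ _⟩
        have e2 : g t (Function.update x t v) = g t x :=
          hg t _ _ fun i hi => Function.update_of_ne hi.ne _ _
        have e3 : Y (t + 1) q (Function.update x t v) = Y t q (Function.update x t v) +
            (M.expect (q t).toStoch (g t (Function.update x t v)) / 2 -
              g t (Function.update x t v) v) := by
          simp only [Y, Finset.sum_range_succ, Function.update_self]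
        rw [← Real.exp_add, e3, e1, e2]
        congr 1
        ring
      simp_rw [e]
      rw [← ofReal_expect M _ (f := fun v =>
        Real.exp (Y t q x + M.expect (q t).toStoch (g t x) / 2) * Real.exp (-g t x v))
        fun v => by positivity, expect_mul_left]
      refine ENNReal.ofReal_le_ofReal ?_
      have h2 := expect_exp_neg_le (M := M) (q t).toStoch (h0 t x) (h1 t x)
      calc _ ≤ Real.exp (Y t q x + M.expect (q t).toStoch (g t x) / 2) *
            Real.exp (-(M.expect (q t).toStoch (g t x) / 2)) := by gcongr
        _ = Real.exp (Y t q x) := by rw [← Real.exp_add]; congr 1; ring)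
    (ENNReal.ofReal (1 / ε))
  have hsub : {ω | ∃ T, ∑ t ∈ Finset.range T, g t (fun i => traj i ω) (traj t ω) +
      Real.log (1 / ε) ≤
      (∑ t ∈ Finset.range T, M.expect (pol t ω).toStoch (g t (fun i => traj i ω))) / 2} ⊆
      {ω | ∃ t, ENNReal.ofReal (1 / ε) ≤
        ENNReal.ofReal (Real.exp (Y t (fun i => pol i ω) (fun i => traj i ω)))} := by
    rintro ω ⟨T, hT⟩
    refine ⟨T, ENNReal.ofReal_le_ofReal ?_⟩
    rw [← Real.log_le_iff_le_exp (by positivity)]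
    simp only [Y, Finset.sum_sub_distrib, ← Finset.sum_div]
    linarith
  refine (MeasureTheory.measure_mono hsub).trans ?_
  have hpos : ENNReal.ofReal (1 / ε) ≠ 0 := by
    rw [Ne, ENNReal.ofReal_eq_zero, not_le]; positivity
  have := (ENNReal.le_inv_iff_mul_le (b := ENNReal.ofReal (1 / ε))).2 ((mul_comm _ _).le.trans key)
  rw [← ENNReal.ofReal_inv_of_pos (by positivity)] at this
  simpa only [one_div, inv_inv] using this

end Chernoff

/-! ### Visit and transition counts. -/

section Counts

variable {S A : Type*} {H : ℕ}

open Classical in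
theorem counts_congr {t : ℕ} {y y' : ℕ → Traj S A H} (h : ∀ i < t, y i = y' i) :
    counts y t = counts y' t := by
  funext z
  unfold counts
  congr 1
  exact Finset.filter_congr fun i hi => by rw [h i (Finset.mem_range.1 hi)]

open Classical in
theorem transCounts_congr {t : ℕ} {y y' : ℕ → Traj S A H} (h : ∀ i < t, y i = y' i) :
    transCounts y t = transCounts y' t := by
  funext k hk s a s'
  unfold transCounts
  congr 1
  exact Finset.filter_congr fun i hi => by rw [h i (Finset.mem_range.1 hi)]

open Classical in
theorem counts_succ (y : ℕ → Traj S A H) (t : ℕ) (z : Fin H × S × A) :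
    counts y (t + 1) z = counts y t z + if y t z.1 = z.2 then 1 else 0 := by
  unfold counts
  rw [Finset.range_add_one, Finset.filter_insert]
  split_ifs
  · rw [Finset.card_insert_of_notMem (by simp)]
  · simp

open Classical in
theorem transCounts_succ (y : ℕ → Traj S A H) (t : ℕ) (h : Fin H) (hh : h.val + 1 < H) (s : S)
    (a : A) (s' : S) : transCounts y (t + 1) h hh s a s' = transCounts y t h hh s a s' +
      if y t h = (s, a) ∧ (y t ⟨h.val + 1, hh⟩).1 = s' then 1 else 0 := by
  unfold transCounts
  rw [Finset.range_add_one, Finset.filter_insert]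
  split_ifs
  · rw [Finset.card_insert_of_notMem (by simp)]
  · simp

theorem counts_zero (y : ℕ → Traj S A H) (z : Fin H × S × A) : counts y 0 z = 0 := by
  simp [counts]

open Classical in
theorem counts_le (y : ℕ → Traj S A H) (t : ℕ) (z : Fin H × S × A) : counts y t z ≤ t :=
  (Finset.card_filter_le _ _).trans (Finset.card_range t).le

theorem counts_mono (y : ℕ → Traj S A H) (z : Fin H × S × A) : Monotone fun t => counts y t z :=
  monotone_nat_of_le_succ fun t => (counts_succ y t z).symm ▸ Nat.le_add_right _ _

theorem sum_transCounts [Fintype S] (y : ℕ → Traj S A H) (t : ℕ) (h : Fin H)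
    (hh : h.val + 1 < H) (s : S) (a : A) :
    ∑ s', transCounts y t h hh s a s' = counts y t (h, s, a) := by
  classical
  induction t with
  | zero => simp [counts, transCounts]
  | succ t ih =>
    simp_rw [counts_succ, transCounts_succ, Finset.sum_add_distrib, ih]
    congr 1
    by_cases h1 : y t h = (s, a) <;> simp [h1]

end Counts

/-! ### Laplace's rule of succession and typical counts. -/

section Laplace

variable {S : Type*} [Fintype S]

/-- Probability of a sequence with type `n` under Laplace's rule of succession. -/
noncomputable def laplaceProb (n : S → ℕ) : ℝ :=
  (∏ s, ((n s).factorial : ℝ)) * ((Fintype.card S - 1).factorial : ℝ) /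
    ((∑ s, n s + (Fintype.card S - 1)).factorial : ℝ)

theorem laplaceProb_nonneg (n : S → ℕ) : 0 ≤ laplaceProb n := by
  unfold laplaceProb; positivity

theorem laplaceProb_pos (n : S → ℕ) : 0 < laplaceProb n := by
  unfold laplaceProb; positivity

open Classical in
theorem laplaceProb_add_single [Nonempty S] (n : S → ℕ) (s : S) :
    laplaceProb (n + Pi.single s 1) =
      laplaceProb n * ((n s + 1) / (∑ s, (n s : ℝ) + Fintype.card S)) := by
  have hS : 1 ≤ Fintype.card S := Fintype.card_pos
  have h1 : ∏ s', (((n + Pi.single s 1 : S → ℕ) s').factorial : ℝ) =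
      (∏ s', ((n s').factorial : ℝ)) * (n s + 1) := by
    rw [← Finset.mul_prod_erase _ _ (Finset.mem_univ s),
      ← Finset.mul_prod_erase (f := fun s' => ((n s').factorial : ℝ)) _ (Finset.mem_univ s)]
    have : ∀ s' ∈ Finset.univ.erase s, (((n + Pi.single s 1 : S → ℕ) s').factorial : ℝ) =
        ((n s').factorial : ℝ) := fun s' hs' => by
      simp [Pi.single_eq_of_ne (Finset.ne_of_mem_erase hs')]
    rw [Finset.prod_congr rfl this]
    simp only [Pi.add_apply, Pi.single_eq_same, Nat.factorial_succ]
    push_cast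
    ring
  have h2 : ∑ s', (n + Pi.single s 1 : S → ℕ) s' = ∑ s', n s' + 1 := by
    simp [Finset.sum_add_distrib]
  have h3 : ((∑ s', n s' + 1 + (Fintype.card S - 1)).factorial : ℝ) =
      (∑ s', (n s' : ℝ) + Fintype.card S) * ((∑ s', n s' + (Fintype.card S - 1)).factorial : ℝ) := by
    rw [show ∑ s', n s' + 1 + (Fintype.card S - 1) = (∑ s', n s' + (Fintype.card S - 1)) + 1 by
      omega, Nat.factorial_succ]
    rw [show ∑ s', n s' + (Fintype.card S - 1) + 1 = ∑ s', n s' + Fintype.card S by omega]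
    push_cast
    ring
  unfold laplaceProb
  rw [h1, h2, h3]
  have : (0 : ℝ) < ∑ s', (n s' : ℝ) + Fintype.card S := by positivity
  field_simp

open Classical in
-- One-step supermartingale property of the likelihood ratio. When `p s ≠ 0`, the draw of `s`
-- cancels one factor of the denominator and leaves the add-one predictive probability of `s`; these
-- sum to one. States with `p s = 0` contribute nothing, hence an inequality.
theorem sum_mul_laplaceProb_div_le [Nonempty S] (p : S → ℝ≥0∞) (hp : ∀ s, p s ≠ ⊤) (n : S → ℕ) :
    ∑ s, p s * (ENNReal.ofReal (laplaceProb (n + Pi.single s 1)) /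
      ∏ s', p s' ^ (n + Pi.single s 1 : S → ℕ) s') ≤
      ENNReal.ofReal (laplaceProb n) / ∏ s', p s' ^ n s' := by
  have hpos : (0 : ℝ) < ∑ s', (n s' : ℝ) + Fintype.card S := by positivity
  have h1 : ∀ s, p s * (ENNReal.ofReal (laplaceProb (n + Pi.single s 1)) /
      ∏ s', p s' ^ (n + Pi.single s 1 : S → ℕ) s') ≤
      ENNReal.ofReal (laplaceProb n * ((n s + 1) / (∑ s, (n s : ℝ) + Fintype.card S))) /
        ∏ s', p s' ^ n s' := by
    intro s
    have e : ∏ s', p s' ^ (n + Pi.single s 1 : S → ℕ) s' = (∏ s', p s' ^ n s') * p s := by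
      simp_rw [Pi.add_apply, pow_add, Finset.prod_mul_distrib]
      congr 1
      rw [Finset.prod_eq_single s (fun s' _ hs' => by simp [Pi.single_eq_of_ne hs']) (by simp)]
      simp
    rw [e, laplaceProb_add_single]
    by_cases h0 : p s = 0
    · simp [h0]
    · rw [div_eq_mul_inv, ENNReal.mul_inv (Or.inr (hp s)) (Or.inr h0), mul_comm (p s), mul_assoc,
        mul_assoc, ENNReal.inv_mul_cancel h0 (hp s), mul_one]
      rfl
  refine (Finset.sum_le_sum fun s _ => h1 s).trans ?_
  simp_rw [div_eq_mul_inv]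
  rw [← Finset.sum_mul]
  gcongr
  rw [← ENNReal.ofReal_sum_of_nonneg fun s _ => mul_nonneg (laplaceProb_nonneg n) (by positivity)]
  rw [← Finset.mul_sum, ← Finset.sum_mul]
  simp only [Finset.sum_add_distrib, Finset.sum_const, Finset.card_univ, nsmul_eq_mul, mul_one]
  rw [mul_inv_cancel₀ hpos.ne', mul_one]

/-- The sequences of type `n` all have probability `∏ q ^ n` and there are multinomially many of
them: this is one term of the expansion of `(∑ q) ^ N ≤ 1`. -/
theorem prod_pow_mul_multinomial_le (n : S → ℕ) (q : S → ℝ) (hq : ∀ s, 0 ≤ q s)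
    (hq1 : ∑ s, q s ≤ 1) :
    (∏ s, q s ^ n s) * ((∑ s, n s).factorial : ℝ) ≤ ∏ s, ((n s).factorial : ℝ) := by
  classical
  have h1 : (Nat.multinomial Finset.univ n : ℝ) * ∏ s, q s ^ n s ≤ 1 := by
    calc _ ≤ (∑ s, q s) ^ (∑ s, n s) := by
          rw [Finset.sum_pow_eq_sum_piAntidiag]
          exact Finset.single_le_sum
            (f := fun k : S → ℕ => (Nat.multinomial Finset.univ k : ℝ) * ∏ s, q s ^ k s)
            (fun k _ => mul_nonneg (by positivity)
              (Finset.prod_nonneg fun s _ => pow_nonneg (hq s) _))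
            (by simp)
      _ ≤ 1 := pow_le_one₀ (Finset.sum_nonneg fun s _ => hq s) hq1
  have h2 : (∏ s, ((n s).factorial : ℝ)) * Nat.multinomial Finset.univ n =
      ((∑ s, n s).factorial : ℝ) := by
    exact_mod_cast Nat.multinomial_spec Finset.univ n
  rw [← h2]
  have h3 : (0 : ℝ) ≤ ∏ s, ((n s).factorial : ℝ) := by positivity
  nlinarith

/-- Equivalently `choose (N + k) k ≤ (N + 1) ^ k`: Laplace's rule loses only a polynomial factor
against the best fixed law. -/
theorem factorial_add_le (N k : ℕ) :
    ((N + k).factorial : ℝ) ≤ (N.factorial : ℝ) * k.factorial * (N + 1) ^ k := by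
  induction k with
  | zero => simp
  | succ k ih =>
    rw [← add_assoc, Nat.factorial_succ, Nat.factorial_succ, pow_succ]
    push_cast
    calc ((N : ℝ) + k + 1) * (N + k).factorial
        ≤ ((k + 1) * (N + 1)) * ((N.factorial : ℝ) * k.factorial * (N + 1) ^ k) := by
          gcongr
          nlinarith [(Nat.cast_nonneg N : (0 : ℝ) ≤ N), (Nat.cast_nonneg k : (0 : ℝ) ≤ k),
            mul_nonneg (Nat.cast_nonneg N : (0 : ℝ) ≤ N) (Nat.cast_nonneg k : (0 : ℝ) ≤ k)]
      _ = _ := by ring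

/-- Transition counts `n` are typical for the law `p` at level `b`. -/
def Typical (n : S → ℕ) (p : S → ℝ) (b : ℝ) : Prop :=
  ∀ u : S → ℝ, (∀ s, 0 < u s) → ∑ s, p s * u s ≤ 1 → ∑ s, n s * Real.log (u s) ≤ b

/-- The weights `q = p u` have likelihood ratio `∏ u ^ n` to `p`, and Laplace's rule gives the
sequence at least its `q`-weight divided by `(N + 1) ^ (S - 1)`. The hypothesis does not involve
`u`, so one event serves all test functions. -/
theorem typical_of_laplaceProb_le [Nonempty S] (n : S → ℕ) (p : S → ℝ) (hp : ∀ s, 0 ≤ p s)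
    {K : ℝ} (hK : 0 < K) (h : laplaceProb n ≤ K * ∏ s, p s ^ n s) :
    Typical n p (Real.log K + Fintype.card S * Real.log (∑ s, n s + 1)) := by
  intro u hu hpu
  set N := ∑ s, n s with hN
  have hP : 0 < ∏ s, p s ^ n s := by
    have := (laplaceProb_pos n).trans_le h
    exact pos_of_mul_pos_right this hK.le
  have h1 := prod_pow_mul_multinomial_le n (fun s => p s * u s)
    (fun s => mul_nonneg (hp s) (hu s).le) hpu
  have h2 := factorial_add_le N (Fintype.card S - 1)
  unfold laplaceProb at h
  rw [← hN] at h h1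
  rw [div_le_iff₀ (by positivity)] at h
  simp_rw [mul_pow, Finset.prod_mul_distrib] at h1
  have h3 : (∏ s, u s ^ n s) ≤ K * (N + 1) ^ (Fintype.card S - 1) := by
    have hU : 0 < ∏ s, u s ^ n s := Finset.prod_pos fun s _ => pow_pos (hu s) _
    set P := ∏ s, p s ^ n s
    set U := ∏ s, u s ^ n s
    set F : ℝ := ∏ s, ((n s).factorial : ℝ)
    have hk : (0 : ℝ) < (Fintype.card S - 1).factorial := by positivity
    have hNf : (0 : ℝ) < N.factorial := by positivity
    have h4 : P * U * N.factorial * (Fintype.card S - 1).factorial ≤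
        K * P * ((N.factorial : ℝ) * (Fintype.card S - 1).factorial *
          (N + 1) ^ (Fintype.card S - 1)) :=
      calc _ ≤ F * (Fintype.card S - 1).factorial := by gcongr
        _ ≤ _ := h
        _ ≤ _ := by gcongr
    have h5 : (P * N.factorial * (Fintype.card S - 1).factorial) * U ≤
        (P * N.factorial * (Fintype.card S - 1).factorial) *
          (K * (N + 1) ^ (Fintype.card S - 1)) := by
      calc _ = P * U * N.factorial * (Fintype.card S - 1).factorial := by ring
        _ ≤ _ := h4
        _ = _ := by ring
    exact le_of_mul_le_mul_left h5 (by positivity)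
  have h6 : ∑ s, n s * Real.log (u s) = Real.log (∏ s, u s ^ n s) := by
    rw [Real.log_prod fun s _ => (pow_pos (hu s) _).ne']
    simp_rw [Real.log_pow]
  rw [h6]
  have hN1 : (0 : ℝ) < (N : ℝ) + 1 := by positivity
  calc _ ≤ Real.log (K * (N + 1) ^ (Fintype.card S - 1)) :=
        Real.log_le_log (Finset.prod_pos fun s _ => pow_pos (hu s) _) h3
    _ = Real.log K + ((Fintype.card S - 1 : ℕ) : ℝ) * Real.log (N + 1) := by
        rw [Real.log_mul hK.ne' (by positivity), Real.log_pow]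
    _ ≤ _ := by
        gcongr
        · exact Real.log_nonneg (by linarith [(Nat.cast_nonneg N : (0 : ℝ) ≤ N)])
        · omega

end Laplace

/-! ### Typicality with high probability. -/

section Concentration

variable {S A : Type*} {H : ℕ} [Fintype S] [Fintype A] {M : MDP S A H}
  {Ω : Type*} [MeasurableSpace Ω] {μ : MeasureTheory.Measure Ω}
  {pol : ℕ → Ω → DetPolicy S A H} {traj : ℕ → Ω → Traj S A H}

theorem IsRun.laplace [MeasureTheory.IsProbabilityMeasure μ] (hr : IsRun M μ pol traj)
    [Nonempty (Fin H)] [Nonempty S] (h : Fin H) (hh : h.val + 1 < H) (s : S) (a : A) {K : ℝ}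
    (hK : 0 < K) :
    μ {ω | ∃ t, ¬ laplaceProb (transCounts (fun i => traj i ω) t h hh s a) ≤
      K * ∏ s', (M.trans h s a s').toReal ^ transCounts (fun i => traj i ω) t h hh s a s'} ≤
      ENNReal.ofReal (1 / K) := by
  classical
  let w : (S → ℕ) → ℝ≥0∞ := fun n =>
    ENNReal.ofReal (laplaceProb n) / ∏ s', M.trans h s a s' ^ n s'
  have hw : ∀ n : S → ℕ, ∑ s', M.trans h s a s' * w (n + Pi.single s' 1) ≤ w n := fun n =>
    sum_mul_laplaceProb_div_le _ (fun s' => PMF.apply_ne_top _ _) n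
  have key := hr.ville (W := fun t _ x => w (transCounts x t h hh s a))
    (fun t q q' x x' hx => by
      simp only [transCounts_congr fun i hi => (hx i hi).2])
    (fun q x => by
      have : transCounts x 0 h hh s a = fun _ => 0 := by
        funext s'; simp [transCounts]
      simp only [this, w, laplaceProb]
      simpa using div_self_le_one _)
    (fun t q x => by
      let n := transCounts x t h hh s a
      let G : S × A → S → ℝ≥0∞ := fun u s' => if u = (s, a) then w (n + Pi.single s' 1) else w n
      have e : ∀ v, w (transCounts (Function.update x t v) (t + 1) h hh s a) =
          G (v h) (v ⟨h.val + 1, hh⟩).1 := by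
        intro v
        have e1 : transCounts (Function.update x t v) t = transCounts x t :=
          transCounts_congr fun i hi => Function.update_of_ne hi.ne _ _
        have e2 : transCounts (Function.update x t v) (t + 1) h hh s a =
            if v h = (s, a) then n + Pi.single (v ⟨h.val + 1, hh⟩).1 1 else n := by
          funext s'
          rw [transCounts_succ, e1, Function.update_self]
          by_cases hv : v h = (s, a)
          · simp only [hv, true_and, if_true, Pi.add_apply, n, Pi.single_apply]
            simp only [eq_comm]
          · simp [hv, n]
        rw [e2]
        simp only [G]
        split_ifs <;> rfl
      simp_rw [e]
      rw [sum_trajProb_mul M _ h hh G]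
      calc _ ≤ ∑ v, M.trajProb (q t).toStoch v * w n := by
            gcongr with v
            by_cases hv : v h = (s, a)
            · simp only [G, hv, if_true]
              exact hw n
            · simp only [G, hv, if_false]
              rw [← Finset.sum_mul, PMF_sum_eq_one, one_mul]
        _ = w n := by rw [← Finset.sum_mul, sum_trajProb, one_mul])
    (ENNReal.ofReal K)
  have hsub : {ω | ∃ t, ¬ laplaceProb (transCounts (fun i => traj i ω) t h hh s a) ≤
      K * ∏ s', (M.trans h s a s').toReal ^ transCounts (fun i => traj i ω) t h hh s a s'} ⊆
      {ω | ∃ t, ENNReal.ofReal K ≤ w (transCounts (fun i => traj i ω) t h hh s a)} := by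
    rintro ω ⟨t, ht⟩
    refine ⟨t, ?_⟩
    set n := transCounts (fun i => traj i ω) t h hh s a
    have hne : ∏ s', M.trans h s a s' ^ n s' ≠ ⊤ :=
      ENNReal.prod_ne_top fun s' _ => ENNReal.pow_ne_top (PMF.apply_ne_top _ _)
    rw [ENNReal.le_div_iff_mul_le (Or.inr (by simp [laplaceProb_pos n])) (Or.inl hne)]
    rw [← ENNReal.ofReal_toReal hne, ← ENNReal.ofReal_mul hK.le]
    refine ENNReal.ofReal_le_ofReal ?_
    rw [ENNReal.toReal_prod]
    simp_rw [ENNReal.toReal_pow]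
    exact (not_le.1 ht).le
  refine (MeasureTheory.measure_mono hsub).trans ?_
  have := (ENNReal.le_inv_iff_mul_le (b := ENNReal.ofReal K)).2 ((mul_comm _ _).le.trans key)
  rwa [← ENNReal.ofReal_inv_of_pos hK, ← one_div] at this

/-- All transition counts are typical at the levels `β`. -/
def TypicalRun (M : MDP S A H) (δ : ℝ) (y : ℕ → Traj S A H) : Prop :=
  ∀ t h (hh : h.val + 1 < H) s a, Typical (transCounts y t h hh s a)
    (fun s' => (M.trans h s a s').toReal) (ucbBeta S A H δ (counts y t (h, s, a)))

theorem IsRun.measure_not_typicalRun_le [MeasureTheory.IsProbabilityMeasure μ]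
    (hr : IsRun M μ pol traj) [Nonempty (Fin H)] [Nonempty S] [Nonempty A] {δ : ℝ} (hδ : 0 < δ) :
    μ {ω | ¬ TypicalRun M δ fun i => traj i ω} ≤ ENNReal.ofReal (δ / 2) := by
  have hH : 0 < H := Fin.pos (Classical.arbitrary (Fin H))
  have hS : 0 < Fintype.card S := Fintype.card_pos
  have hA : 0 < Fintype.card A := Fintype.card_pos
  -- With this `K`, the union bound over `HSA` triplets costs `δ / 2`, and `log K` is the first term
  -- of `β`.
  set K : ℝ := 2 * Fintype.card S * Fintype.card A * H / δ with hKdef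
  have hK : 0 < K := by positivity
  have hsub : {ω | ¬ TypicalRun M δ fun i => traj i ω} ⊆
      ⋃ z : Fin H × S × A, {ω | ∃ (hh : z.1.val + 1 < H), ∃ t,
        ¬ laplaceProb (transCounts (fun i => traj i ω) t z.1 hh z.2.1 z.2.2) ≤
      K * ∏ s', (M.trans z.1 z.2.1 z.2.2 s').toReal ^
        transCounts (fun i => traj i ω) t z.1 hh z.2.1 z.2.2 s'} := by
    intro ω hω
    by_contra hcon
    apply hω
    intro t h hh s a
    simp only [Set.mem_iUnion, Set.mem_ofPred_eq, not_exists, not_not] at hcon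
    have h1 := typical_of_laplaceProb_le _ _ (fun s' => ENNReal.toReal_nonneg) hK
      (hcon (h, s, a) hh t)
    intro u hu hpu
    refine (h1 u hu hpu).trans ?_
    unfold ucbBeta
    rw [← hKdef]
    have h2 := sum_transCounts (fun i => traj i ω) t h hh s a
    have h3 : (∑ s', (transCounts (fun i => traj i ω) t h hh s a s' : ℝ)) =
        counts (fun i => traj i ω) t (h, s, a) := by exact_mod_cast h2
    push_cast
    rw [h3]
    set n : ℝ := (counts (fun i => traj i ω) t (h, s, a) : ℝ)
    have hn : 0 ≤ n := Nat.cast_nonneg _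
    have he : 1 ≤ Real.exp 1 := Real.one_le_exp zero_le_one
    gcongr
    nlinarith
  refine (MeasureTheory.measure_mono hsub).trans
    ((MeasureTheory.measure_iUnion_fintype_le _ _).trans ?_)
  calc _ ≤ ∑ z : Fin H × S × A, ENNReal.ofReal (1 / K) := by
        refine Finset.sum_le_sum fun z _ => ?_
        by_cases hh : z.1.val + 1 < H
        · refine le_trans (MeasureTheory.measure_mono ?_) (hr.laplace z.1 hh z.2.1 z.2.2 hK)
          rintro ω ⟨_, h⟩
          exact h
        · simp [hh]
    _ = ENNReal.ofReal (δ / 2) := by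
        rw [Finset.sum_const, nsmul_eq_mul, Finset.card_univ, ← ENNReal.ofReal_natCast,
          ← ENNReal.ofReal_mul (by positivity)]
        congr 1
        simp only [Fintype.card_prod, Fintype.card_fin, hKdef]
        push_cast
        field_simp

end Concentration

/-! ### Bernstein inequalities from typicality. -/

section EmpiricalMeans

variable {S : Type*} [Fintype S] {n : S → ℕ} {p : S → ℝ} {b : ℝ} {f : S → ℝ}

theorem neg_sub_sq_le_log_one_sub {y : ℝ} (h0 : -1 ≤ y) (h1 : y ≤ 1 / 2) :
    -y - y ^ 2 ≤ Real.log (1 - y) := by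
  rcases le_total 0 y with hy | hy
  · rw [Real.le_log_iff_exp_le (by linarith), show -y - y ^ 2 = -(y + y ^ 2) by ring, Real.exp_neg,
      inv_le_comm₀ (Real.exp_pos _) (by linarith)]
    refine le_trans ?_ (Real.quadratic_le_exp_of_nonneg (x := y + y ^ 2) (by positivity))
    rw [inv_le_iff_one_le_mul₀ (by linarith)]
    have h2 : y ^ 3 ≤ y ^ 2 / 2 := by nlinarith [sq_nonneg y]
    have h3 : y ^ 4 ≤ y ^ 2 / 4 := by nlinarith [sq_nonneg y, mul_nonneg hy (sq_nonneg y)]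
    have h4 : y ^ 5 ≤ y ^ 2 / 8 := by
      have : y ^ 5 = y ^ 4 * y := by ring
      nlinarith [sq_nonneg y, mul_nonneg hy (sq_nonneg y), pow_nonneg hy 4]
    nlinarith [sq_nonneg y]
  · have := Real.le_log_one_add_of_nonneg (x := -y) (by linarith)
    rw [← sub_eq_add_neg] at this
    refine le_trans ?_ this
    rw [le_div_iff₀ (by linarith)]
    nlinarith [sq_nonneg y, mul_nonneg (neg_nonneg.2 hy) (sq_nonneg y)]

/-- Empirical Bernstein inequality. The test function `1 - η (f - m)` has mean one under `p`, and
`log (1 - y) ≥ -y - y²` turns typicality into `η D - η² (v + D²) ≤ b / N`, where `D` is the true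
mean minus the empirical one and `v` the empirical variance. A gap `D` above the bonus contradicts
this for `η = 2 b / (N D)`. -/
theorem Typical.mean_le (hn : Typical n p b) (hp : ∀ s, 0 ≤ p s) (hp1 : ∑ s, p s = 1)
    (hf0 : ∀ s, 0 ≤ f s) (hf1 : ∀ s, f s ≤ 1) (hb : 0 < b) {N : ℝ} (hN : ∑ s, (n s : ℝ) = N)
    (hN0 : 0 < N) :
    ∑ s, p s * f s ≤ ∑ s, n s / N * f s +
      max √(8 * (∑ s, n s / N * (f s - ∑ s, n s / N * f s) ^ 2) * b / N) (8 * b / N) := by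
  set e := ∑ s, n s / N * f s with he
  set m := ∑ s, p s * f s with hm
  set v := ∑ s, n s / N * (f s - e) ^ 2 with hv
  have hq1 : ∑ s, (n s : ℝ) / N = 1 := by rw [← Finset.sum_div, hN, div_self hN0.ne']
  have hm0 : 0 ≤ m := Finset.sum_nonneg fun s _ => mul_nonneg (hp s) (hf0 s)
  have hm1 : m ≤ 1 := by
    rw [← hp1]; exact Finset.sum_le_sum fun s _ => mul_le_of_le_one_right (hp s) (hf1 s)
  have he0 : 0 ≤ e := Finset.sum_nonneg fun s _ => mul_nonneg (by positivity) (hf0 s)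
  by_contra! hcon
  set c := b / N with hc
  have hc0 : 0 < c := by positivity
  set D := m - e with hD
  have hD1 : D ≤ 1 := by linarith
  have hlt1 : 8 * c < D := by
    have := le_max_right √(8 * v * b / N) (8 * b / N)
    rw [hc, ← mul_div_assoc]; linarith
  have hD0 : 0 < D := by linarith
  have hlt2 : 8 * v * c < D ^ 2 := by
    rw [← Real.sqrt_lt' hD0, hc, ← mul_div_assoc]
    have := le_max_left √(8 * v * b / N) (8 * b / N)
    linarith
  set η := 2 * c / D with hη
  have hη0 : 0 < η := by positivity
  have hη1 : η ≤ 1 / 4 := by rw [hη, div_le_iff₀ hD0]; linarith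
  have hηD : η * D = 2 * c := by rw [hη]; field_simp
  have hy : ∀ s, -(1 / 4) ≤ η * (f s - m) ∧ η * (f s - m) ≤ 1 / 4 := by
    intro s
    have := hf0 s
    have := hf1 s
    constructor <;> nlinarith
  have h1 := hn (fun s => 1 - η * (f s - m)) (fun s => by linarith [(hy s).2]) (by
    have : ∀ s, p s * (1 - η * (f s - m)) = p s - η * (p s * f s) + η * m * p s := fun s => by ring
    simp_rw [this]
    rw [Finset.sum_add_distrib, Finset.sum_sub_distrib, ← Finset.mul_sum, ← Finset.mul_sum, hp1,
      ← hm]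
    linarith)
  have h2 : ∑ s, (n s : ℝ) / N * (-(η * (f s - m)) - (η * (f s - m)) ^ 2) ≤ c := by
    rw [hc, le_div_iff₀ hN0]
    refine le_trans ?_ h1
    rw [Finset.sum_mul]
    refine Finset.sum_le_sum fun s _ => ?_
    rw [mul_assoc, mul_comm _ N, ← mul_assoc, div_mul_cancel₀ _ hN0.ne']
    exact mul_le_mul_of_nonneg_left
      (neg_sub_sq_le_log_one_sub (by linarith [(hy s).1]) (by linarith [(hy s).2]))
      (Nat.cast_nonneg _)
  have h3 : ∑ s, (n s : ℝ) / N * (-(η * (f s - m)) - (η * (f s - m)) ^ 2) =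
      η * D - η ^ 2 * (v + D ^ 2) := by
    have : ∀ s, (n s : ℝ) / N * (-(η * (f s - m)) - (η * (f s - m)) ^ 2) =
        -η * (n s / N * f s) + η * m * (n s / N) - η ^ 2 * (n s / N * (f s - e) ^ 2) +
          2 * η ^ 2 * D * (n s / N * f s) - 2 * η ^ 2 * D * e * (n s / N)
          - η ^ 2 * D ^ 2 * (n s / N) := by
      intro s; rw [hD]; ring
    simp_rw [this]
    simp only [Finset.sum_add_distrib, Finset.sum_sub_distrib, ← Finset.mul_sum, hq1]
    rw [← he, ← hv, hD]
    ring
  rw [h3] at h2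
  have h4 : c * D ^ 2 ≤ (η * D) ^ 2 * (v + D ^ 2) := by nlinarith [sq_nonneg D]
  rw [hηD] at h4
  have h5 : D ^ 2 ≤ 4 * c * (v + D ^ 2) := by
    have : c * D ^ 2 ≤ c * (4 * c * (v + D ^ 2)) := by nlinarith
    exact le_of_mul_le_mul_left this hc0
  -- Both halves of the maximum enter: `4 c v < D² / 2` and `4 c D² < D³ / 2 ≤ D² / 2`.
  nlinarith [pow_pos hD0 2, pow_pos hD0 3]

/-- The test function is `exp (η f - (η + η²) m)`. Its mean is at most one because `exp x ≤ 1 + x +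
x²` for `|x| ≤ 1` and `f² ≤ f`. The multiplicative form suits a recursion over `H` stages, with `η`
of order `1 / H`. -/
theorem Typical.empirical_le (hn : Typical n p b) (hp : ∀ s, 0 ≤ p s) (hp1 : ∑ s, p s = 1)
    (hf0 : ∀ s, 0 ≤ f s) (hf1 : ∀ s, f s ≤ 1) {N : ℝ} (hN : ∑ s, (n s : ℝ) = N)
    (hN0 : 0 < N) {η : ℝ} (hη0 : 0 < η) (hη1 : η ≤ 1) :
    ∑ s, n s / N * f s ≤ (1 + η) * ∑ s, p s * f s + b / N / η := by
  set m := ∑ s, p s * f s with hm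
  have h1 := hn (fun s => Real.exp (η * f s - (η + η ^ 2) * m)) (fun s => Real.exp_pos _) (by
    calc ∑ s, p s * Real.exp (η * f s - (η + η ^ 2) * m)
        ≤ ∑ s, (p s + (η + η ^ 2) * (p s * f s)) * Real.exp (-((η + η ^ 2) * m)) := by
          refine Finset.sum_le_sum fun s _ => ?_
          rw [sub_eq_add_neg, Real.exp_add, ← mul_assoc]
          refine mul_le_mul_of_nonneg_right ?_ (Real.exp_pos _).le
          have h2 : |η * f s| ≤ 1 := by
            rw [abs_of_nonneg (mul_nonneg hη0.le (hf0 s))]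
            exact mul_le_one₀ hη1 (hf0 s) (hf1 s)
          have h3 := (abs_le.1 (Real.abs_exp_sub_one_sub_id_le h2)).2
          have h4 : (η * f s) ^ 2 ≤ η ^ 2 * f s := by
            have := mul_le_mul_of_nonneg_left (hf1 s) (hf0 s)
            nlinarith [sq_nonneg η]
          have h5 : Real.exp (η * f s) ≤ 1 + (η + η ^ 2) * f s := by linarith
          have := mul_le_mul_of_nonneg_left h5 (hp s)
          linarith
      _ = ((η + η ^ 2) * m + 1) * Real.exp (-((η + η ^ 2) * m)) := by
          rw [← Finset.sum_mul, Finset.sum_add_distrib, ← Finset.mul_sum, hp1, ← hm]; ring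
      _ ≤ Real.exp ((η + η ^ 2) * m) * Real.exp (-((η + η ^ 2) * m)) :=
          mul_le_mul_of_nonneg_right (Real.add_one_le_exp _) (Real.exp_pos _).le
      _ = 1 := by rw [← Real.exp_add]; simp)
  simp_rw [Real.log_exp] at h1
  have h2 : ∑ s, n s * (η * f s - (η + η ^ 2) * m) =
      η * N * (∑ s, n s / N * f s - (1 + η) * m) := by
    have : ∀ s, n s * (η * f s - (η + η ^ 2) * m) =
        η * N * (n s / N * f s) - (η + η ^ 2) * m * n s := by intro s; field_simp
    simp_rw [this]
    rw [Finset.sum_sub_distrib, ← Finset.mul_sum, ← Finset.mul_sum, hN]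
    ring
  rw [h2] at h1
  rw [div_div, ← sub_le_iff_le_add', le_div_iff₀ (by positivity)]
  linarith

/-- A `[0, 1]`-valued function has variance at most its mean, and AM-GM splits `√(8 v c)` into `η v
+ 2 c / η`. The bonus becomes a small multiple of the mean plus a multiple of `c`. -/
theorem bonus_le {w : S → ℝ} (hw : ∀ s, 0 ≤ w s) (hw1 : ∑ s, w s = 1)
    (hf0 : ∀ s, 0 ≤ f s) (hf1 : ∀ s, f s ≤ 1) {c : ℝ} (hc : 0 ≤ c) {η : ℝ} (hη0 : 0 < η) :
    max √(8 * (∑ s, w s * (f s - ∑ s, w s * f s) ^ 2) * c) (8 * c) ≤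
      η * ∑ s, w s * f s + 2 * c / η + 8 * c := by
  set e := ∑ s, w s * f s with he
  set v := ∑ s, w s * (f s - e) ^ 2 with hv
  have he0 : 0 ≤ e := Finset.sum_nonneg fun s _ => mul_nonneg (hw s) (hf0 s)
  have hv0 : 0 ≤ v := Finset.sum_nonneg fun s _ => mul_nonneg (hw s) (sq_nonneg _)
  have hve : v ≤ e := by
    have h1 : v = ∑ s, w s * f s ^ 2 - e ^ 2 := by
      have : ∀ s, w s * (f s - e) ^ 2 = w s * f s ^ 2 - 2 * e * (w s * f s) + e ^ 2 * w s :=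
        fun s => by ring
      rw [hv]
      simp_rw [this]
      rw [Finset.sum_add_distrib, Finset.sum_sub_distrib, ← Finset.mul_sum, ← Finset.mul_sum, hw1,
        ← he]
      ring
    have h2 : ∑ s, w s * f s ^ 2 ≤ e := Finset.sum_le_sum fun s _ =>
      mul_le_mul_of_nonneg_left (by nlinarith [hf0 s, hf1 s]) (hw s)
    nlinarith [sq_nonneg e]
  have h1 : √(8 * v * c) ≤ η * v + 2 * c / η := by
    refine Real.sqrt_le_iff.2 ⟨by positivity, ?_⟩
    have : η * v * (2 * c / η) = 2 * v * c := by field_simp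
    nlinarith [sq_nonneg (η * v - 2 * c / η)]
  have h2 : 0 ≤ 2 * c / η := by positivity
  refine max_le ?_ ?_
  · nlinarith
  · nlinarith [mul_nonneg hη0.le he0]

end EmpiricalMeans

/-! ### Backward induction on the stages. -/

section Telescoping

variable {S A : Type*} {H : ℕ} [Fintype S] [Fintype A] (M : MDP S A H)

theorem sum_stages_ge (g : Fin H → ℝ) (h : Fin H) :
    ∑ i, (if h.val ≤ i.val then g i else 0) =
      g h + ∑ i : Fin H, if h.val + 1 ≤ i.val then g i else 0 := by
  rw [← Finset.add_sum_erase _ _ (Finset.mem_univ h), if_pos le_rfl,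
    ← Finset.add_sum_erase (a := h) (f := fun i : Fin H => if h.val + 1 ≤ i.val then g i else 0) _
      (Finset.mem_univ h)]
  simp only [show ¬ h.val + 1 ≤ h.val by omega, if_false, zero_add]
  congr 1
  refine Finset.sum_congr rfl fun i hi => ?_
  have : i.val ≠ h.val := fun e => Finset.ne_of_mem_erase hi (Fin.ext e)
  by_cases h1 : h.val + 1 ≤ i.val
  · rw [if_pos h1, if_pos (by omega)]
  · rw [if_neg h1, if_neg (by omega)]

theorem sum_stages_ge_last (g : Fin H → ℝ) (h : Fin H) (hh : ¬ h.val + 1 < H) :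
    ∑ i : Fin H, (if h.val + 1 ≤ i.val then g i else 0) = 0 :=
  Finset.sum_eq_zero fun i _ => if_neg (by omega)

set_option linter.unusedSectionVars false in
theorem next_nonneg (h : Fin H) (s : S) (a : A) {f : S → ℝ} (hf : ∀ s, 0 ≤ f s) :
    0 ≤ M.next h s a f :=
  Finset.sum_nonneg fun s' _ => mul_nonneg ENNReal.toReal_nonneg (hf s')

set_option linter.unusedSectionVars false in
theorem next_mono (h : Fin H) (s : S) (a : A) {f g : S → ℝ} (hf : ∀ s, f s ≤ g s) :
    M.next h s a f ≤ M.next h s a g :=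
  Finset.sum_le_sum fun s' _ => mul_le_mul_of_nonneg_left (hf s') ENNReal.toReal_nonneg

set_option linter.unusedSectionVars false in
theorem sum_trans_toReal (h : Fin H) (s : S) (a : A) :
    ∑ s', (M.trans h s a s').toReal = 1 := by
  rw [← ENNReal.toReal_sum fun s' _ => PMF.apply_ne_top _ _, PMF_sum_eq_one, ENNReal.toReal_one]

theorem next_const (h : Fin H) (s : S) (a : A) (c : ℝ) : M.next h s a (fun _ => c) = c := by
  rw [MDP.next, ← Finset.sum_mul, sum_trans_toReal, one_mul]

variable [Nonempty (Fin H)]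

/-- The expected return of a policy is at most any superharmonic function. -/
theorem expect_sum_le_of_superharmonic (π : StochPolicy S A H) (g : Fin H × S × A → ℝ)
    (U : Fin H → S → ℝ) (hU : ∀ h s, 0 ≤ U h s)
    (hstep : ∀ h (hh : h.val + 1 < H) s a,
      g (h, s, a) + M.next h s a (U ⟨h.val + 1, hh⟩) ≤ U h s)
    (hlast : ∀ h s a, ¬ h.val + 1 < H → g (h, s, a) ≤ U h s) (h0 : Fin H) (hh0 : h0.val = 0) :
    M.expect π (fun x => ∑ h, g (h, x h)) ≤ U h0 M.init := by
  have key : ∀ d : ℕ, ∀ h : Fin H, h.val + d + 1 = H →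
      M.expect π (fun x => ∑ i : Fin H, if h.val ≤ i.val then g (i, x i) else 0) ≤
        M.expect π (fun x => U h (x h).1) := by
    intro d
    induction d with
    | zero =>
      intro h hd
      refine expect_mono M π fun x _ => ?_
      rw [sum_stages_ge (fun i => g (i, x i)) h, sum_stages_ge_last _ _ (by omega), add_zero]
      exact hlast h _ _ (by omega)
    | succ d ih =>
      intro h hd
      have hh : h.val + 1 < H := by omega
      have h1 := ih ⟨h.val + 1, hh⟩ (by simp only; omega)
      rw [expect_next M π h hh fun s => hU _ s] at h1
      calc _ = M.expect π (fun x => g (h, x h)) + M.expect π (fun x => ∑ i : Fin H,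
              if h.val + 1 ≤ i.val then g (i, x i) else 0) := by
            rw [← expect_add]
            exact expect_congr M π fun x _ => sum_stages_ge (fun i => g (i, x i)) h
        _ ≤ M.expect π (fun x => g (h, x h)) +
            M.expect π (fun x => M.next h (x h).1 (x h).2 (U ⟨h.val + 1, hh⟩)) := by
              gcongr
        _ ≤ _ := by
            rw [← expect_add]
            exact expect_mono M π fun x _ => hstep h hh _ _
  have h1 := key (H - 1) h0 (by have := h0.2; omega)
  simp only [hh0, Nat.zero_le, if_true] at h1
  refine h1.trans (le_of_eq ?_)
  rw [← expect_const M π (U h0 M.init)]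
  exact expect_congr M π fun x hx => by rw [eq_init_of_trajProb_ne_zero hx h0 hh0]

/-- Unrolling the recursion multiplies the contribution of each stage by at most `κ ^ H`. The
inequality is needed only at the actions of `π`, as trajectories of positive probability follow `π`.
-/
theorem le_mul_expect_sum_of_subharmonic (π : DetPolicy S A H) (g : Fin H × S × A → ℝ)
    (hg : ∀ z, 0 ≤ g z) (U : Fin H → S → ℝ) (hU : ∀ h s, 0 ≤ U h s) {κ : ℝ} (hκ : 1 ≤ κ)
    (hstep : ∀ h (hh : h.val + 1 < H) s,
      U h s ≤ g (h, s, π h s) + κ * M.next h s (π h s) (U ⟨h.val + 1, hh⟩))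
    (hlast : ∀ h s, ¬ h.val + 1 < H → U h s ≤ g (h, s, π h s)) (h0 : Fin H) (hh0 : h0.val = 0) :
    U h0 M.init ≤ κ ^ H * M.expect π.toStoch (fun x => ∑ h, g (h, x h)) := by
  have hact : ∀ (x : Traj S A H) (h : Fin H), M.trajProb π.toStoch x ≠ 0 →
      x h = ((x h).1, π h (x h).1) := fun x h hx =>
    Prod.ext rfl (eq_action_of_trajProb_ne_zero hx h)
  have hnn : ∀ f : Traj S A H → ℝ, (∀ x, 0 ≤ f x) → 0 ≤ M.expect π.toStoch f := fun f hf =>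
    Finset.sum_nonneg fun x _ => mul_nonneg ENNReal.toReal_nonneg (hf x)
  have key : ∀ d : ℕ, ∀ h : Fin H, h.val + d + 1 = H →
      M.expect π.toStoch (fun x => U h (x h).1) ≤ κ ^ (d + 1) * M.expect π.toStoch
        (fun x => ∑ i : Fin H, if h.val ≤ i.val then g (i, x i) else 0) := by
    intro d
    induction d with
    | zero =>
      intro h hd
      rw [zero_add, pow_one, ← expect_mul_left]
      refine expect_mono M _ fun x hx => ?_
      rw [sum_stages_ge (fun i => g (i, x i)) h, sum_stages_ge_last _ _ (by omega), add_zero]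
      have := hlast h (x h).1 (by omega)
      rw [← hact x h hx] at this
      nlinarith [hg (h, x h)]
    | succ d ih =>
      intro h hd
      have hh : h.val + 1 < H := by omega
      have h1 := ih ⟨h.val + 1, hh⟩ (by simp only; omega)
      rw [expect_next M _ h hh fun s => hU _ s] at h1
      have h2 : 0 ≤ M.expect π.toStoch (fun x => g (h, x h)) := hnn _ fun x => hg _
      calc _ ≤ M.expect π.toStoch (fun x => g (h, x h)) +
            κ * M.expect π.toStoch (fun x => M.next h (x h).1 (x h).2 (U ⟨h.val + 1, hh⟩)) := by
            rw [← expect_mul_left, ← expect_add]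
            refine expect_mono M _ fun x hx => ?_
            have := hstep h hh (x h).1
            rwa [← hact x h hx, ← eq_action_of_trajProb_ne_zero hx h] at this
        _ ≤ κ ^ (d + 2) * M.expect π.toStoch (fun x => g (h, x h)) +
            κ * (κ ^ (d + 1) * M.expect π.toStoch
              (fun x => ∑ i : Fin H, if h.val + 1 ≤ i.val then g (i, x i) else 0)) := by
            gcongr
            exact le_mul_of_one_le_left h2 (one_le_pow₀ hκ)
        _ = κ ^ (d + 2) * (M.expect π.toStoch (fun x => g (h, x h)) + M.expect π.toStoch
              (fun x => ∑ i : Fin H, if h.val + 1 ≤ i.val then g (i, x i) else 0)) := by ring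
        _ = _ := by
            rw [← expect_add]
            congr 1
            exact expect_congr M _ fun x _ => (sum_stages_ge (fun i => g (i, x i)) h).symm
  have h1 := key (H - 1) h0 (by have := h0.2; omega)
  simp only [hh0, Nat.zero_le, if_true] at h1
  rw [Nat.sub_add_cancel (Fin.pos h0)] at h1
  refine le_trans (le_of_eq ?_) h1
  rw [← expect_const M π.toStoch (U h0 M.init)]
  exact expect_congr M _ fun x hx => by rw [eq_init_of_trajProb_ne_zero hx h0 hh0]

end Telescoping

/-! ### Optimism and accuracy of UCBVI. -/

section UCBVI

variable {S A : Type*} {H : ℕ} [Fintype S] [Fintype A] {M : MDP S A H} {δ : ℝ}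
  {y : ℕ → Traj S A H} {t : ℕ} {r : Fin H × S × A → ℝ}

/-- Optimistic state values. -/
noncomputable def ucbV (δ : ℝ) (y : ℕ → Traj S A H) (t : ℕ) (r : Fin H × S × A → ℝ) (h : Fin H)
    (s : S) : ℝ :=
  ⨆ a : A, ucbQ δ y t r h s a

theorem ucbQ_le_ucbV (h : Fin H) (s : S) (a : A) : ucbQ δ y t r h s a ≤ ucbV δ y t r h s :=
  le_ciSup (f := fun a => ucbQ δ y t r h s a) (Set.finite_range _).bddAbove a

theorem ucbV_eq_of_isGreedy {π : DetPolicy S A H} (hπ : IsGreedy (ucbQ δ y t r) π) (h : Fin H)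
    (s : S) : ucbV δ y t r h s = ucbQ δ y t r h s (π h s) :=
  have : Nonempty A := ⟨π h s⟩
  le_antisymm (ciSup_le fun a => hπ h s a) (ucbQ_le_ucbV h s _)

theorem ucbQ_of_counts_eq_zero {h : Fin H} (hh : h.val + 1 < H) {s : S} {a : A}
    (h0 : counts y t (h, s, a) = 0) : ucbQ δ y t r h s a = 1 := by
  rw [ucbQ, dif_pos hh, if_pos h0]

theorem ucbQ_of_counts_ne_zero {h : Fin H} (hh : h.val + 1 < H) {s : S} {a : A}
    (h0 : counts y t (h, s, a) ≠ 0) :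
    ucbQ δ y t r h s a = min (r (h, s, a) +
      ∑ s', transCounts y t h hh s a s' / (counts y t (h, s, a) : ℝ) *
        ucbV δ y t r ⟨h.val + 1, hh⟩ s' +
      max √(8 * (∑ s', transCounts y t h hh s a s' / (counts y t (h, s, a) : ℝ) *
          (ucbV δ y t r ⟨h.val + 1, hh⟩ s' -
            ∑ s', transCounts y t h hh s a s' / (counts y t (h, s, a) : ℝ) *
              ucbV δ y t r ⟨h.val + 1, hh⟩ s') ^ 2) *
          ucbBeta S A H δ (counts y t (h, s, a)) / (counts y t (h, s, a) : ℝ))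
        (8 * ucbBeta S A H δ (counts y t (h, s, a)) / (counts y t (h, s, a) : ℝ))) 1 := by
  rw [ucbQ, dif_pos hh, if_neg h0]
  rfl

theorem ucbQ_last {h : Fin H} (hh : ¬ h.val + 1 < H) (s : S) (a : A) :
    ucbQ δ y t r h s a = r (h, s, a) := by
  rw [ucbQ, dif_neg hh]

theorem ucbQ_le_one (hr1 : ∀ z, r z ≤ 1) (h : Fin H) (s : S) (a : A) :
    ucbQ δ y t r h s a ≤ 1 := by
  by_cases hh : h.val + 1 < H
  · by_cases h0 : counts y t (h, s, a) = 0
    · rw [ucbQ_of_counts_eq_zero hh h0]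
    · rw [ucbQ_of_counts_ne_zero hh h0]
      exact min_le_right _ _
  · rw [ucbQ_last hh]
    exact hr1 _

theorem ucbV_le_one [Nonempty A] (hr1 : ∀ z, r z ≤ 1) (h : Fin H) (s : S) :
    ucbV δ y t r h s ≤ 1 :=
  ciSup_le fun a => ucbQ_le_one hr1 h s a

theorem ucbQ_nonneg (hr0 : ∀ z, 0 ≤ r z) (h : Fin H) (s : S) (a : A) :
    0 ≤ ucbQ δ y t r h s a := by
  have key : ∀ d : ℕ, ∀ h : Fin H, h.val + d + 1 = H → ∀ s a, 0 ≤ ucbQ δ y t r h s a := by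
    intro d
    induction d with
    | zero =>
      intro h hd s a
      rw [ucbQ_last (by omega)]
      exact hr0 _
    | succ d ih =>
      intro h hd s a
      have hh : h.val + 1 < H := by omega
      by_cases h0 : counts y t (h, s, a) = 0
      · rw [ucbQ_of_counts_eq_zero hh h0]
        exact zero_le_one
      · rw [ucbQ_of_counts_ne_zero hh h0]
        refine le_min (add_nonneg (add_nonneg (hr0 _) ?_) ?_) zero_le_one
        · exact Finset.sum_nonneg fun s' _ => mul_nonneg (by positivity)
            (Real.iSup_nonneg fun a' => ih ⟨h.val + 1, hh⟩ (by simp only; omega) s' a')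
        · exact (Real.sqrt_nonneg _).trans (le_max_left _ _)
  exact key (H - 1 - h.val) h (by omega) s a

theorem ucbV_nonneg (hr0 : ∀ z, 0 ≤ r z) (h : Fin H) (s : S) : 0 ≤ ucbV δ y t r h s :=
  Real.iSup_nonneg fun a => ucbQ_nonneg hr0 h s a

theorem ucbBeta_pos [Nonempty S] [Nonempty A] (hH : 0 < H) (hδ : 0 < δ) (hδ1 : δ ≤ 1) (n : ℕ) :
    0 < ucbBeta S A H δ n := by
  have hS : (1 : ℝ) ≤ Fintype.card S := by exact_mod_cast Fintype.card_pos
  have hA : (1 : ℝ) ≤ Fintype.card A := by exact_mod_cast Fintype.card_pos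
  have hH' : (1 : ℝ) ≤ H := by exact_mod_cast hH
  have he : 1 ≤ Real.exp 1 := Real.one_le_exp zero_le_one
  have hn : (0 : ℝ) ≤ n := Nat.cast_nonneg n
  unfold ucbBeta
  have h1 : 0 ≤ Real.log (2 * Fintype.card S * Fintype.card A * H / δ) := by
    refine Real.log_nonneg ?_
    rw [le_div_iff₀ hδ]
    have : (1 : ℝ) ≤ Fintype.card S * Fintype.card A * H :=
      one_le_mul_of_one_le_of_one_le (one_le_mul_of_one_le_of_one_le hS hA) hH'
    nlinarith
  have h2 : 0 < Real.log (8 * Real.exp 1 * (n + 1)) := Real.log_pos (by nlinarith)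
  positivity

set_option linter.unusedSectionVars false in
theorem sum_transCounts_cast {h : Fin H} (hh : h.val + 1 < H) (s : S) (a : A) :
    ∑ s', (transCounts y t h hh s a s' : ℝ) = counts y t (h, s, a) := by
  exact_mod_cast sum_transCounts y t h hh s a

/-- The bonus is exactly that of `Typical.mean_le`, so the empirical backup dominates the true one
up to the truncation at `1`. -/
theorem min_add_next_le_ucbQ [Nonempty A] (hδ : 0 < δ) (hδ1 : δ ≤ 1) (hy : TypicalRun M δ y)
    (hr0 : ∀ z, 0 ≤ r z) (hr1 : ∀ z, r z ≤ 1) {h : Fin H} (hh : h.val + 1 < H) (s : S) (a : A) :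
    min (r (h, s, a) + M.next h s a (ucbV δ y t r ⟨h.val + 1, hh⟩)) 1 ≤ ucbQ δ y t r h s a := by
  have : Nonempty S := ⟨s⟩
  by_cases h0 : counts y t (h, s, a) = 0
  · rw [ucbQ_of_counts_eq_zero hh h0]
    exact min_le_right _ _
  · rw [ucbQ_of_counts_ne_zero hh h0]
    refine min_le_min_right _ ?_
    rw [add_assoc]
    refine add_le_add_right ?_ _
    exact (hy t h hh s a).mean_le (fun s' => ENNReal.toReal_nonneg) (sum_trans_toReal M h s a)
      (ucbV_nonneg hr0 _) (ucbV_le_one hr1 _) (ucbBeta_pos (Fin.pos h) hδ hδ1 _)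
      (sum_transCounts_cast hh s a) (by exact_mod_cast Nat.pos_of_ne_zero h0)

/-- Per-visit width of the confidence intervals. -/
noncomputable def width (S A : Type*) [Fintype S] [Fintype A] (H : ℕ) (δ : ℝ) (n : ℕ) : ℝ :=
  if n = 0 then 1 else min 1 (48 * H * ucbBeta S A H δ n / n)

theorem width_le_one (n : ℕ) : width S A H δ n ≤ 1 := by
  unfold width
  split_ifs
  · exact le_rfl
  · exact min_le_left _ _

theorem width_nonneg [Nonempty S] [Nonempty A] (hH : 0 < H) (hδ : 0 < δ) (hδ1 : δ ≤ 1) (n : ℕ) :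
    0 ≤ width S A H δ n := by
  unfold width
  have := (ucbBeta_pos (S := S) (A := A) hH hδ hδ1 n).le
  split_ifs
  · exact zero_le_one
  · exact le_min zero_le_one (by positivity)

/-- With `η = 1 / (4 H)`, the empirical mean and the bonus each cost a factor `1 + η` on the next
value. The remainders of order `H β / n` are collected in `width`, whose value `1` at an unvisited
triplet absorbs the trivial bound. -/
theorem ucbQ_le_add_next [Nonempty A] (hδ : 0 < δ) (hδ1 : δ ≤ 1) (hy : TypicalRun M δ y)
    (hr0 : ∀ z, 0 ≤ r z) (hr1 : ∀ z, r z ≤ 1) {h : Fin H} (hh : h.val + 1 < H) (s : S) (a : A) :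
    ucbQ δ y t r h s a ≤ r (h, s, a) + width S A H δ (counts y t (h, s, a)) +
      (1 + 1 / (4 * (H : ℝ))) ^ 2 * M.next h s a (ucbV δ y t r ⟨h.val + 1, hh⟩) := by
  have : Nonempty S := ⟨s⟩
  have hH : (1 : ℝ) ≤ H := by exact_mod_cast Fin.pos h
  have hnext : 0 ≤ M.next h s a (ucbV δ y t r ⟨h.val + 1, hh⟩) :=
    next_nonneg M h s a (ucbV_nonneg hr0 _)
  have hone : ucbQ δ y t r h s a ≤ r (h, s, a) + 1 +
      (1 + 1 / (4 * (H : ℝ))) ^ 2 * M.next h s a (ucbV δ y t r ⟨h.val + 1, hh⟩) := by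
    have := mul_nonneg (sq_nonneg (1 + 1 / (4 * (H : ℝ)))) hnext
    linarith [ucbQ_le_one (δ := δ) (y := y) (t := t) hr1 h s a, hr0 (h, s, a)]
  unfold width
  split_ifs with h0
  · exact hone
  rcases min_choice 1 (48 * (H : ℝ) * ucbBeta S A H δ (counts y t (h, s, a)) /
    (counts y t (h, s, a) : ℕ)) with hm | hm <;> rw [hm]
  · exact hone
  rw [ucbQ_of_counts_ne_zero hh h0]
  refine (min_le_left _ _).trans ?_
  set N : ℝ := ((counts y t (h, s, a) : ℕ) : ℝ) with hNdef
  set b := ucbBeta S A H δ (counts y t (h, s, a))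
  set V := ucbV δ y t r ⟨h.val + 1, hh⟩
  have hN0 : 0 < N := by rw [hNdef]; exact_mod_cast Nat.pos_of_ne_zero h0
  have hb : 0 < b := ucbBeta_pos (Fin.pos h) hδ hδ1 _
  have hsum := sum_transCounts_cast (y := y) (t := t) hh s a
  set η : ℝ := 1 / (4 * (H : ℝ)) with hη
  have hη0 : 0 < η := by positivity
  have hη1 : η ≤ 1 := by rw [hη, div_le_one (by positivity)]; linarith
  have h1 := (hy t h hh s a).empirical_le (fun s' => ENNReal.toReal_nonneg)
    (sum_trans_toReal M h s a) (f := V) (ucbV_nonneg hr0 _) (ucbV_le_one hr1 _) hsum hN0 hη0 hη1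
  have h2 := bonus_le (f := V) (w := fun s' => transCounts y t h hh s a s' / N)
    (fun s' => by positivity) (by rw [← Finset.sum_div, hsum, div_self hN0.ne'])
    (ucbV_nonneg hr0 _) (ucbV_le_one hr1 _) (c := b / N) (by positivity) hη0
  rw [← mul_div_assoc, ← mul_div_assoc] at h2
  set e := ∑ s', transCounts y t h hh s a s' / N * V s'
  change e ≤ (1 + η) * M.next h s a V + b / N / η at h1
  have h3 : b / N / η = 4 * H * b / N := by rw [hη]; field_simp
  have h4 : 2 * (b / N) / η = 8 * H * b / N := by rw [hη]; field_simp; ring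
  rw [h3] at h1
  have h5 : 8 * b / N ≤ 8 * H * b / N := by
    gcongr
    linarith
  have h6 : (1 + η) * (4 * H * b / N) ≤ 2 * (4 * H * b / N) := by
    gcongr
    linarith
  have h7 : (1 + η) * e ≤ (1 + η) * ((1 + η) * M.next h s a V + 4 * H * b / N) := by gcongr
  have h8 : 48 * H * b / N = 12 * (4 * H * b / N) := by ring
  have h9 : 8 * H * b / N = 2 * (4 * H * b / N) := by ring
  have h10 : 0 ≤ 4 * H * b / N := by positivity
  refine le_trans (add_le_add_right h2 _) ?_
  rw [h4]
  have h11 : (1 + η) * e = e + η * e := by ring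
  have h12 : (1 + η) * ((1 + η) * M.next h s a V + 4 * H * b / N) =
      (1 + η) ^ 2 * M.next h s a V + (1 + η) * (4 * H * b / N) := by ring
  linarith

/-- The factor `(1 + 1 / (4 H))²` per stage compounds to at most `exp (1 / 2) ≤ 2` over an episode.
-/
theorem ucbV_le_two_mul_expect [Nonempty A] (hδ : 0 < δ) (hδ1 : δ ≤ 1)
    (hy : TypicalRun M δ y) (hr0 : ∀ z, 0 ≤ r z) (hr1 : ∀ z, r z ≤ 1) {π : DetPolicy S A H}
    (hπ : IsGreedy (ucbQ δ y t r) π) (h0 : Fin H) (hh0 : h0.val = 0) :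
    ucbV δ y t r h0 M.init ≤ 2 * M.expect π.toStoch
      (fun x => ∑ h, (r (h, x h) + width S A H δ (counts y t (h, x h)))) := by
  have : Nonempty (Fin H) := ⟨h0⟩
  have : Nonempty S := ⟨M.init⟩
  have hH : (1 : ℝ) ≤ H := by exact_mod_cast Fin.pos h0
  have hw : ∀ n, 0 ≤ width S A H δ n := width_nonneg (Fin.pos h0) hδ hδ1
  have h1 := le_mul_expect_sum_of_subharmonic M π
    (fun z => r z + width S A H δ (counts y t z)) (fun z => add_nonneg (hr0 z) (hw _))
    (ucbV δ y t r) (ucbV_nonneg hr0) (κ := (1 + 1 / (4 * (H : ℝ))) ^ 2)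
    (one_le_pow₀ (by simp))
    (fun h hh s => by
      rw [ucbV_eq_of_isGreedy hπ]
      exact ucbQ_le_add_next hδ hδ1 hy hr0 hr1 hh s _)
    (fun h s hh => by
      rw [ucbV_eq_of_isGreedy hπ, ucbQ_last hh]
      linarith [hw (counts y t (h, s, π h s))]) h0 hh0
  refine h1.trans (mul_le_mul_of_nonneg_right ?_ ?_)
  · calc ((1 + 1 / (4 * (H : ℝ))) ^ 2) ^ H ≤ ((Real.exp (1 / (4 * (H : ℝ)))) ^ 2) ^ H := by
          gcongr
          linarith [Real.add_one_le_exp (1 / (4 * (H : ℝ)))]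
      _ = Real.exp (1 / 2) := by
          rw [← Real.exp_nat_mul, ← Real.exp_nat_mul]
          congr 1
          push_cast
          field_simp
          norm_num
      _ ≤ 2 := by
          have h2 : Real.exp (1 / 2) ^ 2 = Real.exp 1 := by
            rw [← Real.exp_nat_mul]; norm_num
          nlinarith [Real.exp_one_lt_d9, Real.exp_pos (1 / 2)]
  · exact Finset.sum_nonneg fun x _ => mul_nonneg ENNReal.toReal_nonneg
      (Finset.sum_nonneg fun h _ => add_nonneg (hr0 _) (hw _))

/-- Optimism. -/
theorem sum_occupancy_mul_le_ucbV [Nonempty A] (hδ : 0 < δ) (hδ1 : δ ≤ 1)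
    (hy : TypicalRun M δ y) (hr0 : ∀ z, 0 ≤ r z) (hr1 : ∑ z, r z ≤ 1) (π : StochPolicy S A H)
    (h0 : Fin H) (hh0 : h0.val = 0) :
    ∑ z, (M.occupancy π z).toReal * r z ≤ ucbV δ y t r h0 M.init := by
  have : Nonempty (Fin H) := ⟨h0⟩
  have hr1' : ∀ z, r z ≤ 1 := fun z =>
    (Finset.single_le_sum (fun z _ => hr0 z) (Finset.mem_univ z)).trans hr1
  let g : Fin H → ℝ := fun h => ∑ v, r (h, v)
  have hg0 : ∀ h, 0 ≤ g h := fun h => Finset.sum_nonneg fun v _ => hr0 _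
  have hrg : ∀ h s a, r (h, s, a) ≤ g h := fun h s a =>
    Finset.single_le_sum (f := fun v => r (h, v)) (fun v _ => hr0 _) (Finset.mem_univ (s, a))
  -- `R j` is the reward mass on the stages from `j` on. It is at most `1`, so truncating values at
  -- `1` loses nothing: the minimum of `ucbV` and `R` is superharmonic.
  let R : ℕ → ℝ := fun j => ∑ i : Fin H, if j ≤ i.val then g i else 0
  have hR0 : ∀ j, 0 ≤ R j := fun j => Finset.sum_nonneg fun i _ => by
    split_ifs
    · exact hg0 i
    · exact le_rfl
  have hR1 : ∀ j, R j ≤ 1 := by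
    intro j
    refine le_trans (Finset.sum_le_sum (g := g) fun i _ => ?_) ?_
    · split_ifs
      · exact le_rfl
      · exact hg0 i
    · rw [← Fintype.sum_prod_type]
      exact hr1
  have hRs : ∀ h : Fin H, R h.val = g h + R (h.val + 1) := fun h => sum_stages_ge g h
  rw [← expect_sum_stages]
  refine (expect_sum_le_of_superharmonic M π r (fun h s => min (ucbV δ y t r h s) (R h.val))
    (fun h s => le_min (ucbV_nonneg hr0 h s) (hR0 _)) (fun h hh s a => ?_) (fun h s a hh => ?_)
    h0 hh0).trans (min_le_left _ _)
  · have h1 : M.next h s a (fun s' => min (ucbV δ y t r ⟨h.val + 1, hh⟩ s') (R (h.val + 1))) ≤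
        M.next h s a (ucbV δ y t r ⟨h.val + 1, hh⟩) :=
      next_mono M h s a fun s' => min_le_left _ _
    have h2 : M.next h s a (fun s' => min (ucbV δ y t r ⟨h.val + 1, hh⟩ s') (R (h.val + 1))) ≤
        R (h.val + 1) :=
      (next_mono M h s a fun s' => min_le_right _ _).trans (next_const M h s a _).le
    have h3 := hRs h
    have h4 := hrg h s a
    refine le_min (le_trans ?_ ((min_add_next_le_ucbQ hδ hδ1 hy hr0 hr1' hh s a).trans
      (ucbQ_le_ucbV h s a))) (by simp only; linarith)
    refine le_min (by simp only; linarith) ?_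
    have := hR1 h.val
    simp only
    linarith
  · refine le_min ?_ ?_
    · rw [← ucbQ_last (δ := δ) (y := y) (t := t) (r := r) hh s a]
      exact ucbQ_le_ucbV h s a
    · rw [hRs h]
      linarith [hrg h s a, hR0 (h.val + 1)]

end UCBVI

/-! ### First-order regret of the weighted majority forecaster. -/

section Forecaster

variable {ι : Type*} {X : Finset ι}

/-- Potential of exponential weights with learning rate `ξ` at the cumulative losses `L`. -/
noncomputable def expPotential (X : Finset ι) (ξ : ℝ) (L : ι → ℝ) : ℝ :=
  -(Real.log ((∑ z ∈ X, Real.exp (-(ξ * L z))) / X.card) / ξ)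

theorem sum_exp_pos (hX : X.Nonempty) (f : ι → ℝ) : 0 < ∑ z ∈ X, Real.exp (f z) :=
  Finset.sum_pos (fun _ _ => Real.exp_pos _) hX

theorem expPotential_le (hX : X.Nonempty) {ξ : ℝ} (hξ : 0 < ξ) (L : ι → ℝ) {z : ι} (hz : z ∈ X) :
    expPotential X ξ L ≤ L z + Real.log X.card / ξ := by
  have hN : (0 : ℝ) < X.card := by exact_mod_cast hX.card_pos
  have h1 : Real.exp (-(ξ * L z)) ≤ ∑ z ∈ X, Real.exp (-(ξ * L z)) :=
    Finset.single_le_sum (f := fun z => Real.exp (-(ξ * L z))) (fun _ _ => (Real.exp_pos _).le) hz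
  have h2 := Real.log_le_log (Real.exp_pos _) h1
  rw [Real.log_exp] at h2
  unfold expPotential
  rw [Real.log_div (sum_exp_pos hX _).ne' hN.ne', ← neg_div, ← sub_le_iff_le_add, ← sub_div,
    div_le_iff₀ hξ]
  linarith

/-- Monotonicity of power means. Lowering the learning rate therefore never lowers the potential. -/
theorem expPotential_anti (hX : X.Nonempty) {ξ ξ' : ℝ} (hξ' : 0 < ξ') (h : ξ' ≤ ξ) (L : ι → ℝ) :
    expPotential X ξ L ≤ expPotential X ξ' L := by
  have hN : (0 : ℝ) < X.card := by exact_mod_cast hX.card_pos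
  have hξ : 0 < ξ := hξ'.trans_le h
  have h1 := Real.rpow_arith_mean_le_arith_mean_rpow X (fun _ => 1 / (X.card : ℝ))
    (fun z => Real.exp (-(ξ' * L z))) (fun _ _ => by positivity) (by
      rw [Finset.sum_const, nsmul_eq_mul]; field_simp) (fun _ _ => (Real.exp_pos _).le)
    (p := ξ / ξ') ((one_le_div hξ').2 h)
  have h2 : ∀ z, Real.exp (-(ξ' * L z)) ^ (ξ / ξ') = Real.exp (-(ξ * L z)) := fun z => by
    rw [← Real.exp_mul]; congr 1; field_simp
  simp_rw [h2, ← Finset.mul_sum, one_div, inv_mul_eq_div] at h1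
  have hpos := fun ξ : ℝ => div_pos (sum_exp_pos hX fun z => -(ξ * L z)) hN
  have h3 := Real.log_le_log (Real.rpow_pos_of_pos (hpos ξ') _) h1
  rw [Real.log_rpow (hpos ξ')] at h3
  unfold expPotential
  rw [neg_le_neg_iff, le_div_iff₀ hξ]
  refine le_trans (le_of_eq ?_) h3
  field_simp

/-- A round raises the potential by at least half of the loss of the forecaster, again by `exp (-g)
≤ 1 - g / 2`. -/
theorem expPotential_add_le (hX : X.Nonempty) {ξ : ℝ} (hξ0 : 0 < ξ) (hξ1 : ξ ≤ 1) (L l : ι → ℝ)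
    (hl0 : ∀ z, 0 ≤ l z) (hl1 : ∀ z, l z ≤ 1) :
    expPotential X ξ L + (∑ z ∈ X, Real.exp (-(ξ * L z)) /
      (∑ z ∈ X, Real.exp (-(ξ * L z))) * l z) / 2 ≤ expPotential X ξ (fun z => L z + l z) := by
  have hN : (0 : ℝ) < X.card := by exact_mod_cast hX.card_pos
  set Z := ∑ z ∈ X, Real.exp (-(ξ * L z)) with hZ
  have hZ0 : 0 < Z := sum_exp_pos hX _
  set x := ∑ z ∈ X, Real.exp (-(ξ * L z)) / Z * l z with hx
  have h1 : ∑ z ∈ X, Real.exp (-(ξ * (L z + l z))) ≤ Z * Real.exp (-(ξ * x / 2)) := by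
    calc ∑ z ∈ X, Real.exp (-(ξ * (L z + l z)))
        ≤ ∑ z ∈ X, (Real.exp (-(ξ * L z)) - ξ / 2 * Z * (Real.exp (-(ξ * L z)) / Z * l z)) := by
          refine Finset.sum_le_sum fun z _ => ?_
          have h2 := exp_neg_le_one_sub_half (mul_nonneg hξ0.le (hl0 z))
            (mul_le_one₀ hξ1 (hl0 z) (hl1 z))
          have h3 : -(ξ * (L z + l z)) = -(ξ * L z) + -(ξ * l z) := by ring
          rw [h3, Real.exp_add]
          refine (mul_le_mul_of_nonneg_left h2 (Real.exp_pos _).le).trans (le_of_eq ?_)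
          field_simp
      _ = Z * (-(ξ * x / 2) + 1) := by
          rw [Finset.sum_sub_distrib, ← Finset.mul_sum, ← hZ, ← hx]; ring
      _ ≤ _ := by
          gcongr
          exact Real.add_one_le_exp _
  have h2 : Real.log ((∑ z ∈ X, Real.exp (-(ξ * (L z + l z)))) / X.card) ≤
      Real.log (Z / X.card) - ξ * x / 2 := by
    calc _ ≤ Real.log (Z / X.card * Real.exp (-(ξ * x / 2))) := by
          refine Real.log_le_log (div_pos (sum_exp_pos hX _) hN) ?_
          rw [div_mul_eq_mul_div]
          gcongr
      _ = _ := by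
          rw [Real.log_mul (by positivity) (Real.exp_pos _).ne', Real.log_exp]; ring
  unfold expPotential
  rw [← hZ]
  have h3 : Real.log ((∑ z ∈ X, Real.exp (-(ξ * (L z + l z)))) / X.card) / ξ ≤
      Real.log (Z / X.card) / ξ - x / 2 := by
    rw [div_le_iff₀ hξ0, sub_mul, div_mul_cancel₀ _ hξ0.ne']
    linarith
  linarith

theorem one_le_wmfRate_const : 1 ≤ √(2 * (√2 - 1) / (Real.exp 1 - 2)) := by
  rw [Real.one_le_sqrt]
  have h1 := Real.exp_one_gt_d9
  have h2 := Real.exp_one_lt_d9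
  have h3 : (1.414 : ℝ) ≤ √2 := Real.le_sqrt_of_sq_le (by norm_num)
  rw [le_div_iff₀ (by linarith)]
  linarith

theorem wmfRate_le_one (N : ℕ) (V : ℝ) : wmfRate N V ≤ 1 := by
  unfold wmfRate
  split_ifs
  · exact le_rfl
  · exact min_le_left _ _

theorem wmfRate_anti (N : ℕ) {V V' : ℝ} (hV : 0 ≤ V) (h : V ≤ V') : wmfRate N V' ≤ wmfRate N V := by
  by_cases h0 : V = 0
  · rw [show wmfRate N V = 1 by simp [wmfRate, h0]]
    exact wmfRate_le_one N V'
  · have hV0 : 0 < V := lt_of_le_of_ne hV (Ne.symm h0)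
    unfold wmfRate
    rw [if_neg h0, if_neg (hV0.trans_le h).ne']
    gcongr

/-- With one expert `log N = 0`, and the rate would vanish for `V > 0`. A single expert has no
variance, which is what the last hypothesis records. -/
theorem wmfRate_pos {N : ℕ} {V : ℝ} (hN : 1 ≤ N) (hV : 0 ≤ V) (h1 : N = 1 → V = 0) :
    0 < wmfRate N V := by
  by_cases h0 : V = 0
  · simp [wmfRate, h0]
  · have hV0 : 0 < V := lt_of_le_of_ne hV (Ne.symm h0)
    have hN2 : 1 < N := lt_of_le_of_ne hN fun h => h0 (h1 h.symm)
    have hlog : 0 < Real.log N := Real.log_pos (by exact_mod_cast hN2)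
    unfold wmfRate
    rw [if_neg h0]
    have := one_le_wmfRate_const
    exact lt_min one_pos (mul_pos (by linarith) (Real.sqrt_pos.2 (by positivity)))

/-- Only `1 ≤ κ` matters for the constant in the rate. -/
theorem log_div_wmfRate_le {N : ℕ} {V : ℝ} (hN : 1 ≤ N) (hV : 0 ≤ V) (h1 : N = 1 → V = 0) :
    Real.log N / wmfRate N V ≤ Real.log N + √(V * Real.log N) := by
  have hlog0 : 0 ≤ Real.log N := Real.log_natCast_nonneg N
  by_cases h0 : V = 0
  · simp [wmfRate, h0]
  · have hV0 : 0 < V := lt_of_le_of_ne hV (Ne.symm h0)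
    have hN2 : 1 < N := lt_of_le_of_ne hN fun h => h0 (h1 h.symm)
    have hlog : 0 < Real.log N := Real.log_pos (by exact_mod_cast hN2)
    rw [div_le_iff₀ (wmfRate_pos hN hV h1)]
    unfold wmfRate
    rw [if_neg h0]
    have hc := one_le_wmfRate_const
    set κ := √(2 * (√2 - 1) / (Real.exp 1 - 2))
    rcases min_choice 1 (κ * √(Real.log N / V)) with h | h <;> rw [h]
    · linarith [Real.sqrt_nonneg (V * Real.log N)]
    · have h2 : √(V * Real.log N) * √(Real.log N / V) = Real.log N := by
        rw [← Real.sqrt_mul (by positivity), show V * Real.log N * (Real.log N / V) =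
          Real.log N ^ 2 by field_simp, Real.sqrt_sq hlog0]
      have h3 : 0 ≤ √(Real.log N / V) := Real.sqrt_nonneg _
      calc Real.log N ≤ κ * Real.log N := le_mul_of_one_le_left hlog0 hc
        _ = √(V * Real.log N) * (κ * √(Real.log N / V)) := by rw [mul_left_comm, h2]
        _ ≤ _ := by
            gcongr
            linarith

/-- Invariant of the forecaster: `R` is the loss it suffered since the last reset. -/
structure WMFState.Invariant (X : Finset ι) (W : WMFState ι) (R : ℝ) : Prop where
  le_potential : R / 2 ≤ expPotential X (wmfRate X.card W.var) W.loss
  var_nonneg : 0 ≤ W.var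
  var_le : W.var ≤ R
  var_eq_zero : X.card = 1 → W.var = 0

theorem WMFState.invariant_reset (hX : X.Nonempty) : (WMFState.reset ι).Invariant X 0 where
  le_potential := by
    have hN : (X.card : ℝ) ≠ 0 := by exact_mod_cast hX.card_pos.ne'
    simp [WMFState.reset, expPotential, wmfRate, hN]
  var_nonneg := le_rfl
  var_le := le_rfl
  var_eq_zero _ := rfl

theorem WMFState.weights_of_mem (W : WMFState ι) {z : ι} (hz : z ∈ X) :
    W.weights X z = Real.exp (-(wmfRate X.card W.var * W.loss z)) /
      ∑ z' ∈ X, Real.exp (-(wmfRate X.card W.var * W.loss z')) := by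
  rw [WMFState.weights, if_pos hz]

theorem WMFState.weights_of_notMem (W : WMFState ι) {z : ι} (hz : z ∉ X) : W.weights X z = 0 := by
  rw [WMFState.weights, if_neg hz]

theorem WMFState.weights_nonneg (W : WMFState ι) (z : ι) : 0 ≤ W.weights X z := by
  unfold WMFState.weights
  split_ifs
  · positivity
  · exact le_rfl

theorem WMFState.sum_weights (W : WMFState ι) (hX : X.Nonempty) : ∑ z ∈ X, W.weights X z = 1 := by
  rw [Finset.sum_congr rfl fun z hz => W.weights_of_mem hz, ← Finset.sum_div,
    div_self (sum_exp_pos hX _).ne']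

/-- The potential first grows at the old rate and then passes to the smaller new one. Losses in `[0,
1]` have variance at most their mean, so `V ≤ R` persists. -/
theorem WMFState.Invariant.update (hX : X.Nonempty) {W : WMFState ι} {R : ℝ} (h : W.Invariant X R)
    {l : ι → ℝ} (hl0 : ∀ z, 0 ≤ l z) (hl1 : ∀ z, l z ≤ 1) :
    (W.update X l).Invariant X (R + ∑ z ∈ X, W.weights X z * l z) := by
  have hN : 1 ≤ X.card := hX.card_pos
  set x := ∑ z ∈ X, W.weights X z * l z with hx
  set v := ∑ z ∈ X, W.weights X z * (l z - x) ^ 2 with hv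
  have hvar : (W.update X l).var = W.var + v := rfl
  have hv0 : 0 ≤ v := Finset.sum_nonneg fun z _ => mul_nonneg (W.weights_nonneg z) (sq_nonneg _)
  have hvx : v ≤ x := by
    have h1 : v = ∑ z ∈ X, W.weights X z * l z ^ 2 - x ^ 2 := by
      have : ∀ z, W.weights X z * (l z - x) ^ 2 = W.weights X z * l z ^ 2 -
          2 * x * (W.weights X z * l z) + x ^ 2 * W.weights X z := fun z => by ring
      rw [hv]
      simp_rw [this]
      rw [Finset.sum_add_distrib, Finset.sum_sub_distrib, ← Finset.mul_sum, ← Finset.mul_sum,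
        W.sum_weights hX, ← hx]
      ring
    have h2 : ∑ z ∈ X, W.weights X z * l z ^ 2 ≤ x := Finset.sum_le_sum fun z _ =>
      mul_le_mul_of_nonneg_left (by nlinarith [hl0 z, hl1 z]) (W.weights_nonneg z)
    nlinarith [sq_nonneg x]
  have hone : X.card = 1 → v = 0 := by
    intro hc
    obtain ⟨a, rfl⟩ := Finset.card_eq_one.1 hc
    have h1 := W.sum_weights hX
    rw [Finset.sum_singleton] at h1
    rw [hv, hx]
    simp [h1]
  refine ⟨?_, ?_, ?_, fun hc => ?_⟩
  · have hpos : 0 < wmfRate X.card (W.var + v) := wmfRate_pos hN (add_nonneg h.var_nonneg hv0)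
      fun hc => by rw [h.var_eq_zero hc, hone hc, add_zero]
    have h1 := expPotential_add_le hX (wmfRate_pos hN h.var_nonneg h.var_eq_zero)
      (wmfRate_le_one X.card W.var) W.loss l hl0 hl1
    have h2 := expPotential_anti hX hpos (wmfRate_anti X.card h.var_nonneg
      (le_add_of_nonneg_right hv0)) (fun z => W.loss z + l z)
    have h3 : x = ∑ z ∈ X, Real.exp (-(wmfRate X.card W.var * W.loss z)) /
        (∑ z ∈ X, Real.exp (-(wmfRate X.card W.var * W.loss z))) * l z :=
      Finset.sum_congr rfl fun z hz => by rw [W.weights_of_mem hz]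
    rw [← h3] at h1
    have h4 := h.le_potential
    rw [hvar]
    change (R + x) / 2 ≤ expPotential X _ (fun z => W.loss z + l z)
    linarith
  · rw [hvar]; exact add_nonneg h.var_nonneg hv0
  · rw [hvar]; exact add_le_add h.var_le hvx
  · rw [hvar, h.var_eq_zero hc, hone hc, add_zero]

/-- Since `V ≤ R`, the price `log N / ξ` is at most `log N + √(R log N) ≤ R / 8 + 3 log N`. It
remains to solve `R / 2 ≤ L + R / 8 + 3 log N` for `R`. -/
theorem WMFState.Invariant.le (hX : X.Nonempty) {W : WMFState ι} {R : ℝ} (h : W.Invariant X R)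
    {z : ι} (hz : z ∈ X) : R ≤ 8 / 3 * W.loss z + 8 * Real.log X.card := by
  have hN : 1 ≤ X.card := hX.card_pos
  have hlog : 0 ≤ Real.log X.card := Real.log_natCast_nonneg _
  have h1 := expPotential_le hX (wmfRate_pos hN h.var_nonneg h.var_eq_zero) W.loss hz
  have h2 := log_div_wmfRate_le hN h.var_nonneg h.var_eq_zero
  have hR : 0 ≤ R := h.var_nonneg.trans h.var_le
  have h3 : √(W.var * Real.log X.card) ≤ R / 8 + 2 * Real.log X.card := by
    refine Real.sqrt_le_iff.2 ⟨by positivity, ?_⟩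
    have := mul_le_mul_of_nonneg_right h.var_le hlog
    nlinarith [sq_nonneg (R / 8 - 2 * Real.log X.card)]
  have := h.le_potential
  linarith

end Forecaster

/-! ### Level indices and the reward collected at each level. -/

section Levels

variable {S A : Type*} {H : ℕ} [Fintype S] [Fintype A] {c : Fin H × S × A → ℝ}
  {y : ℕ → Traj S A H} {t : ℕ}

theorem mem_target {z : Fin H × S × A} : z ∈ target c ↔ 0 < c z := by
  simp [target]

theorem one_le_cmin : 1 ≤ cmin c := le_max_right _ _

theorem level_zero : level c 0 = target c := by simp [level]

theorem mem_level_succ {k : ℕ} {z : Fin H × S × A} :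
    z ∈ level c (k + 1) ↔ cmin c * 2 ^ (k + 1) < c z := by
  simp [level]

theorem level_subset_target (k : ℕ) : level c k ⊆ target c := by
  cases k with
  | zero => rw [level_zero]
  | succ k =>
    intro z hz
    rw [mem_level_succ] at hz
    have : 0 < cmin c := one_pos.trans_le one_le_cmin
    exact mem_target.2 (lt_trans (by positivity) hz)

theorem lt_of_mem_level {k : ℕ} {z : Fin H × S × A} (hz : z ∈ level c k) (hk : k ≠ 0) :
    cmin c * 2 ^ k < c z := by
  obtain ⟨j, rfl⟩ := Nat.exists_eq_succ_of_ne_zero hk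
  exact mem_level_succ.1 hz

theorem le_cmax (z : Fin H × S × A) : c z ≤ cmax c :=
  le_ciSup (Set.finite_range c).bddAbove z

theorem cmax_pos (hc : ∃ z, 0 < c z) : 0 < cmax c := by
  obtain ⟨z, hz⟩ := hc
  exact hz.trans_le (le_cmax z)

theorem one_le_numLevels : 1 ≤ numLevels c := le_max_right _ _

theorem cmax_le_of_numLevels_le (hc : ∃ z, 0 < c z) {k : ℕ} (hk : numLevels c ≤ k) :
    cmax c ≤ cmin c * 2 ^ k := by
  have h0 : 0 < cmin c := one_pos.trans_le one_le_cmin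
  have h1 : Real.logb 2 (cmax c / cmin c) ≤ k := by
    refine (Nat.le_ceil _).trans ?_
    exact_mod_cast (le_max_left _ _).trans hk
  rw [Real.logb_le_iff_le_rpow (by norm_num) (div_pos (cmax_pos hc) h0), Real.rpow_natCast,
    div_le_iff₀ h0] at h1
  linarith

theorem lt_numLevels_of_mem_level (hc : ∃ z, 0 < c z) {k : ℕ} {z : Fin H × S × A}
    (hz : z ∈ level c k) : k < numLevels c := by
  by_contra! hk
  have h1 := lt_of_mem_level hz (by have := one_le_numLevels (c := c); omega)
  exact absurd (h1.trans_le (le_cmax z)) (not_lt.2 (cmax_le_of_numLevels_le hc hk))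

set_option linter.unusedSectionVars false in
theorem not_covered_mono {s : ℕ} (h : ¬ Covered c y t) (hst : s ≤ t) : ¬ Covered c y s :=
  fun hs => h fun z => (hs z).trans (by exact_mod_cast counts_mono y z hst)

theorem exists_mem_target_of_not_covered (h : ¬ Covered c y t) :
    ∃ z ∈ target c, (counts y t z : ℝ) < c z := by
  unfold Covered at h
  push Not at h
  obtain ⟨z, hz⟩ := h
  exact ⟨z, mem_target.2 ((Nat.cast_nonneg _).trans_lt hz), hz⟩

variable (c y) in
/-- Level indices above which all requirements are met after `t` episodes. -/
def metAbove (t : ℕ) : Set ℕ :=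
  {j : ℕ | ∀ z ∈ target c, z ∉ level c j → c z ≤ (counts y t z : ℝ)}

theorem zero_mem_metAbove : 0 ∈ metAbove c y t := fun z hz hz' => by
  rw [level_zero] at hz'
  exact absurd hz hz'

/-- An unmet triplet lies in `𝒳_j` for every `j` of this set, and `𝒳_j` is empty from `j = m` on.
After full coverage the set is all of `ℕ` and its `sSup` is the default `0`; the level index is
meaningful only before coverage. -/
theorem bddAbove_metAbove (h : ¬ Covered c y t) : BddAbove (metAbove c y t) := by
  obtain ⟨z, hz, hlt⟩ := exists_mem_target_of_not_covered h
  refine ⟨numLevels c, fun j hj => ?_⟩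
  by_contra! hlt'
  have : z ∈ level c j := by
    by_contra hz'
    exact absurd (hj z hz hz') (not_le.2 hlt)
  exact absurd (lt_numLevels_of_mem_level ⟨z, mem_target.1 hz⟩ this) (by omega)

theorem levelIdx_mem_metAbove (h : ¬ Covered c y t) : levelIdx c y t ∈ metAbove c y t := by
  cases t with
  | zero => exact zero_mem_metAbove
  | succ t => exact Nat.sSup_mem ⟨0, zero_mem_metAbove⟩ (bddAbove_metAbove h)

theorem levelIdx_mono (h : ¬ Covered c y t) {s : ℕ} (hst : s ≤ t) :
    levelIdx c y s ≤ levelIdx c y t := by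
  cases t with
  | zero => rw [Nat.le_zero.1 hst]
  | succ t =>
    refine le_csSup (bddAbove_metAbove h) fun z hz hz' => ?_
    exact (levelIdx_mem_metAbove (not_covered_mono h hst) z hz hz').trans
      (by exact_mod_cast counts_mono y z hst)

/-- Some requirement of the current level is met neither by the counts nor by the next level. -/
theorem exists_mem_level_counts_le (hc : ∃ z, 0 < c z) (h : ¬ Covered c y t) :
    ∃ z ∈ level c (levelIdx c y t), (counts y t z : ℝ) ≤ cmin c * 2 ^ (levelIdx c y t + 1) := by
  cases t with
  | zero =>
    obtain ⟨z, hz⟩ := hc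
    have : 0 < cmin c := one_pos.trans_le one_le_cmin
    refine ⟨z, by simpa [levelIdx, level_zero] using mem_target.2 hz, ?_⟩
    rw [counts_zero, Nat.cast_zero]
    positivity
  | succ t =>
    -- By maximality of the index `k`, some triplet outside `𝒳_{k+1}` is unmet; it lies in `𝒳_k`
    -- because everything outside `𝒳_k` is met.
    have hnot : levelIdx c y (t + 1) + 1 ∉ metAbove c y (t + 1) := fun hmem =>
      absurd (le_csSup (bddAbove_metAbove h) hmem) (by simp [levelIdx, metAbove])
    unfold metAbove at hnot
    simp only [Set.mem_ofPred_eq, not_forall, not_le] at hnot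
    obtain ⟨z, hz, hz', hlt⟩ := hnot
    refine ⟨z, ?_, ?_⟩
    · by_contra hz''
      exact absurd (levelIdx_mem_metAbove h z hz hz'') (not_le.2 hlt)
    · rw [mem_level_succ, not_lt] at hz'
      exact hlt.le.trans hz'

theorem levelIdx_lt_numLevels (hc : ∃ z, 0 < c z) (h : ¬ Covered c y t) :
    levelIdx c y t < numLevels c := by
  obtain ⟨z, hz, -⟩ := exists_mem_level_counts_le hc h
  exact lt_numLevels_of_mem_level hc hz

theorem levelIdx_congr {y' : ℕ → Traj S A H} (h : ∀ i < t, y i = y' i) :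
    levelIdx c y t = levelIdx c y' t := by
  cases t with
  | zero => rfl
  | succ t => simp only [levelIdx, counts_congr h]

theorem wmfState_congr {y' : ℕ → Traj S A H} (h : ∀ i < t, y i = y' i) :
    wmfState c y t = wmfState c y' t := by
  induction t with
  | zero => rfl
  | succ t ih =>
    have h' : ∀ i < t, y i = y' i := fun i hi => h i (hi.trans t.lt_succ_self)
    simp only [wmfState, levelIdx_congr h, levelIdx_congr h', ih h']
    rw [h t t.lt_succ_self]

theorem advReward_congr {y' : ℕ → Traj S A H} (h : ∀ i < t, y i = y' i) :
    advReward c y t = advReward c y' t := by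
  unfold advReward
  rw [wmfState_congr h, levelIdx_congr h]

theorem advReward_nonneg (z : Fin H × S × A) : 0 ≤ advReward c y t z :=
  WMFState.weights_nonneg _ z

theorem sum_advReward_mul (f : Fin H × S × A → ℝ) : ∑ z, advReward c y t z * f z =
    ∑ z ∈ level c (levelIdx c y t),
      (wmfState c y t).weights (level c (levelIdx c y t)) z * f z := by
  symm
  refine Finset.sum_subset (Finset.subset_univ _) fun z _ hz => ?_
  rw [WMFState.weights_of_notMem _ hz, zero_mul]

theorem sum_advReward_le_one : ∑ z, advReward c y t z ≤ 1 := by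
  have := sum_advReward_mul (c := c) (y := y) (t := t) fun _ => 1
  simp only [mul_one] at this
  rw [this]
  rcases (level c (levelIdx c y t)).eq_empty_or_nonempty with h | h
  · rw [h, Finset.sum_empty]; exact zero_le_one
  · exact (WMFState.sum_weights _ h).le

theorem advReward_le_one (z : Fin H × S × A) : advReward c y t z ≤ 1 :=
  (Finset.single_le_sum (fun z _ => advReward_nonneg z) (Finset.mem_univ z)).trans
    sum_advReward_le_one

theorem sum_stages_eq (f : Fin H × S × A → ℝ) (v : Traj S A H) [DecidableEq (S × A)] :
    ∑ h, f (h, v h) = ∑ z, f z * if v z.1 = z.2 then 1 else 0 := by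
  rw [Fintype.sum_prod_type]
  simp

theorem sum_stages_le (f : Fin H × S × A → ℝ) (hf : ∀ z, 0 ≤ f z) (v : Traj S A H) :
    ∑ h, f (h, v h) ≤ ∑ z, f z := by
  classical
  rw [sum_stages_eq]
  exact Finset.sum_le_sum fun z _ => mul_le_of_le_one_right (hf z) (by split_ifs <;> norm_num)

variable (c y) in
/-- Reward `λ` collected in episode `t + 1`. -/
noncomputable def advGain (t : ℕ) : ℝ :=
  ∑ h, advReward c y t (h, y t h)

theorem advGain_le_one : advGain c y t ≤ 1 :=
  (sum_stages_le _ (fun z => advReward_nonneg z) _).trans sum_advReward_le_one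

variable (c y) in
/-- Reward collected in the first `t` episodes while the level index was `k`. -/
noncomputable def phaseGain (t k : ℕ) : ℝ :=
  ∑ i ∈ Finset.range t, if levelIdx c y i = k then advGain c y i else 0

theorem phaseGain_succ (k : ℕ) : phaseGain c y (t + 1) k =
    phaseGain c y t k + if levelIdx c y t = k then advGain c y t else 0 :=
  Finset.sum_range_succ _ _

/-- The loss of the forecaster is the reward of the learner, so the `phaseGain` of the current level
is the loss since the last reset. -/
theorem wmfState_invariant (hc : ∃ z, 0 < c z) (h : ¬ Covered c y t) :
    (wmfState c y t).Invariant (level c (levelIdx c y t)) (phaseGain c y t (levelIdx c y t)) ∧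
      ∀ z, (wmfState c y t).loss z ≤ counts y t z := by
  classical
  induction t with
  | zero =>
    obtain ⟨z, hz, -⟩ := exists_mem_level_counts_le hc h
    refine ⟨?_, fun z => by simp [wmfState, WMFState.reset]⟩
    simpa [phaseGain, wmfState] using WMFState.invariant_reset ⟨z, hz⟩
  | succ t ih =>
    obtain ⟨z, hz, -⟩ := exists_mem_level_counts_le hc h
    have h' := not_covered_mono h t.le_succ
    obtain ⟨ih1, ih2⟩ := ih h'
    by_cases hk : levelIdx c y (t + 1) = levelIdx c y t
    · have e : wmfState c y (t + 1) = (wmfState c y t).update (level c (levelIdx c y t))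
          fun z => if y t z.1 = z.2 then 1 else 0 := by
        rw [wmfState, if_neg (not_not.2 hk)]
      rw [e, hk, phaseGain_succ, if_pos rfl]
      rw [hk] at hz
      refine ⟨?_, fun z => ?_⟩
      · have := ih1.update ⟨z, hz⟩ (l := fun z => if y t z.1 = z.2 then 1 else 0)
          (fun z => by split_ifs <;> norm_num)
          (fun z => by split_ifs <;> norm_num)
        rw [← sum_advReward_mul, ← sum_stages_eq] at this
        exact this
      · rw [counts_succ]
        push_cast
        refine add_le_add (ih2 z) (le_of_eq ?_)
        split_ifs with h1 <;> simp [h1]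
    · have e : wmfState c y (t + 1) = WMFState.reset _ := by
        rw [wmfState, if_pos hk]
      rw [e]
      refine ⟨?_, fun z => by simp [WMFState.reset]⟩
      -- Level indices do not decrease before coverage, so a level entered by a reset has never been
      -- in force.
      have : phaseGain c y (t + 1) (levelIdx c y (t + 1)) = 0 := by
        refine Finset.sum_eq_zero fun i hi => if_neg ?_
        have h1 := levelIdx_mono h' (Nat.lt_succ_iff.1 (Finset.mem_range.1 hi))
        have h2 := levelIdx_mono h t.le_succ
        omega
      rw [this]
      exact WMFState.invariant_reset ⟨z, hz⟩

/-- The regret bound is used at the last episode of the phase, against a triplet with at most `c_min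
2^(k+1)` visits. Thus `16 / 3 = 2 · 8 / 3`, and the final `1` pays for that episode. -/
theorem phaseGain_le (hc : ∃ z, 0 < c z) (h : ¬ Covered c y t) (k : ℕ) :
    phaseGain c y t k ≤ 16 / 3 * (cmin c * 2 ^ k) +
      (8 * Real.log (H * Fintype.card S * Fintype.card A) + 1) := by
  have hcm : 0 < cmin c := one_pos.trans_le one_le_cmin
  have hlog : 0 ≤ Real.log ((H : ℝ) * Fintype.card S * Fintype.card A) := by
    have := Real.log_natCast_nonneg (H * Fintype.card S * Fintype.card A)
    push_cast at this
    exact this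
  induction t with
  | zero =>
    simp only [phaseGain, Finset.range_zero, Finset.sum_empty]
    positivity
  | succ t ih =>
    have h' := not_covered_mono h t.le_succ
    rw [phaseGain_succ]
    split_ifs with hk
    · obtain ⟨z, hz, hle⟩ := exists_mem_level_counts_le hc h'
      obtain ⟨h1, h2⟩ := wmfState_invariant hc h'
      have h3 := h1.le ⟨z, hz⟩ hz
      have h4 := h2 z
      rw [hk] at h3 hle hz
      have h5 : Real.log (level c k).card ≤ Real.log (H * Fintype.card S * Fintype.card A) := by
        refine Real.log_le_log (by exact_mod_cast Finset.card_pos.2 ⟨z, hz⟩) ?_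
        have := Finset.card_le_univ (level c k)
        simp only [Fintype.card_prod, Fintype.card_fin] at this
        rw [← mul_assoc] at this
        exact_mod_cast this
      have h6 := advGain_le_one (c := c) (y := y) (t := t)
      rw [pow_succ] at hle
      linarith
    · rw [add_zero]
      exact ih h'

end Levels

/-! ### Coverage complexities and the value of the game. -/

section Complexity

variable {S A : Type*} {H : ℕ} [Fintype S] [Fintype A] (M : MDP S A H)

theorem ofReal_mul_phiStar_le {c₁ c₂ : Fin H × S × A → ℝ} {a : ℝ} (ha : 0 < a)
    (h : ∀ z, 0 < c₁ z → a * c₁ z ≤ c₂ z) :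
    ENNReal.ofReal a * M.phiStar c₁ ≤ M.phiStar c₂ := by
  refine le_iInf fun π => ?_
  calc ENNReal.ofReal a * M.phiStar c₁
      ≤ ENNReal.ofReal a * ⨆ z : Fin H × S × A, ⨆ _ : 0 < c₁ z,
          ENNReal.ofReal (c₁ z) / M.occupancy π z := by
        gcongr
        exact iInf_le _ π
    _ ≤ _ := by
        simp_rw [ENNReal.mul_iSup]
        refine iSup₂_le fun z hz => ?_
        refine le_trans ?_ (le_iSup₂ (f := fun z (_ : 0 < c₂ z) =>
          ENNReal.ofReal (c₂ z) / M.occupancy π z) z ((mul_pos ha hz).trans_le (h z hz)))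
        rw [← mul_div_assoc, ← ENNReal.ofReal_mul ha.le]
        gcongr
        exact h z hz

theorem ofReal_le_phiStar [Nonempty (Fin H)] {c : Fin H × S × A → ℝ} {z : Fin H × S × A}
    (hz : 0 < c z) : ENNReal.ofReal (c z) ≤ M.phiStar c := by
  refine le_iInf fun π => ?_
  refine le_trans ?_ (le_iSup₂ (f := fun z (_ : 0 < c z) =>
    ENNReal.ofReal (c z) / M.occupancy π z) z hz)
  rw [div_eq_mul_inv]
  exact le_mul_of_one_le_right' (ENNReal.one_le_inv.2 (occupancy_le_one z))

open Classical in
/-- Coverage complexity of the indicator function of a set of triplets. -/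
noncomputable def MDP.phiSet (X : Finset (Fin H × S × A)) : ℝ≥0∞ :=
  M.phiStar fun z => if z ∈ X then 1 else 0

theorem phiSet_target (c : Fin H × S × A → ℝ) :
    M.phiSet (target c) = M.phiStar (targetInd c) := rfl

theorem phiSet_mono {X Y : Finset (Fin H × S × A)} (h : X ⊆ Y) : M.phiSet X ≤ M.phiSet Y := by
  classical
  have := ofReal_mul_phiStar_le M (c₁ := fun z => if z ∈ X then 1 else 0)
    (c₂ := fun z => if z ∈ Y then 1 else 0) one_pos fun z hz => by
      have hX : z ∈ X := by
        by_contra hX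
        simp [hX] at hz
      simp [hX, h hX]
  rw [ENNReal.ofReal_one, one_mul] at this
  convert this <;> (unfold MDP.phiSet; congr!)

theorem ofReal_mul_phiSet_le {X : Finset (Fin H × S × A)} {c : Fin H × S × A → ℝ} {a : ℝ}
    (ha : 0 < a) (h : ∀ z ∈ X, a ≤ c z) : ENNReal.ofReal a * M.phiSet X ≤ M.phiStar c := by
  classical
  refine ofReal_mul_phiStar_le M ha fun z hz => ?_
  have hX : z ∈ X := by
    by_contra hX
    simp [hX] at hz
  simpa [hX] using h z hX

/-- `c / c_max` is at most the indicator of its support. -/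
theorem phiStar_ne_top {c : Fin H × S × A → ℝ} (hc : ∃ z, 0 < c z)
    (h : M.phiSet (target c) ≠ ⊤) : M.phiStar c ≠ ⊤ := by
  classical
  have hpos := cmax_pos hc
  have h1 := ofReal_mul_phiStar_le M (c₁ := c) (c₂ := targetInd c)
    (a := 1 / cmax c) (by positivity) fun z hz => by
      rw [targetInd, if_pos (mem_target.2 hz), one_div, inv_mul_le_iff₀ hpos, mul_one]
      exact le_cmax z
  intro htop
  rw [htop, ENNReal.mul_top (by simp [hpos]), top_le_iff] at h1
  exact h h1

/-- A game value inequality: no policy covers `X` at a rate above the value of any reward `l`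
distributed over `X`. -/
theorem one_le_phiSet_mul [Nonempty (Fin H)] {X : Finset (Fin H × S × A)} (hX : X.Nonempty)
    (htop : M.phiSet X ≠ ⊤) {l : Fin H × S × A → ℝ} (hl : ∀ z, 0 ≤ l z)
    (hl1 : ∑ z ∈ X, l z = 1) {V : ℝ}
    (hV : ∀ π, ∑ z, (M.occupancy π z).toReal * l z ≤ V) : 1 ≤ (M.phiSet X).toReal * V := by
  classical
  -- For a fixed policy, `s⁻¹` is the smallest occupancy over `X`, hence at most the average of the
  -- occupancies under `l`. Inverses in `ℝ≥0∞` include policies that miss a triplet.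
  have key : (ENNReal.ofReal V)⁻¹ ≤ M.phiSet X := by
    refine le_iInf fun π => ?_
    set s := ⨆ z : Fin H × S × A, ⨆ _ : (0 : ℝ) < if z ∈ X then 1 else 0,
      ENNReal.ofReal (if z ∈ X then 1 else 0) / M.occupancy π z with hs
    have h1 : ∀ z ∈ X, s⁻¹ ≤ M.occupancy π z := by
      intro z hz
      rw [ENNReal.inv_le_iff_inv_le]
      refine le_trans ?_ (le_iSup₂ (f := fun z (_ : (0 : ℝ) < if z ∈ X then 1 else 0) =>
        ENNReal.ofReal (if z ∈ X then 1 else 0) / M.occupancy π z) z (by simp [hz]))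
      simp [hz]
    have hocc : ∀ z, M.occupancy π z ≠ ⊤ := fun z =>
      ne_top_of_le_ne_top ENNReal.one_ne_top (occupancy_le_one z)
    have hne : s⁻¹ ≠ ⊤ := by
      obtain ⟨z, hz⟩ := hX
      exact ne_top_of_le_ne_top (hocc z) (h1 z hz)
    have h2 : s⁻¹.toReal ≤ V := by
      calc s⁻¹.toReal = ∑ z ∈ X, s⁻¹.toReal * l z := by rw [← Finset.mul_sum, hl1, mul_one]
        _ ≤ ∑ z ∈ X, (M.occupancy π z).toReal * l z := by
            refine Finset.sum_le_sum fun z hz => ?_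
            exact mul_le_mul_of_nonneg_right (ENNReal.toReal_mono (hocc z) (h1 z hz)) (hl z)
        _ ≤ ∑ z, (M.occupancy π z).toReal * l z :=
            Finset.sum_le_sum_of_subset_of_nonneg (Finset.subset_univ _)
              fun z _ _ => mul_nonneg ENNReal.toReal_nonneg (hl z)
        _ ≤ V := hV π
    have h3 : (ENNReal.ofReal V)⁻¹ ≤ s := by
      rw [ENNReal.inv_le_iff_inv_le, ← ENNReal.ofReal_toReal hne]
      exact ENNReal.ofReal_le_ofReal h2
    convert h3
  have hV0 : 0 < V := by
    by_contra! hV0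
    rw [ENNReal.ofReal_of_nonpos hV0, ENNReal.inv_zero, top_le_iff] at key
    exact htop key
  rw [← ENNReal.ofReal_inv_of_pos hV0] at key
  have := ENNReal.toReal_mono htop key
  rw [ENNReal.toReal_ofReal (by positivity)] at this
  rwa [inv_le_iff_one_le_mul₀ hV0] at this

end Complexity

/-! ### Solving the self-bounding inequality. -/

section Arithmetic

/-- From `log (1 + y) ≤ 4 (1 + y)^(1/4)`, the square is at most `16 √(1 + y)`; AM-GM concludes. -/
theorem log_one_add_sq_le {ε y : ℝ} (hε : 0 < ε) (hy : 0 ≤ y) :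
    Real.log (1 + y) ^ 2 ≤ ε / 2 * (1 + y) + 128 / ε := by
  set s := √(1 + y) with hs
  have hs2 : s ^ 2 = 1 + y := Real.sq_sqrt (by linarith)
  have hs0 : 0 < s := Real.sqrt_pos.2 (by linarith)
  set q := √s with hq
  have hq2 : q ^ 2 = s := Real.sq_sqrt hs0.le
  have hq0 : 0 < q := Real.sqrt_pos.2 hs0
  have h1 : Real.log (1 + y) = 4 * Real.log q := by
    rw [← hs2, ← hq2, Real.log_pow, Real.log_pow]; push_cast; ring
  have h2 : Real.log (1 + y) ≤ 4 * q := by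
    rw [h1]
    linarith [Real.log_le_sub_one_of_pos hq0]
  have h3 : 0 ≤ Real.log (1 + y) := Real.log_nonneg (by linarith)
  have h4 : Real.log (1 + y) ^ 2 ≤ 16 * s := by nlinarith
  refine h4.trans ?_
  rw [← hs2]
  have h5 : ε / 2 * s ^ 2 + 128 / ε - 16 * s = (ε * s - 16) ^ 2 / (2 * ε) := by
    field_simp; ring
  have h6 : 0 ≤ (ε * s - 16) ^ 2 / (2 * ε) := by positivity
  linarith

theorem one_le_log_of_three_le {x : ℝ} (hx : 3 ≤ x) : 1 ≤ Real.log x := by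
  rw [Real.le_log_iff_exp_le (by linarith)]
  linarith [Real.exp_one_lt_d9]

theorem mul_log_sq_le {ε b x : ℝ} (hε : 0 < ε) (hb : 1 ≤ b) (hx : 0 ≤ x) :
    b * Real.log (2 + x) ^ 2 ≤ ε * x + (2 + ε + 256 / ε) * (b * Real.log (2 + b) ^ 2) := by
  set y := x / b with hy
  have hy0 : 0 ≤ y := by positivity
  have hxy : x = b * y := by rw [hy]; field_simp
  have h1 : Real.log (2 + x) ≤ Real.log (2 + b) + Real.log (1 + y) := by
    rw [← Real.log_mul (by positivity) (by positivity)]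
    refine Real.log_le_log (by linarith) ?_
    rw [hxy]
    nlinarith
  have h0 : 0 ≤ Real.log (2 + x) := Real.log_nonneg (by linarith)
  have h2 : Real.log (2 + x) ^ 2 ≤ 2 * Real.log (2 + b) ^ 2 + 2 * Real.log (1 + y) ^ 2 := by
    have := pow_le_pow_left₀ h0 h1 2
    nlinarith [sq_nonneg (Real.log (2 + b) - Real.log (1 + y))]
  have h3 := log_one_add_sq_le hε hy0
  have h4 : 1 ≤ Real.log (2 + b) ^ 2 := one_le_pow₀ (one_le_log_of_three_le (by linarith))
  have h5 : 0 < 256 / ε := by positivity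
  calc b * Real.log (2 + x) ^ 2
      ≤ b * (2 * Real.log (2 + b) ^ 2 + 2 * (ε / 2 * (1 + y) + 128 / ε)) := by
        gcongr
        linarith
    _ = ε * x + 2 * (b * Real.log (2 + b) ^ 2) + (ε + 256 / ε) * (b * 1) := by rw [hxy]; ring
    _ ≤ ε * x + 2 * (b * Real.log (2 + b) ^ 2) +
          (ε + 256 / ε) * (b * Real.log (2 + b) ^ 2) := by gcongr
    _ = _ := by ring

/-- Solving the self-bounding inequality of the stopping time. -/
theorem le_of_self_bounding {T m Φ b : ℝ} (hT : 0 ≤ T) (hm : 1 ≤ m) (hΦ : 0 ≤ Φ)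
    (hmΦ : m ≤ 2 + Φ) (hb : 1 ≤ b)
    (h : T ≤ 64 / 3 * (m * Φ) + 4000 * (m * b) * (1 + Real.log (2 + T) ^ 2)) :
    T ≤ 32 * (m * Φ) + 10 ^ 12 * (m * b * Real.log (2 + b) ^ 2) := by
  have hm0 : 0 < m := by linarith
  -- Dividing by `m` keeps the remainder linear in `m`. Inside the logarithm, `m ≤ 2 + Φ` gives `2 +
  -- T ≤ (2 + Φ) (2 + U)`.
  set U := T / m with hU
  have hU0 : 0 ≤ U := by positivity
  have hTU : T = m * U := by rw [hU]; field_simp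
  have h1 : Real.log (2 + T) ≤ Real.log (2 + Φ) + Real.log (2 + U) := by
    rw [← Real.log_mul (by positivity) (by positivity)]
    refine Real.log_le_log (by linarith) ?_
    rw [hTU]
    nlinarith
  have h0 : 0 ≤ Real.log (2 + T) := Real.log_nonneg (by linarith)
  have h2 : Real.log (2 + T) ^ 2 ≤ 2 * Real.log (2 + Φ) ^ 2 + 2 * Real.log (2 + U) ^ 2 := by
    have := pow_le_pow_left₀ h0 h1 2
    nlinarith [sq_nonneg (Real.log (2 + Φ) - Real.log (2 + U))]
  have h3 : U ≤ 64 / 3 * Φ + 4000 * b * (1 + Real.log (2 + T) ^ 2) := by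
    rw [hU, div_le_iff₀ hm0]
    linarith
  have h4 : 1 ≤ Real.log (2 + b) ^ 2 := one_le_pow₀ (one_le_log_of_three_le (by linarith))
  -- As `8000 / 32000 = 1 / 4`, the logarithms cost `Φ / 4` and `U / 4`, and `(64/3 + 1/4) / (3/4) ≤
  -- 32`. The logarithm of `φ*(c)` thus disappears into the leading term.
  have h5 := mul_log_sq_le (ε := 1 / 32000) (by norm_num) hb hU0
  have h6 := mul_log_sq_le (ε := 1 / 32000) (by norm_num) hb hΦ
  set B := b * Real.log (2 + b) ^ 2 with hB
  have h7 : b ≤ B := le_mul_of_one_le_right (by linarith) h4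
  have h8 : b * Real.log (2 + T) ^ 2 ≤
      2 * (b * Real.log (2 + Φ) ^ 2) + 2 * (b * Real.log (2 + U) ^ 2) := by
    have := mul_le_mul_of_nonneg_left h2 (by linarith : 0 ≤ b)
    linarith
  norm_num at h5 h6
  have h9 : U ≤ 32 * Φ + 10 ^ 12 * B := by
    norm_num
    linarith
  rw [hTU, mul_assoc m b, ← hB]
  calc m * U ≤ m * (32 * Φ + 10 ^ 12 * B) := by gcongr
    _ = _ := by ring

theorem log_four_le_two : Real.log 4 ≤ 2 := by
  rw [show (4 : ℝ) = 2 ^ 2 by norm_num, Real.log_pow]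
  push_cast
  linarith [Real.log_two_lt_d9]

/-- From the recursive bound on the number of episodes to the explicit one. Here `s`, `a`, `H` are
the sizes of the problem, `f` and `Φ` the coverage complexities and `L = log (1 / δ)`. -/
theorem episodes_le {T m Φ s a H f L β ν : ℝ} (hT : 0 ≤ T) (hm : 1 ≤ m) (hΦ : 0 ≤ Φ)
    (hmΦ : m ≤ 2 + Φ) (hs : 1 ≤ s) (ha : 1 ≤ a) (hH : 1 ≤ H) (hf : 1 ≤ f) (hL : 0 ≤ L)
    (hβ : β = 2 * Real.log 2 + Real.log s + Real.log a + Real.log H + L +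
      s * (3 * Real.log 2 + 1 + Real.log (T + 1)))
    (hν : ν = Real.log H + Real.log s + Real.log a)
    (h : T ≤ 4 * (m * (16 / 3 * (Φ + f) + f * (8 * ν + 1)) +
      f * (H * s * a * (1 + 48 * H * β * (1 + Real.log (T + 1)))) +
      f * ((H + 1) * (2 * Real.log 2 + L)))) :
    T + 1 ≤ 64 * (m * Φ) + m * f *
      (10 ^ 14 * Real.log (2 + s + a + H + f + L) ^ 3 * (s * a * H ^ 2 * (L + s))) := by
  set G := Real.log (2 + s + a + H + f + L) with hG
  have hG1 : 1 ≤ G := one_le_log_of_three_le (by linarith)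
  have hlog : ∀ x, 1 ≤ x → x ≤ 2 + s + a + H + f + L → Real.log x ≤ G := fun x hx hx' =>
    Real.log_le_log (by linarith) hx'
  have hsG := hlog s hs (by linarith)
  have haG := hlog a ha (by linarith)
  have hHG := hlog H hH (by linarith)
  have hfG := hlog f hf (by linarith)
  set D := L + s with hD
  have hD1 : 1 ≤ D := by linarith
  have hDG := hlog D hD1 (by linarith)
  set Q := s * a * H ^ 2 * D with hQ
  set ℓ := Real.log (2 + T) with hℓ
  have hℓ0 : 0 ≤ ℓ := Real.log_nonneg (by linarith)
  have hℓ1 : Real.log (T + 1) ≤ ℓ := Real.log_le_log (by linarith) (by linarith)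
  have hℓ2 : 0 ≤ Real.log (T + 1) := Real.log_nonneg (by linarith)
  have hl2 := Real.log_two_lt_d9
  have hl20 : 0 < Real.log 2 := Real.log_pos (by norm_num)
  have hQH : H * D ≤ Q := by
    have : 1 ≤ s * a * H :=
      one_le_mul_of_one_le_of_one_le (one_le_mul_of_one_le_of_one_le hs ha) hH
    calc H * D ≤ (s * a * H) * (H * D) := le_mul_of_one_le_left (by positivity) this
      _ = Q := by rw [hQ]; ring
  have hQ1 : 1 ≤ Q := (one_le_mul_of_one_le_of_one_le hH hD1).trans hQH
  set b := f * Q * G with hb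
  have hfb : f ≤ b := by
    rw [hb, mul_assoc]
    exact le_mul_of_one_le_right (by linarith) (one_le_mul_of_one_le_of_one_le hQ1 hG1)
  have hb1 : 1 ≤ b := hf.trans hfb
  have hfGb : f * G ≤ b := by
    rw [hb, mul_right_comm]
    exact le_mul_of_one_le_right (by positivity) hQ1
  have hβD : β ≤ D * G * (10 + ℓ) := by
    have h1 : G ≤ D * G := le_mul_of_one_le_left (by linarith) hD1
    have h2 : D ≤ D * G := le_mul_of_one_le_right (by linarith) hG1
    have h3 : s * (3 * Real.log 2 + 1 + Real.log (T + 1)) ≤ D * G * (4 + ℓ) := by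
      gcongr
      · linarith
      · linarith
    rw [hβ]
    linarith
  have hβ0 : 0 ≤ β := by
    have := Real.log_nonneg hs
    have := Real.log_nonneg ha
    have := Real.log_nonneg hH
    rw [hβ]
    positivity
  have t1 : f * (8 * ν + 1) ≤ 25 * b := by
    calc f * (8 * ν + 1) ≤ f * (25 * G) := by
          gcongr
          rw [hν]
          linarith
      _ ≤ 25 * b := by linarith
  have t2 : f * (H * s * a * (1 + 48 * H * β * (1 + Real.log (T + 1)))) ≤
      800 * b * (1 + ℓ ^ 2) := by
    have h1 : H * s * a * (1 + 48 * H * β * (1 + Real.log (T + 1))) ≤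
        H * s * a * (H * D * G * (800 * (1 + ℓ ^ 2))) := by
      gcongr
      have h2 : 1 ≤ H * D * G :=
        one_le_mul_of_one_le_of_one_le (one_le_mul_of_one_le_of_one_le hH hD1) hG1
      have h3 : 48 * H * β * (1 + Real.log (T + 1)) ≤
          48 * H * (D * G * (10 + ℓ)) * (1 + ℓ) := by gcongr
      have h4 : 48 * H * (D * G * (10 + ℓ)) * (1 + ℓ) =
          H * D * G * (48 * (10 + 11 * ℓ + ℓ ^ 2)) := by ring
      have h5 : 1 + 48 * (10 + 11 * ℓ + ℓ ^ 2) ≤ 800 * (1 + ℓ ^ 2) := by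
        nlinarith [sq_nonneg (ℓ - 1)]
      have h6 : H * D * G * (1 + 48 * (10 + 11 * ℓ + ℓ ^ 2)) ≤
          H * D * G * (800 * (1 + ℓ ^ 2)) := by gcongr
      linarith
    calc _ ≤ f * (H * s * a * (H * D * G * (800 * (1 + ℓ ^ 2)))) := by gcongr
      _ = 800 * b * (1 + ℓ ^ 2) := by rw [hb, hQ]; ring
  have t3 : f * ((H + 1) * (2 * Real.log 2 + L)) ≤ 6 * b := by
    have h1 : (H + 1) * (2 * Real.log 2 + L) ≤ (2 * H) * (3 * D) := by
      gcongr <;> linarith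
    have h2 : Q ≤ Q * G := le_mul_of_one_le_right (by linarith) hG1
    calc _ ≤ f * (6 * (Q * G)) := mul_le_mul_of_nonneg_left (by linarith) (by linarith)
      _ = 6 * b := by rw [hb]; ring
  have hmb : b ≤ m * b := le_mul_of_one_le_left (by linarith) hm
  have hmb1 : m * b ≤ m * b * (1 + ℓ ^ 2) :=
    le_mul_of_one_le_right (by positivity) (by linarith [sq_nonneg ℓ])
  have hmb2 : b * (1 + ℓ ^ 2) ≤ m * b * (1 + ℓ ^ 2) :=
    mul_le_mul_of_nonneg_right hmb (by positivity)
  have t4 : m * (16 / 3 * (Φ + f) + f * (8 * ν + 1)) ≤ 16 / 3 * (m * Φ) + 31 * (m * b) := by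
    have : 16 / 3 * (Φ + f) + f * (8 * ν + 1) ≤ 16 / 3 * Φ + 31 * b := by linarith
    calc _ ≤ m * (16 / 3 * Φ + 31 * b) := by gcongr
      _ = _ := by ring
  have key := le_of_self_bounding hT hm hΦ hmΦ hb1 (by
    rw [← hℓ]
    linarith)
  have hlogb : Real.log (2 + b) ≤ 9 * G := by
    have hG0 : 0 < G := by linarith
    have h1 : Real.log (2 + b) ≤ Real.log (3 * b) := Real.log_le_log (by linarith) (by linarith)
    have h2 : Real.log (3 * b) = Real.log 3 + (Real.log f + (Real.log s + Real.log a +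
        2 * Real.log H + Real.log D) + Real.log G) := by
      rw [hb, hQ, Real.log_mul (by norm_num) (by positivity), Real.log_mul (by positivity) hG0.ne',
        Real.log_mul (by positivity) (by positivity), Real.log_mul (by positivity) (by positivity),
        Real.log_mul (by positivity) (by positivity), Real.log_mul (by positivity) (by positivity),
        Real.log_pow]
      push_cast
      ring
    have h3 : Real.log 3 ≤ 2 := (Real.log_le_log (by norm_num) (by norm_num)).trans log_four_le_two
    have h4 := Real.log_le_sub_one_of_pos hG0
    linarith
  have hlogb0 : 0 ≤ Real.log (2 + b) := Real.log_nonneg (by linarith)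
  have t5 : m * b * Real.log (2 + b) ^ 2 ≤ 81 * (m * f * (G ^ 3 * Q)) := by
    calc _ ≤ m * b * (9 * G) ^ 2 := by gcongr
      _ = _ := by rw [hb]; ring
  -- The extra episode in `T + 1` is charged to the lower-order term: `81 · 10^12 + 1 ≤ 10^14`.
  have t6 : 1 ≤ m * f * (G ^ 3 * Q) :=
    one_le_mul_of_one_le_of_one_le (one_le_mul_of_one_le_of_one_le hm hf)
      (one_le_mul_of_one_le_of_one_le (one_le_pow₀ hG1) hQ1)
  have t7 : 0 ≤ m * Φ := by positivity
  have t8 : m * f * (10 ^ 14 * G ^ 3 * Q) = 10 ^ 14 * (m * f * (G ^ 3 * Q)) := by ring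
  rw [t8]
  norm_num at key ⊢
  linarith

end Arithmetic

/-! ### The number of episodes on the good event. -/

section Episodes

variable {S A : Type*} {H : ℕ} [Fintype S] [Fintype A] {M : MDP S A H}
  {c : Fin H × S × A → ℝ} {y : ℕ → Traj S A H} {δ : ℝ}

theorem ucbBeta_mono {n n' : ℕ} (h : n ≤ n') : ucbBeta S A H δ n ≤ ucbBeta S A H δ n' := by
  unfold ucbBeta
  gcongr

theorem sum_width_le [Nonempty S] [Nonempty A] (hH : 0 < H) (hδ : 0 < δ) (hδ1 : δ ≤ 1)
    {n T : ℕ} (hn : n ≤ T) :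
    ∑ j ∈ Finset.range n, width S A H δ j ≤
      1 + 48 * H * ucbBeta S A H δ T * (1 + Real.log (T + 1)) := by
  have hβ := (ucbBeta_pos (S := S) (A := A) hH hδ hδ1 T).le
  have hlog : 0 ≤ Real.log ((T : ℝ) + 1) :=
    Real.log_nonneg (by linarith [(Nat.cast_nonneg T : (0 : ℝ) ≤ T)])
  cases n with
  | zero =>
    rw [Finset.range_zero, Finset.sum_empty]
    positivity
  | succ n =>
    rw [Finset.sum_range_succ']
    have h1 : ∑ j ∈ Finset.range n, width S A H δ (j + 1) ≤
        48 * H * ucbBeta S A H δ T * ∑ j ∈ Finset.range n, ((j : ℝ) + 1)⁻¹ := by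
      rw [Finset.mul_sum]
      refine Finset.sum_le_sum fun j hj => ?_
      unfold width
      rw [if_neg j.succ_ne_zero]
      refine (min_le_right _ _).trans ?_
      rw [div_eq_mul_inv]
      push_cast
      gcongr
      exact ucbBeta_mono (by have := Finset.mem_range.1 hj; omega)
    have h2 : ∑ j ∈ Finset.range n, ((j : ℝ) + 1)⁻¹ ≤ 1 + Real.log (T + 1) := by
      have h3 := harmonic_le_one_add_log n
      rw [harmonic] at h3
      push_cast at h3
      refine h3.trans ?_
      rcases Nat.eq_zero_or_pos n with rfl | hn0
      · simpa using hlog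
      · gcongr
        have : (n : ℝ) + 1 ≤ T := by exact_mod_cast hn
        linarith
    have h4 : width S A H δ 0 ≤ 1 := width_le_one 0
    have h5 : 48 * H * ucbBeta S A H δ T * ∑ j ∈ Finset.range n, ((j : ℝ) + 1)⁻¹ ≤
        48 * H * ucbBeta S A H δ T * (1 + Real.log (T + 1)) := by gcongr
    linarith

set_option linter.unusedSectionVars false in
open Classical in
-- Each visit to `z` raises its count by one, so the widths met at `z` are those of `0, 1, 2, …`
-- without repetition.
theorem sum_width_counts (z : Fin H × S × A) (T : ℕ) (w : ℕ → ℝ) :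
    ∑ t ∈ Finset.range T, (w (counts y t z) * if y t z.1 = z.2 then 1 else 0) =
      ∑ j ∈ Finset.range (counts y T z), w j := by
  induction T with
  | zero => simp [counts_zero]
  | succ T ih =>
    rw [Finset.sum_range_succ, ih, counts_succ]
    split_ifs
    · rw [Finset.sum_range_succ, mul_one]
    · simp

theorem sum_width_traj_le [Nonempty S] [Nonempty A] (hH : 0 < H) (hδ : 0 < δ) (hδ1 : δ ≤ 1)
    (T : ℕ) :
    ∑ t ∈ Finset.range T, ∑ h, width S A H δ (counts y t (h, y t h)) ≤
      H * Fintype.card S * Fintype.card A *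
        (1 + 48 * H * ucbBeta S A H δ T * (1 + Real.log (T + 1))) := by
  classical
  have h1 : ∀ t, ∑ h, width S A H δ (counts y t (h, y t h)) =
      ∑ z, width S A H δ (counts y t z) * if y t z.1 = z.2 then 1 else 0 := fun t =>
    sum_stages_eq (fun z => width S A H δ (counts y t z)) (y t)
  simp_rw [h1]
  rw [Finset.sum_comm]
  calc _ ≤ ∑ _z : Fin H × S × A,
        (1 + 48 * H * ucbBeta S A H δ T * (1 + Real.log (T + 1))) := by
        refine Finset.sum_le_sum fun z _ => ?_
        refine le_trans (le_of_eq ?_) (sum_width_le hH hδ hδ1 (counts_le y T z))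
        rw [← sum_width_counts]
    _ = _ := by
        rw [Finset.sum_const, nsmul_eq_mul, Finset.card_univ]
        simp only [Fintype.card_prod, Fintype.card_fin]
        push_cast
        ring

variable (M c δ) in
/-- Normalised gain of an episode with trajectory `v`, weighted by the complexity of the level. -/
noncomputable def weightedGain (t : ℕ) (y : ℕ → Traj S A H) (v : Traj S A H) : ℝ :=
  (M.phiSet (level c (levelIdx c y t))).toReal / (M.phiSet (target c)).toReal *
    ((∑ h, (advReward c y t (h, v h) + width S A H δ (counts y t (h, v h)))) / (H + 1))

theorem weightedGain_congr {t : ℕ} {y' : ℕ → Traj S A H} (h : ∀ i < t, y i = y' i) :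
    weightedGain M c δ t y = weightedGain M c δ t y' := by
  unfold weightedGain
  rw [levelIdx_congr h, advReward_congr h, counts_congr h]

theorem phiSet_level_le (htop : M.phiSet (target c) ≠ ⊤) (k : ℕ) :
    (M.phiSet (level c k)).toReal ≤ (M.phiSet (target c)).toReal :=
  ENNReal.toReal_mono htop (phiSet_mono M (level_subset_target k))

theorem weightedGain_nonneg [Nonempty S] [Nonempty A] (hH : 0 < H) (hδ : 0 < δ) (hδ1 : δ ≤ 1)
    (t : ℕ) (v : Traj S A H) : 0 ≤ weightedGain M c δ t y v := by
  have : 0 ≤ ∑ h, (advReward c y t (h, v h) + width S A H δ (counts y t (h, v h))) :=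
    Finset.sum_nonneg fun h _ => add_nonneg (advReward_nonneg _) (width_nonneg hH hδ hδ1 _)
  unfold weightedGain
  positivity

/-- The weights `λ` have mass at most one and the `H` widths are at most one each, whence the
normalisation by `H + 1`. -/
theorem weightedGain_le_one [Nonempty S] [Nonempty A] (hH : 0 < H) (hδ : 0 < δ) (hδ1 : δ ≤ 1)
    (htop : M.phiSet (target c) ≠ ⊤) (t : ℕ) (v : Traj S A H) :
    weightedGain M c δ t y v ≤ 1 := by
  have h1 : ∑ h, (advReward c y t (h, v h) + width S A H δ (counts y t (h, v h))) ≤ H + 1 := by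
    rw [Finset.sum_add_distrib, add_comm]
    refine add_le_add ?_ ((sum_stages_le _ (fun z => advReward_nonneg z) v).trans
      sum_advReward_le_one)
    calc _ ≤ ∑ _h : Fin H, (1 : ℝ) := Finset.sum_le_sum fun h _ => width_le_one _
      _ = H := by simp
  unfold weightedGain
  refine mul_le_one₀ (div_le_one_of_le₀ (phiSet_level_le htop _) ENNReal.toReal_nonneg) ?_
    (div_le_one_of_le₀ h1 (by positivity))
  have : 0 ≤ ∑ h, (advReward c y t (h, v h) + width S A H δ (counts y t (h, v h))) :=
    Finset.sum_nonneg fun h _ => add_nonneg (advReward_nonneg _) (width_nonneg hH hδ hδ1 _)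
  positivity

/-- For `k ≥ 1`, `c > c_min 2^k` on `𝒳_k`. For `k = 0`, either `c_min` is the minimum of `c` on `𝒳`,
or `c_min = 1` and the product is `φ*(𝟙_𝒳)` itself; this case needs the second term. -/
theorem phiSet_level_mul_le (hc : ∃ z, 0 < c z) (htop : M.phiSet (target c) ≠ ⊤) (k : ℕ) :
    (M.phiSet (level c k)).toReal * (cmin c * 2 ^ k) ≤
      (M.phiStar c).toReal + (M.phiSet (target c)).toReal := by
  have hcm : 0 < cmin c := one_pos.trans_le one_le_cmin
  have hstar := phiStar_ne_top M hc htop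
  have h0 : 0 ≤ (M.phiSet (target c)).toReal := ENNReal.toReal_nonneg
  have aux : ∀ {X : Finset (Fin H × S × A)} {a : ℝ}, 0 < a → (∀ z ∈ X, a ≤ c z) →
      (M.phiSet X).toReal * a ≤ (M.phiStar c).toReal := by
    intro X a ha h
    have := ENNReal.toReal_mono hstar (ofReal_mul_phiSet_le M ha h)
    rwa [ENNReal.toReal_mul, ENNReal.toReal_ofReal ha.le, mul_comm] at this
  by_cases hk : k = 0
  · subst hk
    rw [level_zero, pow_zero, mul_one]
    rcases max_choice (⨅ z : target c, c z) 1 with h | h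
    · have h1 := aux (X := target c) (a := cmin c) hcm fun z hz => by
        rw [cmin, h]
        exact ciInf_le (Set.finite_range _).bddBelow (⟨z, hz⟩ : target c)
      linarith
    · rw [cmin, h, mul_one]
      linarith [ENNReal.toReal_nonneg (a := M.phiStar c)]
  · have := aux (X := level c k) (a := cmin c * 2 ^ k) (by positivity)
      fun z hz => (lt_of_mem_level hz hk).le
    linarith

theorem sum_phiSet_mul_advGain_le (hc : ∃ z, 0 < c z) (htop : M.phiSet (target c) ≠ ⊤) {T : ℕ}
    (hT : ¬ Covered c y T) :
    ∑ t ∈ Finset.range T, (M.phiSet (level c (levelIdx c y t))).toReal * advGain c y t ≤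
      numLevels c * (16 / 3 * ((M.phiStar c).toReal + (M.phiSet (target c)).toReal) +
        (M.phiSet (target c)).toReal *
          (8 * Real.log (H * Fintype.card S * Fintype.card A) + 1)) := by
  have h1 : ∀ t ∈ Finset.range T,
      (M.phiSet (level c (levelIdx c y t))).toReal * advGain c y t =
      ∑ k ∈ Finset.range (numLevels c), (M.phiSet (level c k)).toReal *
        if levelIdx c y t = k then advGain c y t else 0 := by
    intro t ht
    have hk := levelIdx_lt_numLevels hc
      (not_covered_mono hT (Finset.mem_range.1 ht).le)
    rw [Finset.sum_eq_single (levelIdx c y t) (fun k _ hk => by rw [if_neg hk.symm, mul_zero])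
      (fun hn => absurd (Finset.mem_range.2 hk) hn), if_pos rfl]
  rw [Finset.sum_congr rfl h1, Finset.sum_comm]
  simp_rw [← Finset.mul_sum]
  have hlog : 0 ≤ Real.log ((H : ℝ) * Fintype.card S * Fintype.card A) := by
    have := Real.log_natCast_nonneg (H * Fintype.card S * Fintype.card A)
    push_cast at this
    exact this
  calc _ ≤ ∑ _k ∈ Finset.range (numLevels c),
        (16 / 3 * ((M.phiStar c).toReal + (M.phiSet (target c)).toReal) +
        (M.phiSet (target c)).toReal *
          (8 * Real.log (H * Fintype.card S * Fintype.card A) + 1)) := by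
        refine Finset.sum_le_sum fun k _ => ?_
        have h2 := phaseGain_le hc hT k
        have h3 := mul_le_mul_of_nonneg_left h2
          (ENNReal.toReal_nonneg (a := M.phiSet (level c k)))
        have h4 := phiSet_level_mul_le hc htop k
        have h5 : (M.phiSet (level c k)).toReal *
            (8 * Real.log (H * Fintype.card S * Fintype.card A) + 1) ≤
            (M.phiSet (target c)).toReal *
              (8 * Real.log (H * Fintype.card S * Fintype.card A) + 1) :=
          mul_le_mul_of_nonneg_right (phiSet_level_le htop k) (by positivity)
        refine h3.trans ?_
        linarith
    _ = _ := by rw [Finset.sum_const, Finset.card_range, nsmul_eq_mul]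

/-- Recursive bound on the number of episodes before the stopping time. -/
theorem episodes_le_of_good [Nonempty A] (hc : ∃ z, 0 < c z) (hδ : 0 < δ) (hδ1 : δ ≤ 1)
    (htop : M.phiSet (target c) ≠ ⊤) (hy : TypicalRun M δ y) {T : ℕ}
    (hT : ¬ Covered c y T) {q : ℕ → DetPolicy S A H} {ε : ℝ}
    (hq : ∀ t < T, IsGreedy (ucbQ δ y t (advReward c y t)) (q t))
    (hch : (∑ t ∈ Finset.range T, M.expect (q t).toStoch (weightedGain M c δ t y)) / 2 ≤
      ∑ t ∈ Finset.range T, weightedGain M c δ t y (y t) + Real.log (1 / ε)) :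
    (T : ℝ) ≤ 4 * (numLevels c * (16 / 3 * ((M.phiStar c).toReal +
        (M.phiSet (target c)).toReal) + (M.phiSet (target c)).toReal *
          (8 * Real.log (H * Fintype.card S * Fintype.card A) + 1)) +
      (M.phiSet (target c)).toReal * (H * Fintype.card S * Fintype.card A *
        (1 + 48 * H * ucbBeta S A H δ T * (1 + Real.log (T + 1)))) +
      (M.phiSet (target c)).toReal * ((H + 1) * Real.log (1 / ε))) := by
  have : Nonempty S := ⟨M.init⟩
  obtain ⟨z₀, hz₀⟩ := hc
  have hH : 0 < H := Fin.pos z₀.1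
  have : Nonempty (Fin H) := ⟨z₀.1⟩
  let h0 : Fin H := ⟨0, hH⟩
  set f := (M.phiSet (target c)).toReal with hf
  have hf0 : 0 < f := by
    refine ENNReal.toReal_pos (fun h => ?_) htop
    have h1 := ofReal_le_phiStar M (c := targetInd c) (z := z₀)
      (by rw [targetInd, if_pos (mem_target.2 hz₀)]; exact one_pos)
    rw [← phiSet_target, h, targetInd, if_pos (mem_target.2 hz₀)] at h1
    simp at h1
  have hgain : ∀ t v, weightedGain M c δ t y v = 1 / (f * (H + 1)) *
      ((M.phiSet (level c (levelIdx c y t))).toReal *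
        ∑ h, (advReward c y t (h, v h) + width S A H δ (counts y t (h, v h)))) := by
    intro t v
    rw [weightedGain, ← hf]
    field_simp
  -- Game value, optimism and accuracy chain to `1 ≤ φ_k ucbV ≤ 2 φ_k E[gain + widths]`.
  have h1 : ∀ t ∈ Finset.range T,
      1 ≤ 2 * (f * (H + 1)) * M.expect (q t).toStoch (weightedGain M c δ t y) := by
    intro t ht
    have htT := Finset.mem_range.1 ht
    have hcov := not_covered_mono hT htT.le
    obtain ⟨z, hz, -⟩ := exists_mem_level_counts_le ⟨z₀, hz₀⟩ hcov
    have hltop : M.phiSet (level c (levelIdx c y t)) ≠ ⊤ :=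
      ne_top_of_le_ne_top htop (phiSet_mono M (level_subset_target _))
    have h2 := one_le_phiSet_mul M ⟨z, hz⟩ hltop (l := advReward c y t)
      (fun z => advReward_nonneg z) (WMFState.sum_weights _ ⟨z, hz⟩)
      (V := ucbV δ y t (advReward c y t) h0 M.init)
      (fun π => sum_occupancy_mul_le_ucbV hδ hδ1 hy (fun z => advReward_nonneg z)
        sum_advReward_le_one π h0 rfl)
    have h3 := ucbV_le_two_mul_expect hδ hδ1 hy (fun z => advReward_nonneg (c := c) (y := y) z)
      (fun z => advReward_le_one z) (hq t htT) h0 rfl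
    have h4 : M.expect (q t).toStoch (weightedGain M c δ t y) = 1 / (f * (H + 1)) *
        ((M.phiSet (level c (levelIdx c y t))).toReal * M.expect (q t).toStoch (fun v =>
          ∑ h, (advReward c y t (h, v h) + width S A H δ (counts y t (h, v h))))) := by
      rw [← expect_mul_left, ← expect_mul_left]
      exact expect_congr M _ fun v _ => hgain t v
    rw [h4]
    have h5 := mul_le_mul_of_nonneg_left h3
      (ENNReal.toReal_nonneg (a := M.phiSet (level c (levelIdx c y t))))
    refine (h2.trans h5).trans (le_of_eq ?_)
    field_simp
  have h2 : (T : ℝ) ≤ 2 * (f * (H + 1)) *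
      ∑ t ∈ Finset.range T, M.expect (q t).toStoch (weightedGain M c δ t y) := by
    rw [Finset.mul_sum]
    calc (T : ℝ) = ∑ _t ∈ Finset.range T, (1 : ℝ) := by simp
      _ ≤ _ := Finset.sum_le_sum h1
  -- The gains are summed level by level, which produces `m`. For the widths `φ_k ≤ f` suffices, and
  -- no factor `m` appears.
  have h3 : f * (H + 1) * ∑ t ∈ Finset.range T, weightedGain M c δ t y (y t) ≤
      numLevels c * (16 / 3 * ((M.phiStar c).toReal + f) + f *
          (8 * Real.log (H * Fintype.card S * Fintype.card A) + 1)) +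
      f * (H * Fintype.card S * Fintype.card A *
        (1 + 48 * H * ucbBeta S A H δ T * (1 + Real.log (T + 1)))) := by
    calc _ = ∑ t ∈ Finset.range T,
          (M.phiSet (level c (levelIdx c y t))).toReal * advGain c y t +
        ∑ t ∈ Finset.range T, (M.phiSet (level c (levelIdx c y t))).toReal *
          ∑ h, width S A H δ (counts y t (h, y t h)) := by
          rw [← Finset.sum_add_distrib, Finset.mul_sum]
          refine Finset.sum_congr rfl fun t _ => ?_
          rw [hgain, Finset.sum_add_distrib, advGain]
          field_simp
      _ ≤ _ := by
          refine add_le_add (sum_phiSet_mul_advGain_le ⟨z₀, hz₀⟩ htop hT) ?_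
          refine le_trans ?_ (mul_le_mul_of_nonneg_left
            (sum_width_traj_le (y := y) hH hδ hδ1 T) hf0.le)
          rw [Finset.mul_sum]
          refine Finset.sum_le_sum fun t _ => ?_
          exact mul_le_mul_of_nonneg_right (phiSet_level_le htop _)
            (Finset.sum_nonneg fun h _ => width_nonneg hH hδ hδ1 _)
  -- The factor `4` is `2` from the accuracy of UCBVI times `2` from the Chernoff bound.
  have h4 := mul_le_mul_of_nonneg_left hch (by positivity : 0 ≤ 4 * (f * (H + 1)))
  nlinarith

end Episodes

/-! ### From the good event to the stopping time. -/

section Main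

set_option linter.unusedSectionVars false

variable {S A : Type*} {H : ℕ} [Fintype S] [Fintype A] {M : MDP S A H}
  {c : Fin H × S × A → ℝ} {y : ℕ → Traj S A H} {δ : ℝ}

theorem not_covered_of_lt_stoppingTime (hc : ∃ z, 0 < c z) {t : ℕ}
    (h : (t : ℕ∞) < stoppingTime c y) : ¬ Covered c y t := by
  intro hcov
  rcases Nat.eq_zero_or_pos t with rfl | ht
  · obtain ⟨z, hz⟩ := hc
    have := hcov z
    rw [counts_zero, Nat.cast_zero] at this
    linarith
  · exact absurd h (not_lt.2 (iInf₂_le t ⟨ht, hcov⟩))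

/-- A finite positive `τ` is `T + 1` for the last `T` before it; if `τ = ⊤`, the hypothesis would
bound every natural number. -/
theorem stoppingTime_le_ofReal {R : ℝ}
    (h : ∀ T : ℕ, (T : ℕ∞) < stoppingTime c y → (T : ℝ) + 1 ≤ R) :
    (stoppingTime c y : ℝ≥0∞) ≤ ENNReal.ofReal R := by
  cases hτ : stoppingTime c y with
  | top =>
    rw [hτ] at h
    have := h ⌈R⌉₊ (ENat.natCast_lt_top _)
    linarith [Nat.le_ceil R]
  | coe n =>
    rw [hτ] at h
    cases n with
    | zero => simp
    | succ n =>
      have h1 := h n (by exact_mod_cast n.lt_succ_self)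
      rw [ENat.toENNReal_coe, ← ENNReal.ofReal_natCast]
      refine ENNReal.ofReal_le_ofReal ?_
      push_cast
      exact h1

/-- Occupancies are at most one, so `c_max ≤ φ*(c)`, and `log₂ x ≤ x + 1`. This crude bound keeps
`log m` out of the poly-logarithmic factor. -/
theorem numLevels_le [Nonempty (Fin H)] (hc : ∃ z, 0 < c z) (htop : M.phiSet (target c) ≠ ⊤) :
    (numLevels c : ℝ) ≤ 2 + (M.phiStar c).toReal := by
  have hΦ : 0 ≤ (M.phiStar c).toReal := ENNReal.toReal_nonneg
  obtain ⟨z, hz⟩ := hc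
  have : Nonempty (Fin H × S × A) := ⟨z⟩
  obtain ⟨z', hz'⟩ := exists_eq_ciSup_of_finite (f := c)
  have hz'' : c z' = cmax c := hz'
  have hpos := cmax_pos ⟨z, hz⟩
  have h1 : cmax c ≤ (M.phiStar c).toReal := by
    have h2 := ENNReal.toReal_mono (phiStar_ne_top M ⟨z, hz⟩ htop)
      (ofReal_le_phiStar M (c := c) (z := z') (by rw [hz'']; exact hpos))
    rwa [hz'', ENNReal.toReal_ofReal hpos.le] at h2
  have hcm := one_le_cmin (c := c)
  unfold numLevels
  push_cast
  refine max_le ?_ (by linarith)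
  rcases le_total (Real.logb 2 (cmax c / cmin c)) 0 with h | h
  · rw [Nat.ceil_eq_zero.2 h, Nat.cast_zero]
    linarith
  · have h2 : Real.logb 2 (cmax c / cmin c) ≤ cmax c + 1 := by
      have hl := Real.log_two_gt_d9
      have hl' := Real.log_two_lt_d9
      have h3 : cmax c / cmin c ≤ cmax c := div_le_self hpos.le hcm
      have h4 := Real.log_le_log (by positivity) h3
      have h5 := Real.log_le_sub_one_of_pos (x := cmax c / 2) (by positivity)
      rw [Real.log_div hpos.ne' (by norm_num)] at h5
      rw [Real.logb, div_le_iff₀ (by linarith)]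
      nlinarith
    have h3 := (Nat.ceil_lt_add_one h).le
    linarith

theorem log_one_div_quarter (hδ : 0 < δ) :
    Real.log (1 / (δ / 4)) = 2 * Real.log 2 + Real.log (1 / δ) := by
  rw [show 1 / (δ / 4) = 2 ^ 2 * (1 / δ) by field_simp; norm_num,
    Real.log_mul (by norm_num) (by positivity), Real.log_pow]
  push_cast
  ring

theorem ucbBeta_eq [Nonempty S] [Nonempty A] (hH : 0 < H) (hδ : 0 < δ) (T : ℕ) :
    ucbBeta S A H (δ / 2) T = 2 * Real.log 2 + Real.log (Fintype.card S) +
      Real.log (Fintype.card A) + Real.log H + Real.log (1 / δ) +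
      Fintype.card S * (3 * Real.log 2 + 1 + Real.log (T + 1)) := by
  have hS : (0 : ℝ) < Fintype.card S := by exact_mod_cast Fintype.card_pos
  have hA : (0 : ℝ) < Fintype.card A := by exact_mod_cast Fintype.card_pos
  have hH' : (0 : ℝ) < H := by exact_mod_cast hH
  unfold ucbBeta
  rw [show (2 : ℝ) * Fintype.card S * Fintype.card A * H / (δ / 2) =
      2 ^ 2 * (Fintype.card S * Fintype.card A * H * (1 / δ)) by field_simp,
    show (8 : ℝ) * Real.exp 1 * (T + 1) = 2 ^ 3 * (Real.exp 1 * (T + 1)) by ring,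
    Real.log_mul (by norm_num) (by positivity), Real.log_mul (by positivity) (by positivity),
    Real.log_mul (by positivity) (by positivity), Real.log_mul (by positivity) (by positivity),
    Real.log_mul (by norm_num) (by positivity), Real.log_mul (by positivity) (by positivity),
    Real.log_pow, Real.log_pow, Real.log_exp]
  push_cast
  ring

theorem stoppingTime_le_of_good (hc : ∃ z, 0 < c z) (hδ : 0 < δ) (hδ1 : δ < 1)
    (htop : M.phiSet (target c) ≠ ⊤) (hy : TypicalRun M (δ / 2) y) {q : ℕ → DetPolicy S A H}
    (hq : ∀ t : ℕ, (t : ℕ∞) < stoppingTime c y →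
      IsGreedy (ucbQ (δ / 2) y t (advReward c y t)) (q t))
    (hch : ∀ T, (∑ t ∈ Finset.range T, M.expect (q t).toStoch (weightedGain M c (δ / 2) t y)) / 2 ≤
      ∑ t ∈ Finset.range T, weightedGain M c (δ / 2) t y (y t) + Real.log (1 / (δ / 4))) :
    (stoppingTime c y : ℝ≥0∞) ≤
      64 * (numLevels c : ℝ≥0∞) * M.phiStar c +
        (numLevels c : ℝ≥0∞) * M.phiStar (targetInd c) *
          ENNReal.ofReal (10 ^ 14 * polyLog M c δ 3 *
            (Fintype.card S * Fintype.card A * (H : ℝ) ^ 2 *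
              (Real.log (1 / δ) + Fintype.card S))) := by
  obtain ⟨z₀, hz₀⟩ := id hc
  have : Nonempty (Fin H) := ⟨z₀.1⟩
  have : Nonempty S := ⟨z₀.2.1⟩
  have : Nonempty A := ⟨z₀.2.2⟩
  have hH : 0 < H := Fin.pos z₀.1
  have hS1 : (1 : ℝ) ≤ Fintype.card S := by exact_mod_cast Fintype.card_pos
  have hA1 : (1 : ℝ) ≤ Fintype.card A := by exact_mod_cast Fintype.card_pos
  have hH1 : (1 : ℝ) ≤ H := by exact_mod_cast hH
  have hL : 0 ≤ Real.log (1 / δ) := Real.log_nonneg (by rw [le_div_iff₀ hδ]; linarith)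
  have hstar := phiStar_ne_top M hc htop
  have hf1 : 1 ≤ (M.phiSet (target c)).toReal := by
    have h1 := ofReal_le_phiStar M (c := targetInd c) (z := z₀)
      (by rw [targetInd, if_pos (mem_target.2 hz₀)]; exact one_pos)
    rw [targetInd, if_pos (mem_target.2 hz₀)] at h1
    have := ENNReal.toReal_mono htop h1
    simpa using this
  have hpoly : 0 ≤ polyLog M c δ 3 :=
    pow_nonneg (Real.log_nonneg (by
      linarith [ENNReal.toReal_nonneg (a := M.phiStar (targetInd c))])) _
  set B := 10 ^ 14 * polyLog M c δ 3 * (Fintype.card S * Fintype.card A * (H : ℝ) ^ 2 *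
    (Real.log (1 / δ) + Fintype.card S)) with hB
  have hB0 : 0 ≤ B := mul_nonneg (mul_nonneg (by norm_num) hpoly) (by positivity)
  have hrhs : ∀ b : ℝ, 0 ≤ b → 64 * (numLevels c : ℝ≥0∞) * M.phiStar c +
      (numLevels c : ℝ≥0∞) * M.phiStar (targetInd c) * ENNReal.ofReal b =
      ENNReal.ofReal (64 * (numLevels c * (M.phiStar c).toReal) +
        numLevels c * (M.phiSet (target c)).toReal * b) := fun b hb => by
    rw [ENNReal.ofReal_add (by positivity) (by positivity), ENNReal.ofReal_mul (by norm_num),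
      ENNReal.ofReal_mul (q := (M.phiStar c).toReal) (by positivity),
      ENNReal.ofReal_mul (q := b) (by positivity),
      ENNReal.ofReal_mul (q := (M.phiSet (target c)).toReal) (by positivity),
      ENNReal.ofReal_toReal hstar, ENNReal.ofReal_toReal htop,
      ENNReal.ofReal_natCast, phiSet_target, mul_assoc]
    norm_num
  rw [hrhs B hB0]
  refine stoppingTime_le_ofReal fun T hT => ?_
  have h1 := episodes_le_of_good hc (by positivity : 0 < δ / 2) (by linarith) htop hy
    (not_covered_of_lt_stoppingTime hc hT)
    (fun t ht => hq t (lt_trans (by exact_mod_cast ht) hT)) (hch T)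
  have hHSA : Real.log (H * Fintype.card S * Fintype.card A) =
      Real.log H + Real.log (Fintype.card S) + Real.log (Fintype.card A) := by
    rw [Real.log_mul (by positivity) (by positivity), Real.log_mul (by positivity) (by positivity)]
  rw [log_one_div_quarter hδ, hHSA] at h1
  have h2 := episodes_le (Nat.cast_nonneg T)
    (by exact_mod_cast one_le_numLevels (c := c)) ENNReal.toReal_nonneg
    (numLevels_le hc htop) hS1 hA1 hH1 hf1 hL (ucbBeta_eq hH hδ T) rfl h1
  rw [hB, polyLog, ← phiSet_target]
  exact h2

end Main

end ActiveCoverage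

theorem mainTheorem3 :
    ∃ (C : ℝ) (d : ℕ), 0 < C ∧
      ∀ (S A : Type*) [Fintype S] [Fintype A] (H : ℕ) (M : ActiveCoverage.MDP S A H)
        (c : Fin H × S × A → ℝ) (_ : ∃ z, 0 < c z) (δ : ℝ) (_ : 0 < δ) (_ : δ < 1)
        (Ω : Type*) [MeasurableSpace Ω] (μ : MeasureTheory.Measure Ω)
        [MeasureTheory.IsProbabilityMeasure μ]
        (pol : ℕ → Ω → ActiveCoverage.DetPolicy S A H)
        (traj : ℕ → Ω → ActiveCoverage.Traj S A H)
        (_ : ActiveCoverage.IsCovGameRun M c δ μ pol traj),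
        ENNReal.ofReal (1 - δ) ≤
          μ {ω | (ActiveCoverage.stoppingTime c (fun i => traj i ω) : ℝ≥0∞) ≤
            64 * (ActiveCoverage.numLevels c : ℝ≥0∞) * M.phiStar c +
              (ActiveCoverage.numLevels c : ℝ≥0∞) * M.phiStar (ActiveCoverage.targetInd c) *
                ENNReal.ofReal
                  (C * ActiveCoverage.polyLog M c δ d *
                    (Fintype.card S * Fintype.card A * (H : ℝ) ^ 2 *
                      (Real.log (1 / δ) + Fintype.card S)))} := by
  refine ⟨10 ^ 14, 3, by norm_num, ?_⟩
  intro S A _ _ H M c hc δ hδ hδ1 Ω _ μ _ pol traj hrun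
  obtain ⟨z₀, hz₀⟩ := id hc
  have : Nonempty (Fin H) := ⟨z₀.1⟩
  have : Nonempty S := ⟨z₀.2.1⟩
  have : Nonempty A := ⟨z₀.2.2⟩
  have hH : 0 < H := Fin.pos z₀.1
  have hL : 0 ≤ Real.log (1 / δ) := Real.log_nonneg (by rw [le_div_iff₀ hδ]; linarith)
  have hS1 : (1 : ℝ) ≤ Fintype.card S := by exact_mod_cast Fintype.card_pos
  have hA1 : (1 : ℝ) ≤ Fintype.card A := by exact_mod_cast Fintype.card_pos
  have hH1 : (1 : ℝ) ≤ H := by exact_mod_cast hH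
  set good := {ω | (ActiveCoverage.stoppingTime c (fun i => traj i ω) : ℝ≥0∞) ≤
    64 * (ActiveCoverage.numLevels c : ℝ≥0∞) * M.phiStar c +
      (ActiveCoverage.numLevels c : ℝ≥0∞) * M.phiStar (ActiveCoverage.targetInd c) *
        ENNReal.ofReal (10 ^ 14 * ActiveCoverage.polyLog M c δ 3 *
          (Fintype.card S * Fintype.card A * (H : ℝ) ^ 2 *
            (Real.log (1 / δ) + Fintype.card S)))} with hgood
  -- If `φ*(𝟙_𝒳) = ∞`, its coefficient is positive and the bound is infinite.
  by_cases htop : M.phiSet (ActiveCoverage.target c) = ⊤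
  · have huniv : good = Set.univ := by
      rw [ActiveCoverage.phiSet_target] at htop
      have hpos : 0 < 10 ^ 14 * ActiveCoverage.polyLog M c δ 3 *
          (Fintype.card S * Fintype.card A * (H : ℝ) ^ 2 *
            (Real.log (1 / δ) + Fintype.card S)) := by
        have : 0 < ActiveCoverage.polyLog M c δ 3 := pow_pos (Real.log_pos (by
          linarith [ENNReal.toReal_nonneg (a := M.phiStar (ActiveCoverage.targetInd c))])) _
        positivity
      have hm : (ActiveCoverage.numLevels c : ℝ≥0∞) ≠ 0 := by
        have := ActiveCoverage.one_le_numLevels (c := c)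
        exact_mod_cast (by omega : ActiveCoverage.numLevels c ≠ 0)
      rw [hgood, htop, ENNReal.mul_top hm, ENNReal.top_mul (by simpa using hpos), add_top]
      simp
    rw [huniv, MeasureTheory.measure_univ]
    exact ENNReal.ofReal_le_one.2 (by linarith)
  have hr : ActiveCoverage.IsRun M μ pol traj :=
    ⟨hrun.measurable_pol, hrun.measurable_traj, hrun.law⟩
  have hδ2 : 0 < δ / 2 := by positivity
  have b1 := hr.measure_not_typicalRun_le hδ2
  have b2 := hr.chernoff (ActiveCoverage.weightedGain M c (δ / 2))
    (fun t x x' h => ActiveCoverage.weightedGain_congr h)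
    (fun t x v => ActiveCoverage.weightedGain_nonneg hH hδ2 (by linarith) t v)
    (fun t x v => ActiveCoverage.weightedGain_le_one hH hδ2 (by linarith) htop t v)
    (ε := δ / 4) (by positivity)
  set bad1 := {ω | ¬ ActiveCoverage.TypicalRun M (δ / 2) fun i => traj i ω}
  set bad2 := {ω | ∃ T, ∑ t ∈ Finset.range T,
      ActiveCoverage.weightedGain M c (δ / 2) t (fun i => traj i ω) (traj t ω) +
        Real.log (1 / (δ / 4)) ≤
      (∑ t ∈ Finset.range T, M.expect (pol t ω).toStoch
        (ActiveCoverage.weightedGain M c (δ / 2) t (fun i => traj i ω))) / 2} with hbad2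
  have hsub : Set.univ ⊆ good ∪ (bad1 ∪ bad2) := by
    intro ω _
    by_cases h1 : ω ∈ bad1
    · exact Or.inr (Or.inl h1)
    by_cases h2 : ω ∈ bad2
    · exact Or.inr (Or.inr h2)
    left
    rw [hbad2, Set.mem_ofPred_eq, not_exists] at h2
    exact ActiveCoverage.stoppingTime_le_of_good hc hδ hδ1 htop (not_not.1 h1)
      (q := fun t => pol t ω) (fun t ht => hrun.greedy t ω ht) fun T => (not_le.1 (h2 T)).le
  -- Subadditivity suffices, so `good` need not be measurable. The two bad events cost `δ / 4` each.
  have h1 : 1 ≤ μ good + ENNReal.ofReal δ := by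
    calc 1 = μ Set.univ := MeasureTheory.measure_univ.symm
      _ ≤ μ good + (μ bad1 + μ bad2) :=
          (MeasureTheory.measure_mono hsub).trans ((MeasureTheory.measure_union_le _ _).trans
            (add_le_add_right (MeasureTheory.measure_union_le _ _) _))
      _ ≤ μ good + (ENNReal.ofReal (δ / 2 / 2) + ENNReal.ofReal (δ / 4)) := by gcongr
      _ ≤ μ good + ENNReal.ofReal δ := by
          rw [← ENNReal.ofReal_add (by positivity) (by positivity)]
          gcongr
          linarith
  rw [ENNReal.ofReal_sub _ hδ.le, ENNReal.ofReal_one]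
  exact tsub_le_iff_right.2 h1
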